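/- **Proposition 3.2.** All rings are unital; noetherian means left and right noetherian. A *pseudocompact* ring is a Hausdorff complete topological ring $R$ in which the open left ideals $L$ with $R/L$ of finite length form a fundamental system of neighbourhoods of $0$. Let $R$ be a noetherian pseudocompact ring, $\sigma$ a topological automorphism of $R$ and $\delta : R \to R$ a continuous left $\sigma$-derivation, i.e. a continuous additive map with $\delta(ab) = \delta(a)b + \sigma(a)\delta(b)$ for all $a, b \in R$. Assume that $\delta$ is $\sigma$-nilpotent: for every $n \ge 1$ there is an $m \ge 1$ such that every (noncommutative) composition of copies of $\delta$, $\sigma$, $\sigma^{-1}$ in which $\delta$ occurs at least $m$ times maps $R$ into $\mathrm{Jac}(R)^n$. Let $S = R[[t;\sigma,\delta]]$ be the skew power series ring, i.e. the left $R$-module of all formal power series $\sum_{i\ge 0} a_i t^i$ over $R$ with the multiplication $$\Big(\sum_{j\ge 0} a_j t^j\Big)\Big(\sum_{l\ge 0} b_l t^l\Big) = \sum_{m\ge 0}\Big(\sum_{n=0}^m \sum_{j\ge n} a_j M_{j-n,n}(\delta,\sigma)(b_{m-n})\Big)t^m ,$$ where $M_{k,l}(\delta,\sigma)$ is the sum of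 all noncommutative monomials in $\delta$ and $\sigma$ with $k$ factors $\delta$ and $l$ factors $\sigma$; so $ta = \sigma(a)t + \delta(a)$ for $a \in R$. Assume that $S$ is noetherian. For a noetherian ring $A$ and a finitely generated left or right $A$-module $N$ let $j_A(N) = \min\{i \ge 0 : \mathrm{Ext}^i_A(N,A) \ne 0\}$ be its grade or codimension (with $j_A(N) = \infty$ if all these groups vanish). The ring $A$ is *Auslander regular* if every finitely generated left or right $A$-module $N$ has a finite resolution by finitely generated projective modules, and if for every such $N$, every $k \ge 0$ and every $A$-submodule $N' \subseteq \mathrm{Ext}^k_A(N,A)$ one has $j_A(N') \ge k$. For $j \ge 0$ let $\mathcal{M}^j(A)$ be the class of all finitely generated left $A$-modules $M$ such that $\mathrm{Ext}^i_A(M',A) = 0$ for all $i < j$ and all submodules $M' \subseteq M$. Let $\mathcal{M}_R(S)$ be the class of all left $S$-modules which are finitely generated as $R$-modules. Assume that $R$ and $S$ are Auslander regular. Then for every $j \ge 0$ $$\mathcal{M}^j(R) \cap \mathcal{M}_R(S) = \mathcal{M}^{j+1}(S) \cap \mathcal{M}_R(S),$$ i.e. a module $M$ in $\mathcal{M}_R(S)$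 lies, as an $R$-module, in $\mathcal{M}^j(R)$ if and only if it lies in $\mathcal{M}^{j+1}(S)$. Moreover, $j_S(M) = j_R(M) + 1$ for every $M$ in $\mathcal{M}_R(S)$ (with $\infty = \infty + 1$ for $M = 0$). -/

import Mathlib

open CategoryTheory CategoryTheory.Abelian Topology

universe u

/-! ### Pseudocompact rings and skew derivations -/

/-- A (left) pseudocompact ring: a Hausdorff complete topological ring in which the open left ideals
`L` with `R ⧸ L` of finite length form a fundamental system of neighbourhoods of zero.
(The uniform structure is the one of the additive group, so it is determined by the topology.) -/
class IsPseudocompactRing (R : Type u) [Ring R] [UniformSpace R] : Prop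
    extends IsUniformAddGroup R, IsTopologicalRing R, T2Space R, CompleteSpace R where
  exists_leftIdeal_subset : ∀ U ∈ 𝓝 (0 : R), ∃ L : Ideal R,
    IsOpen (L : Set R) ∧ (L : Set R) ⊆ U ∧ IsFiniteLength R (R ⧸ L)

/-- `IsSkewMonomial σ δ k F`: the map `F` is the value at `(δ, σ, σ⁻¹)` of a noncommutative monomial
in three variables `Y, Z, Z'` with exactly `k` factors `Y`. -/
inductive IsSkewMonomial {R : Type u} [Ring R] (σ : R ≃+* R) (δ : R →+ R) : ℕ → (R →+ R) → Prop
  | one : IsSkewMonomial σ δ 0 (AddMonoidHom.id R)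
  | comp_delta {k : ℕ} {F : R →+ R} :
      IsSkewMonomial σ δ k F → IsSkewMonomial σ δ (k + 1) (F.comp δ)
  | comp_sigma {k : ℕ} {F : R →+ R} :
      IsSkewMonomial σ δ k F → IsSkewMonomial σ δ k (F.comp (σ : R →+ R))
  | comp_sigma_symm {k : ℕ} {F : R →+ R} :
      IsSkewMonomial σ δ k F → IsSkewMonomial σ δ k (F.comp (σ.symm : R →+ R))

/-- The data `(σ, δ)`: a topological automorphism `σ` of `R` and a continuous left
`σ`-derivation `δ` of `R` which is `σ`-nilpotent. -/
structure SkewDerivation (R : Type u) [Ring R] [UniformSpace R] where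
  σ : R ≃+* R
  δ : R →+ R
  continuous_sigma : Continuous σ
  continuous_sigma_symm : Continuous σ.symm
  continuous_delta : Continuous δ
  delta_mul : ∀ a b : R, δ (a * b) = δ a * b + σ a * δ b
  nilpotent : ∀ n : ℕ, 1 ≤ n → ∃ m : ℕ, 1 ≤ m ∧ ∀ k : ℕ, m ≤ k → ∀ F : R →+ R,
    IsSkewMonomial σ δ k F → ∀ a : R, F a ∈ Ring.jacobson R ^ n

namespace SkewDerivation

section Algebra

variable {R : Type u} [Ring R] [UniformSpace R] (D : SkewDerivation R)

/-- `D.words k l` is the sum of all noncommutative monomials in `δ` and `σ` with `k` factors `δ`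
and `l` factors `σ` (sorted by their outermost factor). -/
def words : ℕ → ℕ → (R →+ R)
  | 0, 0 => AddMonoidHom.id R
  | k + 1, 0 => D.δ.comp (words k 0)
  | 0, l + 1 => (D.σ : R →+ R).comp (words 0 l)
  | k + 1, l + 1 => D.δ.comp (words k (l + 1)) + (D.σ : R →+ R).comp (words (k + 1) l)

/-- Left multiplication by `t`, on coefficient sequences. -/
def tMul : (ℕ → R) →+ (ℕ → R) where
  toFun b m := Nat.casesOn m (D.δ (b 0)) fun i => D.σ (b i) + D.δ (b (i + 1))
  map_zero' := by
    funext m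
    cases m <;> simp
  map_add' a b := by
    funext m
    cases m
    · simp
    · simp only [Pi.add_apply, map_add]
      abel

@[simp] lemma tMul_zero (b : ℕ → R) : D.tMul b 0 = D.δ (b 0) := rfl

@[simp] lemma tMul_succ (b : ℕ → R) (i : ℕ) :
    D.tMul b (i + 1) = D.σ (b i) + D.δ (b (i + 1)) := rfl

/-- `t ^ j * b`, on coefficient sequences. -/
def tPow (j : ℕ) (b : ℕ → R) : ℕ → R := (D.tMul)^[j] b

@[simp] lemma tPow_zero (b : ℕ → R) : D.tPow 0 b = b := rfl

lemma tPow_succ (j : ℕ) (b : ℕ → R) : D.tPow (j + 1) b = D.tMul (D.tPow j b) :=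
  Function.iterate_succ_apply' _ _ _

lemma tPow_add (j : ℕ) (b c : ℕ → R) : D.tPow j (b + c) = D.tPow j b + D.tPow j c := by
  induction j with
  | zero => rfl
  | succ j ih => simp only [tPow_succ, ih, map_add]

lemma tPow_of_zero (j : ℕ) : D.tPow j (0 : ℕ → R) = 0 := by
  induction j with
  | zero => rfl
  | succ j ih => simp only [tPow_succ, ih, map_zero]

lemma tMul_smul (r : R) (b : ℕ → R) :
    D.tMul (r • b) = D.σ r • D.tMul b + D.δ r • b := by
  funext m
  cases m with
  | zero => simp [D.delta_mul, add_comm]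
  | succ m =>
    simp only [tMul_succ, Pi.smul_apply, smul_eq_mul, map_mul, D.delta_mul, Pi.add_apply, mul_add]
    abel

/-- The coefficient of `t ^ n` in `t ^ j * a`, as a function of `a`. -/
def wordsAt (j n : ℕ) : R →+ R := if n ≤ j then D.words (j - n) n else 0

lemma wordsAt_succ_zero (j : ℕ) (x : R) : D.wordsAt (j + 1) 0 x = D.δ (D.wordsAt j 0 x) := by
  simp [wordsAt, words]

lemma wordsAt_succ_succ (j n : ℕ) (x : R) :
    D.wordsAt (j + 1) (n + 1) x = D.σ (D.wordsAt j n x) + D.δ (D.wordsAt j (n + 1) x) := by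
  unfold wordsAt
  rcases lt_trichotomy n j with h | h | h
  · obtain ⟨k, rfl⟩ := Nat.exists_eq_add_of_lt h
    have e1 : n + k + 1 + 1 - (n + 1) = k + 1 := by omega
    have e2 : n + k + 1 - n = k + 1 := by omega
    have e3 : n + k + 1 - (n + 1) = k := by omega
    rw [if_pos (by omega), if_pos (by omega), if_pos (by omega), e1, e2, e3]
    simp [words, add_comm]
  · subst h
    simp [words]
  · rw [if_neg (by omega), if_neg (by omega), if_neg (by omega)]
    simp

lemma tPow_apply (j : ℕ) (b : ℕ → R) (m : ℕ) :
    D.tPow j b m = ∑ n ∈ Finset.range (m + 1), D.wordsAt j n (b (m - n)) := by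
  induction j generalizing m with
  | zero =>
    rw [Finset.sum_eq_single 0]
    · simp [wordsAt, words]
    · intro n _ hn
      simp [wordsAt, hn]
    · simp
  | succ j ih =>
    rw [tPow_succ]
    cases m with
    | zero => simp [ih, wordsAt_succ_zero]
    | succ m =>
      rw [tMul_succ, ih, ih, Finset.sum_range_succ' _ (m + 1), Finset.sum_range_succ' _ (m + 1)]
      simp only [map_add, map_sum, wordsAt_succ_succ, wordsAt_succ_zero, Finset.sum_add_distrib,
        Nat.add_sub_add_right]
      abel

lemma words_mem (L : AddSubgroup R) (m : ℕ)
    (h : ∀ k : ℕ, m ≤ k → ∀ F : R →+ R, IsSkewMonomial D.σ D.δ k F → ∀ a : R, F a ∈ L) :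
    ∀ (k l i : ℕ) (F : R →+ R), IsSkewMonomial D.σ D.δ i F → m ≤ k + i →
      ∀ a : R, F (D.words k l a) ∈ L
  | 0, 0, i, F, hF, hi, a => by
    rw [words]
    exact h i (by omega) F hF a
  | k + 1, 0, i, F, hF, hi, a => by
    rw [words]
    exact words_mem L m h k 0 (i + 1) _ hF.comp_delta (by omega) a
  | 0, l + 1, i, F, hF, hi, a => by
    rw [words]
    exact words_mem L m h 0 l i _ hF.comp_sigma hi a
  | k + 1, l + 1, i, F, hF, hi, a => by
    have h1 := words_mem L m h k (l + 1) (i + 1) _ hF.comp_delta (by omega) a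
    have h2 := words_mem L m h (k + 1) l i _ hF.comp_sigma hi a
    have := L.add_mem h1 h2
    simpa [words] using this

lemma delta_one : D.δ 1 = 0 := by
  have h := D.delta_mul 1 1
  simpa using h

lemma tPow_one (j : ℕ) : D.tPow j (Pi.single 0 1) = Pi.single j 1 := by
  induction j with
  | zero => rfl
  | succ j ih =>
    rw [D.tPow_succ, ih]
    funext m
    cases m with
    | zero =>
      cases j with
      | zero => simp [delta_one]
      | succ j => simp
    | succ m =>
      rw [D.tMul_succ]
      by_cases h : m = j
      · subst h
        simp
      · by_cases h' : m + 1 = j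
        · subst h'
          simp [delta_one]
        · simp [h, h']

end Algebra

end SkewDerivation

/-- A power of the Jacobson radical kills any module of finite length. -/
lemma IsFiniteLength.exists_jacobson_pow_smul {R : Type u} [Ring R] {M : Type u} [AddCommGroup M]
    [Module R M] (h : IsFiniteLength R M) :
    ∃ n : ℕ, 1 ≤ n ∧ ∀ r ∈ Ring.jacobson R ^ n, ∀ x : M, r • x = 0 := by
  induction h with
  | of_subsingleton => exact ⟨1, le_rfl, fun r _ x => Subsingleton.elim _ _⟩
  | @of_simple_quotient M _ _ N _ _ ih =>
    obtain ⟨n, hn, h⟩ := ih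
    refine ⟨n + 1, by omega, fun r hr x => ?_⟩
    have key : ∀ b ∈ Ring.jacobson R, ∀ x : M, b • x ∈ N := by
      intro b hb x
      have h1 : b • (Submodule.Quotient.mk x : M ⧸ N) ∈ Module.jacobson R (M ⧸ N) :=
        Ring.jacobson_smul_top_le R (M ⧸ N) (Submodule.smul_mem_smul hb trivial)
      rw [IsSimpleModule.jacobson_eq_bot, Submodule.mem_bot, ← Submodule.Quotient.mk_smul,
        Submodule.Quotient.mk_eq_zero] at h1
      exact h1
    replace hr : r ∈ (Ring.jacobson R ^ n : Submodule R R) * (Ring.jacobson R : Submodule R R) := hr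
    induction hr using Submodule.mul_induction_on' with
    | mem_mul_mem a ha b hb =>
      rw [mul_smul]
      have := h a ha ⟨b • x, key b hb x⟩
      simpa [Subtype.ext_iff] using this
    | add a _ b _ h1 h2 => rw [add_smul, h1, h2, add_zero]

namespace SkewDerivation

section Convergence

variable {R : Type u} [Ring R] [UniformSpace R] [IsPseudocompactRing R] (D : SkewDerivation R)

lemma exists_tPow_mem (L : Ideal R) (hL : IsFiniteLength R (R ⧸ L)) (m : ℕ) :
    ∃ J : ℕ, ∀ j, J ≤ j → ∀ b : ℕ → R, D.tPow j b m ∈ L := by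
  obtain ⟨n, hn, h⟩ := hL.exists_jacobson_pow_smul
  obtain ⟨k, -, hk⟩ := D.nilpotent n hn
  have hk' : ∀ i : ℕ, k ≤ i → ∀ F : R →+ R, IsSkewMonomial D.σ D.δ i F →
      ∀ a : R, F a ∈ L.toAddSubgroup := by
    intro i hi F hF a
    have := h _ (hk i hi F hF a) (Submodule.Quotient.mk (1 : R))
    rw [← Submodule.Quotient.mk_smul, Submodule.Quotient.mk_eq_zero] at this
    simpa using this
  refine ⟨k + m, fun j hj b => ?_⟩
  rw [tPow_apply]
  refine L.sum_mem fun i hi => ?_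
  rw [Finset.mem_range] at hi
  unfold wordsAt
  rw [if_pos (by omega)]
  exact D.words_mem L.toAddSubgroup k hk' (j - i) i 0 _ .one (by omega) _

lemma nonarchimedeanAddGroup (R : Type u) [Ring R] [UniformSpace R] [IsPseudocompactRing R] :
    NonarchimedeanAddGroup R where
  is_nonarchimedean U hU := by
    obtain ⟨L, hL, hLU, -⟩ := IsPseudocompactRing.exists_leftIdeal_subset U hU
    exact ⟨⟨L.toAddSubgroup, hL⟩, hLU⟩

lemma summable_aux (a : ℕ → R) (f : ℕ → R)
    (h : ∀ L : Ideal R, IsFiniteLength R (R ⧸ L) → ∃ J : ℕ, ∀ j, J ≤ j → f j ∈ L) :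
    Summable fun j => a j * f j := by
  have := nonarchimedeanAddGroup R
  apply NonarchimedeanAddGroup.summable_of_tendsto_cofinite_zero
  rw [Nat.cofinite_eq_atTop]
  intro U hU
  obtain ⟨L, -, hLU, hfl⟩ := IsPseudocompactRing.exists_leftIdeal_subset U hU
  obtain ⟨J, hJ⟩ := h L hfl
  rw [Filter.mem_map, Filter.mem_atTop_sets]
  exact ⟨J, fun j hj => hLU (L.mul_mem_left _ (hJ j hj))⟩

lemma summable_tPow (a b : ℕ → R) (m : ℕ) : Summable fun j => a j * D.tPow j b m :=
  summable_aux a _ fun L hL => (D.exists_tPow_mem L hL m).imp fun _ h j hj => h j hj b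

lemma summable_wordsAt (a : ℕ → R) (n : ℕ) (x : R) : Summable fun j => a j * D.wordsAt j n x := by
  refine summable_aux a _ fun L hL => ?_
  obtain ⟨J, hJ⟩ := D.exists_tPow_mem L hL n
  refine ⟨J, fun j hj => ?_⟩
  have := hJ j hj (Pi.single 0 x)
  rw [tPow_apply, Finset.sum_eq_single n] at this
  · simpa using this
  · intro i hi hin
    rw [Finset.mem_range] at hi
    rw [Pi.single_eq_of_ne (by omega), map_zero]
  · simp

/-- The coefficients of the product of `∑ aⱼ tʲ` and `∑ bₗ tˡ`:
`(∑ aⱼ tʲ) (∑ bₗ tˡ) = ∑ₘ (∑_{n ≤ m} ∑_{j ≥ n} aⱼ M_{j-n,n}(δ, σ)(b_{m-n})) tᵐ`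
(with `j = n + k`), where the inner sum is a convergent series in `R`. -/
noncomputable def mulCoeff (a b : ℕ → R) (m : ℕ) : R :=
  ∑ n ∈ Finset.range (m + 1), ∑' k : ℕ, a (n + k) * D.words k n (b (m - n))

/-- All the series in the definition of the product converge. -/
lemma summable_mulCoeff (a : ℕ → R) (n : ℕ) (x : R) :
    Summable fun k : ℕ => a (n + k) * D.words k n x := by
  have h := (summable_nat_add_iff n).2 (D.summable_wordsAt a n x)
  refine h.congr fun k => ?_
  simp [wordsAt, add_comm]

lemma mulCoeff_eq_tsum (a b : ℕ → R) (m : ℕ) :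
    D.mulCoeff a b m = ∑' j : ℕ, a j * D.tPow j b m := by
  unfold mulCoeff
  simp only [D.tPow_apply, Finset.mul_sum]
  rw [Summable.tsum_finsetSum fun n _ => D.summable_wordsAt a n _]
  refine Finset.sum_congr rfl fun n _ => ?_
  rw [← (D.summable_wordsAt a n (b (m - n))).sum_add_tsum_nat_add n, Finset.sum_eq_zero, zero_add]
  · refine tsum_congr fun k => ?_
    simp [wordsAt, add_comm]
  · intro j hj
    rw [Finset.mem_range] at hj
    simp [wordsAt, not_le.2 hj]

lemma hasSum_mulCoeff (a b : ℕ → R) :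
    HasSum (fun j : ℕ => a j • D.tPow j b) (D.mulCoeff a b) := by
  refine Pi.hasSum.2 fun m => ?_
  rw [mulCoeff_eq_tsum]
  exact (D.summable_tPow a b m).hasSum

lemma smul_mulCoeff (r : R) (a b : ℕ → R) : D.mulCoeff (r • a) b = r • D.mulCoeff a b := by
  funext m
  rw [Pi.smul_apply, mulCoeff_eq_tsum, mulCoeff_eq_tsum, smul_eq_mul,
    ← (D.summable_tPow a b m).tsum_mul_left]
  simp only [Pi.smul_apply, smul_eq_mul, mul_assoc]

lemma add_mulCoeff (a b c : ℕ → R) :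
    D.mulCoeff (a + b) c = D.mulCoeff a c + D.mulCoeff b c := by
  funext m
  rw [Pi.add_apply, mulCoeff_eq_tsum, mulCoeff_eq_tsum, mulCoeff_eq_tsum,
    ← (D.summable_tPow a c m).tsum_add (D.summable_tPow b c m)]
  simp only [Pi.add_apply, add_mul]

lemma mulCoeff_add (a b c : ℕ → R) :
    D.mulCoeff a (b + c) = D.mulCoeff a b + D.mulCoeff a c := by
  funext m
  rw [Pi.add_apply, mulCoeff_eq_tsum, mulCoeff_eq_tsum, mulCoeff_eq_tsum,
    ← (D.summable_tPow a b m).tsum_add (D.summable_tPow a c m)]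
  simp only [D.tPow_add, Pi.add_apply, mul_add]

lemma zero_mulCoeff (a : ℕ → R) : D.mulCoeff 0 a = 0 := by
  have h := D.add_mulCoeff 0 0 a
  rw [add_zero] at h
  exact left_eq_add.1 h

lemma mulCoeff_zero (a : ℕ → R) : D.mulCoeff a 0 = 0 := by
  have h := D.mulCoeff_add a 0 0
  rw [add_zero] at h
  exact left_eq_add.1 h

lemma continuous_tMul : Continuous D.tMul := by
  refine continuous_pi fun m => ?_
  cases m with
  | zero => exact D.continuous_delta.comp (continuous_apply 0)
  | succ m =>
    exact (D.continuous_sigma.comp (continuous_apply m)).add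
      (D.continuous_delta.comp (continuous_apply (m + 1)))

/-- Right multiplication by `c`, on coefficient sequences. -/
noncomputable def mulRight (c : ℕ → R) : (ℕ → R) →+ (ℕ → R) where
  toFun a := D.mulCoeff a c
  map_zero' := D.zero_mulCoeff c
  map_add' a b := D.add_mulCoeff a b c

lemma continuous_mulRight (c : ℕ → R) : Continuous (D.mulRight c) := by
  refine continuous_pi fun m => ?_
  have : Continuous ((Pi.evalAddMonoidHom (fun _ : ℕ => R) m).comp (D.mulRight c)) := by
    refine continuous_of_continuousAt_zero _ ?_
    intro U hU
    rw [map_zero] at hU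
    obtain ⟨L, hL, hLU, hfl⟩ := IsPseudocompactRing.exists_leftIdeal_subset U hU
    obtain ⟨J, hJ⟩ := D.exists_tPow_mem L hfl m
    have hcl : IsClosed (L : Set R) := L.toAddSubgroup.isClosed_of_isOpen hL
    have hV : ∀ j ∈ Finset.range J, ∀ᶠ a : ℕ → R in 𝓝 0, a j * D.tPow j c m ∈ L := by
      intro j _
      have hc : Continuous fun a : ℕ → R => a j * D.tPow j c m :=
        (continuous_apply j).mul continuous_const
      exact hc.continuousAt (hL.mem_nhds (by simp))
    rw [Filter.mem_map]
    filter_upwards [(Filter.eventually_all_finset _).2 hV] with a ha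
    apply hLU
    change D.mulCoeff a c m ∈ L
    rw [mulCoeff_eq_tsum]
    refine hcl.mem_of_tendsto (D.summable_tPow a c m).hasSum
      (Filter.Eventually.of_forall fun s => L.sum_mem fun j _ => ?_)
    by_cases hj : j < J
    · exact ha j (Finset.mem_range.2 hj)
    · exact L.mul_mem_left _ (hJ j (not_lt.1 hj) c)
  exact this

lemma tMul_mulCoeff (x c : ℕ → R) : D.mulCoeff (D.tMul x) c = D.tMul (D.mulCoeff x c) := by
  have h1 := (D.hasSum_mulCoeff x c).map D.tMul D.continuous_tMul
  have h2 := D.hasSum_mulCoeff (fun j => D.δ (x j)) c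
  let y : ℕ → R := fun j => Nat.casesOn j 0 fun i => D.σ (x i)
  have h3 := D.hasSum_mulCoeff y c
  have h4 : HasSum (fun j : ℕ => D.σ (x j) • D.tPow (j + 1) c) (D.mulCoeff y c) := by
    have h := (hasSum_nat_add_iff' 1).2 h3
    have hy : y 0 = 0 := rfl
    rw [Finset.sum_range_one, hy, zero_smul, sub_zero] at h
    exact h
  have h5 := h4.add h2
  have h6 : (D.tMul ∘ fun j : ℕ => x j • D.tPow j c) =
      fun j : ℕ => D.σ (x j) • D.tPow (j + 1) c + D.δ (x j) • D.tPow j c := by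
    funext j
    rw [Function.comp_apply, D.tMul_smul, D.tPow_succ]
  have h7 : D.tMul x = y + fun j => D.δ (x j) := by
    funext m
    cases m with
    | zero => exact (zero_add _).symm
    | succ m => rfl
  rw [h7, add_mulCoeff]
  rw [h6] at h1
  exact h5.unique h1

lemma tPow_mulCoeff (j : ℕ) (x c : ℕ → R) :
    D.mulCoeff (D.tPow j x) c = D.tPow j (D.mulCoeff x c) := by
  induction j with
  | zero => rfl
  | succ j ih => rw [D.tPow_succ, D.tPow_succ, tMul_mulCoeff, ih]

lemma mulCoeff_assoc (a b c : ℕ → R) :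
    D.mulCoeff (D.mulCoeff a b) c = D.mulCoeff a (D.mulCoeff b c) := by
  have h1 := (D.hasSum_mulCoeff a b).map (D.mulRight c) (D.continuous_mulRight c)
  have h2 := D.hasSum_mulCoeff a (D.mulCoeff b c)
  have h3 : (D.mulRight c ∘ fun j : ℕ => a j • D.tPow j b) =
      fun j : ℕ => a j • D.tPow j (D.mulCoeff b c) := by
    funext j
    change D.mulCoeff (a j • D.tPow j b) c = _
    rw [smul_mulCoeff, tPow_mulCoeff]
  rw [h3] at h1
  exact h1.unique h2

lemma mulCoeff_one (a : ℕ → R) : D.mulCoeff a (Pi.single 0 1) = a := by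
  funext m
  rw [mulCoeff_eq_tsum, tsum_eq_single m]
  · rw [tPow_one, Pi.single_eq_same, mul_one]
  · intro j hj
    rw [tPow_one, Pi.single_eq_of_ne hj.symm, mul_zero]

lemma single_mulCoeff (i : ℕ) (a : ℕ → R) : D.mulCoeff (Pi.single i 1) a = D.tPow i a := by
  funext m
  rw [mulCoeff_eq_tsum, tsum_eq_single i]
  · rw [Pi.single_eq_same, one_mul]
  · intro j hj
    rw [Pi.single_eq_of_ne hj, zero_mul]

end Convergence

end SkewDerivation

/-! ### The skew power series ring -/

/-- The skew power series ring `R[[t; σ, δ]]`: its elements are the formal power series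
`∑ aᵢ tⁱ`, given by their (left) coefficients `aᵢ`. -/
def SkewPowerSeries {R : Type u} [Ring R] [UniformSpace R] (_D : SkewDerivation R) : Type u :=
  ℕ → R

namespace SkewPowerSeries

variable {R : Type u} [Ring R] [UniformSpace R] {D : SkewDerivation R}

/-- The coefficient of `t ^ m`. -/
def coeff (m : ℕ) (a : SkewPowerSeries D) : R := a m

/-- The power series with given coefficients. -/
def mk (a : ℕ → R) : SkewPowerSeries D := a

instance : AddCommGroup (SkewPowerSeries D) := inferInstanceAs (AddCommGroup (ℕ → R))

/-- The left `R`-module structure, coefficientwise. -/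
instance : Module R (SkewPowerSeries D) := inferInstanceAs (Module R (ℕ → R))

noncomputable instance [IsPseudocompactRing R] : Ring (SkewPowerSeries D) :=
  { (inferInstance : AddCommGroup (SkewPowerSeries D)) with
    mul := fun a b => mk (D.mulCoeff (fun i => coeff i a) (fun i => coeff i b))
    one := mk (Pi.single 0 1)
    left_distrib := D.mulCoeff_add
    right_distrib := D.add_mulCoeff
    zero_mul := D.zero_mulCoeff
    mul_zero := D.mulCoeff_zero
    mul_assoc := D.mulCoeff_assoc
    one_mul := D.single_mulCoeff 0
    mul_one := D.mulCoeff_one }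

lemma coeff_mul [IsPseudocompactRing R] (m : ℕ) (a b : SkewPowerSeries D) :
    coeff m (a * b) =
      ∑ n ∈ Finset.range (m + 1), ∑' k : ℕ, coeff (n + k) a * D.words k n (coeff (m - n) b) := rfl

/-- The variable `t`. -/
def X : SkewPowerSeries D := mk (Pi.single 1 1)

/-- The defining relation `t a = σ(a) t + δ(a)`, with `a ∈ R` embedded as `a • 1`. -/
lemma X_mul_smul_one [IsPseudocompactRing R] (a : R) :
    (X : SkewPowerSeries D) * a • (1 : SkewPowerSeries D) = D.σ a • X + D.δ a • 1 := by
  have h := D.tMul_smul a (Pi.single 0 1)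
  have h1 : D.tMul (Pi.single 0 1) = Pi.single 1 1 := D.tPow_one 1
  rw [h1] at h
  exact (D.single_mulCoeff 1 _).trans h

end SkewPowerSeries

/-! ### Grade, Auslander regularity and the codimension filtration -/

/-- `Ext^k_A(N, A)`, for a left `A`-module `N`, in the category of left `A`-modules. -/
abbrev ExtDual (A : Type u) [Ring A] (N : Type u) [AddCommGroup N] [Module A N] (k : ℕ) : Type u :=
  Ext (ModuleCat.of A N) (ModuleCat.of A A) k

/-- Right multiplication by `a`, an endomorphism of the left `A`-module `A`. -/
def mulRightEnd (A : Type u) [Ring A] (a : A) : ModuleCat.of A A ⟶ ModuleCat.of A A :=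
  ModuleCat.ofHom (LinearMap.toSpanSingleton A A a)

/-- The right `A`-module structure on `Ext^k_A(N, A)`, induced by the right multiplications
on the left `A`-module `A`. -/
noncomputable instance ExtDual.instModule (A : Type u) [Ring A] (N : Type u) [AddCommGroup N]
    [Module A N] (k : ℕ) : Module Aᵐᵒᵖ (ExtDual A N k) where
  smul a e := e.comp (Ext.mk₀ (mulRightEnd A a.unop)) (add_zero k)
  one_smul e := by
    have : mulRightEnd A (1 : Aᵐᵒᵖ).unop = 𝟙 _ := by
      ext
      simp [mulRightEnd]
    change e.comp (Ext.mk₀ (mulRightEnd A (1 : Aᵐᵒᵖ).unop)) (add_zero k) = e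
    rw [this, Ext.comp_mk₀_id]
  mul_smul a b e := by
    have : mulRightEnd A (a * b).unop = mulRightEnd A b.unop ≫ mulRightEnd A a.unop := by
      ext
      simp [mulRightEnd]
    change e.comp (Ext.mk₀ (mulRightEnd A (a * b).unop)) (add_zero k) =
      (e.comp (Ext.mk₀ (mulRightEnd A b.unop)) (add_zero k)).comp
        (Ext.mk₀ (mulRightEnd A a.unop)) (add_zero k)
    rw [this, ← Ext.mk₀_comp_mk₀, Ext.comp_assoc_of_third_deg_zero]
  smul_zero a := Ext.zero_comp _ _ _ _ _
  smul_add a e f := Ext.add_comp _ _ _ _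
  add_smul a b e := by
    have : mulRightEnd A (a + b).unop = mulRightEnd A a.unop + mulRightEnd A b.unop := by
      ext
      simp [mulRightEnd]
    change e.comp (Ext.mk₀ (mulRightEnd A (a + b).unop)) (add_zero k) =
      e.comp (Ext.mk₀ (mulRightEnd A a.unop)) (add_zero k) +
        e.comp (Ext.mk₀ (mulRightEnd A b.unop)) (add_zero k)
    rw [this, Ext.mk₀_add, Ext.comp_add]
  zero_smul e := by
    have : mulRightEnd A (0 : Aᵐᵒᵖ).unop = 0 := by
      ext
      simp [mulRightEnd]
    change e.comp (Ext.mk₀ (mulRightEnd A (0 : Aᵐᵒᵖ).unop)) (add_zero k) = 0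
    rw [this, Ext.mk₀_zero, Ext.comp_zero]

/-- The grade (or codimension) `j_A(N)`: the smallest `i` with `Ext^i_A(N, A) ≠ 0`,
and `∞` if there is none. -/
noncomputable def moduleGrade (A : Type u) [Ring A] (N : Type u) [AddCommGroup N] [Module A N] : ℕ∞ :=
  sInf ((fun i : ℕ => (i : ℕ∞)) '' {i : ℕ | Nontrivial (ExtDual A N i)})

/-- Every finitely generated left `A`-module has a finite resolution by finitely generated
projective modules. -/
def IsLeftRegularRing (A : Type u) [Ring A] : Prop :=
  ∀ (N : Type u) [AddCommGroup N] [Module A N], Module.Finite A N →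
    ∃ (P : ProjectiveResolution (ModuleCat.of A N)) (d : ℕ),
      (∀ n, Module.Finite A (P.complex.X n)) ∧ ∀ n, d < n → Limits.IsZero (P.complex.X n)

/-- The Auslander condition for finitely generated left `A`-modules `N`: every right submodule `N'`
of `Ext^k_A(N, A)` has grade at least `k`. Right `A`-modules are left modules over the
ring `B`, which is identified with the opposite ring of `A` through `e`. -/
def AuslanderCondition (A B : Type u) [Ring A] [Ring B] (e : B ≃+* Aᵐᵒᵖ) : Prop :=
  ∀ (N : Type u) [AddCommGroup N] [Module A N], Module.Finite A N → ∀ k : ℕ,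
    letI : Module B (ExtDual A N k) := Module.compHom _ (e : B →+* Aᵐᵒᵖ)
    ∀ N' : Submodule B (ExtDual A N k), (k : ℕ∞) ≤ moduleGrade B N'

/-- `A` is (left and right) Auslander regular. Right `A`-modules are left `Aᵐᵒᵖ`-modules, and right
`Aᵐᵒᵖ`-modules are left `A`-modules. -/
structure IsAuslanderRegular (A : Type u) [Ring A] : Prop where
  left_regular : IsLeftRegularRing A
  right_regular : IsLeftRegularRing Aᵐᵒᵖ
  left_auslander : AuslanderCondition A Aᵐᵒᵖ (RingEquiv.refl Aᵐᵒᵖ)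
  right_auslander : AuslanderCondition Aᵐᵒᵖ A (RingEquiv.opOp A)

/-- The left `A`-module `M` belongs to the category `𝓜^j(A)`: it is finitely generated and
`Ext^i_A(M', A) = 0` for all `i < j` and all submodules `M'` of `M`. -/
def MemCodim (A : Type u) [Ring A] (j : ℕ) (M : Type u) [AddCommGroup M] [Module A M] : Prop :=
  Module.Finite A M ∧
    ∀ M' : Submodule A M, ∀ i : ℕ, i < j → Subsingleton (ExtDual A M' i)

/-! Write `S` for the skew power series ring. Everything rests on a comparison,
`subsingleton_extDual_succ_iff`: for `M` finitely generated over `R`, `Ext^{l+1}_S(M, S)` vanishes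
exactly when `Ext^l_R(M, R)` does, while `Ext^0_S(M, S)` is always zero. The grade formula follows
at once. For the codimension classes, passing from `R` to `S` only restricts attention to
`S`-submodules. In the other direction all `R`-submodules must be controlled, and here the Auslander
condition on `R` ensures that the grade does not drop on submodules
(`ExtDual.subsingleton_submodule`).

The comparison uses test modules `P = S^ι / S^ι (t - A)`, called `RowModule`, with `A` a constant
matrix for which `x ↦ σ(x) A + δ(x)` is topologically nilpotent. Division with remainder by `t - A`
is then possible on rows and on columns. Row division shows that `t - A` is injective and that `P`
is free over `R` on the images of the standard basis. Column division computes the dual of this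
length-one resolution: `Ext^1_S(P, S)` is `Hom_R(P, R)`, naturally in `P`, and all other Ext groups
vanish.

Since `t` acts nilpotently modulo the `(σ, δ)`-stable radical (`exists_X_pow_smul_mem`), companion
matrices present every `M` as a quotient of such a `P`. The kernel is again finitely generated over
the noetherian ring `R`, so it is also covered by a test module, and the comparison follows by
dimension shifting. -/

namespace IsPseudocompactRing

/-! ### Linear compactness of pseudocompact rings. -/

variable {R : Type u} [Ring R] [UniformSpace R] [IsPseudocompactRing R]

lemma isClosed_of_isOpen {L : Ideal R} (hL : IsOpen (L : Set R)) : IsClosed (L : Set R) :=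
  L.toAddSubgroup.isClosed_of_isOpen hL

variable (R) in
/-- The open left ideals of finite colength. -/
abbrev OpenIdeal : Type u := {L : Ideal R // IsOpen (L : Set R) ∧ IsFiniteLength R (R ⧸ L)}

lemma exists_openIdeal_le {L : Ideal R} (hL : IsOpen (L : Set R)) :
    ∃ U : OpenIdeal R, U.1 ≤ L := by
  obtain ⟨U, hU, hUL, hfl⟩ := exists_leftIdeal_subset (L : Set R) (hL.mem_nhds L.zero_mem)
  exact ⟨⟨U, hU, hfl⟩, hUL⟩

/-- A family of cosets of left ideals with the finite intersection property. -/
def HasFIP (A : Set (R × Ideal R)) : Prop :=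
  ∀ t : Finset (R × Ideal R), (t : Set (R × Ideal R)) ⊆ A → ∃ z : R, ∀ p ∈ t, z - p.1 ∈ p.2

omit [UniformSpace R] [IsPseudocompactRing R] in
-- As `R ⧸ U` is artinian, some finite subfamily `t` of `A` has an intersection of ideals with
-- minimal image modulo `U`. For a point `y` common to the cosets in `t`, the coset `y + U` meets
-- every finite intersection, because adding further cosets no longer shrinks that image. Maximality
-- then puts `(y, U)` in `A`.
lemma HasFIP.exists_mem_of_maximal {A : Set (R × Ideal R)}
    (hA : Maximal (· ∈ {A : Set (R × Ideal R) | HasFIP A}) A) (U : Ideal R)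
    (hU : IsFiniteLength R (R ⧸ U)) : ∃ y, (y, U) ∈ A := by
  classical
  have hfip : HasFIP A := hA.prop
  have hart : IsArtinian R (R ⧸ U) := (isFiniteLength_iff_isNoetherian_isArtinian.1 hU).2
  let N : Finset (R × Ideal R) → Ideal R := fun t => t.inf Prod.snd
  obtain ⟨_, ⟨t, ht, rfl⟩, hmin⟩ := (wellFounded_lt (α := Submodule R (R ⧸ U))).has_min
    ((fun t => Submodule.map U.mkQ (N t)) '' {t | (t : Set (R × Ideal R)) ⊆ A}) ⟨_, ∅, by simp, rfl⟩
  obtain ⟨y, hy⟩ := hfip t ht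
  refine ⟨y, ?_⟩
  have key : HasFIP (insert (y, U) A) := by
    intro s hs
    let s' := s.erase (y, U)
    have hs' : (s' : Set (R × Ideal R)) ⊆ A := by
      intro p hp
      have hp' := Finset.mem_erase.1 (Finset.mem_coe.1 hp)
      exact (hs (Finset.mem_coe.2 hp'.2)).resolve_left hp'.1
    have hts : ((t ∪ s' : Finset _) : Set (R × Ideal R)) ⊆ A := by
      rw [Finset.coe_union]
      exact Set.union_subset ht hs'
    obtain ⟨z, hz⟩ := hfip _ hts
    have h1 : Submodule.map U.mkQ (N (t ∪ s')) = Submodule.map U.mkQ (N t) := by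
      refine le_antisymm (Submodule.map_mono (Finset.inf_mono Finset.subset_union_left)) ?_
      by_contra hcon
      exact hmin _ ⟨_, hts, rfl⟩ (lt_of_le_not_ge
        (Submodule.map_mono (Finset.inf_mono Finset.subset_union_left)) hcon)
    have h2 : U.mkQ (y - z) ∈ Submodule.map U.mkQ (N t) := by
      refine Submodule.mem_map_of_mem (Submodule.mem_finsetInf.2 fun p hp => ?_)
      have := p.2.sub_mem (hy p hp) (hz p (Finset.mem_union_left _ hp))
      simpa using this
    rw [← h1] at h2
    obtain ⟨n, hn, hnz⟩ := h2
    refine ⟨z + n, fun p hp => ?_⟩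
    by_cases h : p = (y, U)
    · subst h
      have := (Submodule.Quotient.eq U).1 hnz
      have h3 : z + n - y = n - (y - z) := by abel
      change z + n - y ∈ U
      rw [h3]
      exact this
    · have hp' : p ∈ t ∪ s' := Finset.mem_union_right _ (Finset.mem_erase.2 ⟨h, hp⟩)
      have h3 : z + n - p.1 = (z - p.1) + n := by abel
      rw [h3]
      exact p.2.add_mem (hz p hp') (Submodule.mem_finsetInf.1 hn p hp')
  exact hA.le_of_ge key (Set.subset_insert _ _) (Set.mem_insert _ _)

/-- Linear compactness, for descending sequences of cosets of open left ideals. -/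
theorem exists_forall_sub_mem (K : ℕ → Ideal R) (hK : Antitone K)
    (hop : ∀ k, IsOpen (K k : Set R)) (x : ℕ → R) (hx : ∀ k, x (k + 1) - x k ∈ K k) :
    ∃ y, ∀ k, y - x k ∈ K k := by
  classical
  have hx' : ∀ k l, k ≤ l → x l - x k ∈ K k := by
    intro k l hkl
    induction l, hkl using Nat.le_induction with
    | base => simp
    | succ l hl ih =>
      have := (K k).add_mem (hK hl (hx l)) ih
      simpa using this
  have h0 : HasFIP (Set.range fun k => (x k, K k)) := by
    intro t ht
    have : ∃ n, ∀ p ∈ t, ∃ k ≤ n, (x k, K k) = p := by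
      have h : ∀ p : t, ∃ k, (x k, K k) = p.1 := fun p => ht p.2
      choose f hf using h
      refine ⟨Finset.univ.sup f, fun p hp => ⟨f ⟨p, hp⟩, Finset.le_sup (Finset.mem_univ _), hf _⟩⟩
    obtain ⟨n, hn⟩ := this
    refine ⟨x n, fun p hp => ?_⟩
    obtain ⟨k, hk, rfl⟩ := hn p hp
    exact hx' k n hk
  -- A maximal family contains a coset of every open left ideal of finite colength. These cosets
  -- generate a Cauchy filter whose limit is the required point.
  obtain ⟨A, hsub, hmax⟩ := zorn_subset_nonempty {A : Set (R × Ideal R) | HasFIP A} (by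
    intro c hc hchain hne
    refine ⟨⋃₀ c, fun t ht => ?_, fun s hs => Set.subset_sUnion_of_mem hs⟩
    rw [Set.sUnion_eq_biUnion] at ht
    obtain ⟨s, hs, hts⟩ := DirectedOn.exists_mem_subset_of_finset_subset_biUnion
      (f := fun s : Set (R × Ideal R) => s) hne hchain.directedOn ht
    exact hc hs t hts) _ h0
  have hfip : HasFIP A := hmax.prop
  have hpair : ∀ p ∈ A, ∀ q ∈ A, ∃ z, z - p.1 ∈ p.2 ∧ z - q.1 ∈ q.2 := by
    intro p hp q hq
    obtain ⟨z, hz⟩ := hfip {p, q} (by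
      intro r hr
      simp only [Finset.coe_insert, Finset.coe_singleton, Set.mem_insert_iff,
        Set.mem_singleton_iff] at hr
      rcases hr with rfl | rfl <;> assumption)
    exact ⟨z, hz p (by simp), hz q (by simp)⟩
  choose y hy using fun U : OpenIdeal R => HasFIP.exists_mem_of_maximal hmax U.1 U.2.2
  -- Two cosets in `A` always meet, so the chosen coset of `W` lies inside every coset in `A` whose
  -- ideal contains `W`.
  have hle : ∀ (p : R × Ideal R), p ∈ A → ∀ W : OpenIdeal R, W.1 ≤ p.2 → ∀ z, z - y W ∈ W.1 →
      z - p.1 ∈ p.2 := by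
    intro p hp W hW z hz
    obtain ⟨w, hw1, hw2⟩ := hpair p hp _ (hy W)
    have h3 : z - p.1 = (z - y W) - (w - y W) + (w - p.1) := by abel
    rw [h3]
    exact p.2.add_mem (p.2.sub_mem (hW hz) (hW hw2)) hw1
  let F : Filter R := ⨅ U : OpenIdeal R, Filter.principal {z | z - y U ∈ U.1}
  have hmem : ∀ U : OpenIdeal R, {z | z - y U ∈ U.1} ∈ F := fun U =>
    Filter.mem_iInf_of_mem U (Filter.mem_principal_self _)
  have : Nonempty (OpenIdeal R) := let ⟨U, _⟩ := exists_openIdeal_le (R := R) (L := ⊤) isOpen_univ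
    ⟨U⟩
  have hne : F.NeBot := by
    refine Filter.iInf_neBot_of_directed' ?_ fun U => ?_
    · intro U V
      obtain ⟨W, hW⟩ := exists_openIdeal_le (L := U.1 ⊓ V.1) (U.2.1.inter V.2.1)
      refine ⟨W, Filter.principal_mono.2 fun z hz => ?_, Filter.principal_mono.2 fun z hz => ?_⟩
      · exact hle _ (hy U) W (hW.trans inf_le_left) z hz
      · exact hle _ (hy V) W (hW.trans inf_le_right) z hz
    · rw [Filter.principal_neBot_iff]
      exact ⟨y U, by simp⟩
  have hcauchy : Cauchy F := by
    refine cauchy_iff.2 ⟨hne, fun s hs => ?_⟩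
    rw [uniformity_eq_comap_nhds_zero, Filter.mem_comap] at hs
    obtain ⟨V, hV, hVs⟩ := hs
    obtain ⟨L, hL, hLV, hfl⟩ := exists_leftIdeal_subset V hV
    refine ⟨_, hmem ⟨L, hL, hfl⟩, ?_⟩
    rintro ⟨a, b⟩ ⟨ha, hb⟩
    refine hVs (hLV ?_)
    have := L.sub_mem hb ha
    simpa using this
  obtain ⟨z, hz⟩ := CompleteSpace.complete hcauchy
  refine ⟨z, fun k => ?_⟩
  obtain ⟨U, hU⟩ := exists_openIdeal_le (hop k)
  have hcl : IsClosed {w | w - x k ∈ (K k : Set R)} :=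
    (isClosed_of_isOpen (hop k)).preimage (continuous_id.sub continuous_const)
  have : z ∈ {w | w - x k ∈ (K k : Set R)} := by
    refine hcl.mem_of_tendsto (f := id) (b := F) hz ?_
    filter_upwards [hmem U] with w hw
    exact hle (x k, K k) (hsub ⟨k, rfl⟩) U hU w hw
  exact this

end IsPseudocompactRing

/-! ### The intersection of the open maximal left ideals. -/

namespace IsPseudocompactRing

variable {R : Type u} [Ring R] [UniformSpace R]

variable (R) in
/-- The intersection of the open maximal left ideals. -/
def openJacobson : Ideal R := sInf {M : Ideal R | M.IsMaximal ∧ IsOpen (M : Set R)}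

lemma openJacobson_le {M : Ideal R} (hM : M.IsMaximal) (ho : IsOpen (M : Set R)) :
    openJacobson R ≤ M := sInf_le ⟨hM, ho⟩

lemma jacobson_le_openJacobson : Ring.jacobson R ≤ openJacobson R := by
  refine le_sInf fun M hM => ?_
  rw [Ring.jacobson_eq_sInf_isMaximal]
  exact sInf_le hM.1

/-- The annihilator of a nonzero element of a simple module is a maximal left ideal, here assumed
open. -/
lemma openJacobson_smul_eq_zero {V : Type u} [AddCommGroup V] [Module R V] [IsSimpleModule R V]
    (v : V) (ho : IsOpen {a : R | a • v = 0}) {a : R} (ha : a ∈ openJacobson R) : a • v = 0 := by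
  by_cases hv : v = 0
  · simp [hv]
  · exact openJacobson_le (M := LinearMap.ker (LinearMap.toSpanSingleton R V v))
      (IsSimpleModule.ker_toSpanSingleton_isMaximal R hv) ho ha

lemma mem_openJacobson_of_ringEquiv (σ : R ≃+* R) (hσ : Continuous σ) {a : R}
    (ha : a ∈ openJacobson R) : σ a ∈ openJacobson R := by
  refine Submodule.mem_sInf.2 fun M hM => ?_
  have : (Ideal.comap σ M).IsMaximal := by
    have := hM.1
    exact Ideal.comap_isMaximal_of_equiv σ
  exact openJacobson_le this (hM.2.preimage hσ) ha

lemma isOpen_smul_mk [IsTopologicalRing R] {L : Ideal R} (hL : IsOpen (L : Set R)) (v : R ⧸ L) :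
    IsOpen {a : R | a • v = 0} := by
  obtain ⟨r, rfl⟩ := Submodule.Quotient.mk_surjective L v
  have : {a : R | a • (Submodule.Quotient.mk r : R ⧸ L) = 0} = (fun a => a * r) ⁻¹' L := by
    ext a
    rw [Set.mem_ofPred_eq, ← Submodule.Quotient.mk_smul, Submodule.Quotient.mk_eq_zero]
    rfl
  rw [this]
  exact hL.preimage (continuous_mul_const r)

instance [IsTopologicalRing R] : (openJacobson R).IsTwoSided where
  mul_mem_of_left {a} r ha := by
    refine Submodule.mem_sInf.2 fun M hM => ?_
    have hs : IsSimpleModule R (R ⧸ M) := isSimpleModule_iff_isCoatom.2 hM.1.out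
    have := openJacobson_smul_eq_zero (Submodule.Quotient.mk r : R ⧸ M) (isOpen_smul_mk hM.2 _) ha
    rwa [← Submodule.Quotient.mk_smul, Submodule.Quotient.mk_eq_zero] at this

/-- Induction on a composition series: openness of annihilators passes to the simple factors, each
of which is killed by `openJacobson R`. -/
lemma exists_openJacobson_pow_smul [IsTopologicalRing R] {M : Type u} [AddCommGroup M] [Module R M]
    (h : IsFiniteLength R M) (ho : ∀ x : M, IsOpen {a : R | a • x = 0}) :
    ∃ n : ℕ, 1 ≤ n ∧ ∀ r ∈ openJacobson R ^ n, ∀ x : M, r • x = 0 := by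
  induction h with
  | of_subsingleton => exact ⟨1, le_rfl, fun r _ x => Subsingleton.elim _ _⟩
  | @of_simple_quotient M _ _ N _ _ ih =>
    obtain ⟨n, hn, h⟩ := ih fun x => by
      convert ho x.1 using 3
      exact Subtype.ext_iff
    refine ⟨n + 1, by omega, fun r hr x => ?_⟩
    have key : ∀ b ∈ openJacobson R, ∀ x : M, b • x ∈ N := by
      intro b hb x
      have h1 := openJacobson_smul_eq_zero (Submodule.Quotient.mk x : M ⧸ N) (by
        have h2 : {a : R | a • (Submodule.Quotient.mk x : M ⧸ N) = 0} =
            (AddMonoidHom.ker (LinearMap.toSpanSingleton R (M ⧸ N)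
              (Submodule.Quotient.mk x)).toAddMonoidHom : Set R) := rfl
        rw [h2]
        refine AddSubgroup.isOpen_mono (H₁ := AddMonoidHom.ker
          (LinearMap.toSpanSingleton R M x).toAddMonoidHom) (fun a ha => ?_) (ho x)
        have ha' : a • x = 0 := ha
        change a • (Submodule.Quotient.mk x : M ⧸ N) = 0
        rw [← Submodule.Quotient.mk_smul, ha', Submodule.Quotient.mk_zero]) hb
      rwa [← Submodule.Quotient.mk_smul, Submodule.Quotient.mk_eq_zero] at h1
    replace hr : r ∈ (openJacobson R ^ n : Submodule R R) * (openJacobson R : Submodule R R) := hr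
    induction hr using Submodule.mul_induction_on' with
    | mem_mul_mem a ha b hb =>
      rw [mul_smul]
      have := h a ha ⟨b • x, key b hb x⟩
      simpa [Subtype.ext_iff] using this
    | add a _ b _ h1 h2 => rw [add_smul, h1, h2, add_zero]

variable [IsPseudocompactRing R]

/-- Otherwise there are open maximal left ideals `L n`, none containing the intersection `K n` of
its predecessors. The ascending chain of tail intersections `Z n` becomes constant from some `n` on.
Linear compactness yields `y` congruent to `1` modulo `L n` and lying in all later `L m`. Then `y ∈
Z (n + 1) = Z n ≤ L n`, which forces `1 ∈ L n`. -/
lemma exists_finset_inf_eq_openJacobson [IsNoetherianRing R] :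
    ∃ s : Finset {M : Ideal R // M.IsMaximal ∧ IsOpen (M : Set R)},
      s.inf Subtype.val = openJacobson R := by
  classical
  by_contra! hcon
  have hex : ∀ s : Finset {M : Ideal R // M.IsMaximal ∧ IsOpen (M : Set R)},
      ∃ M : {M : Ideal R // M.IsMaximal ∧ IsOpen (M : Set R)}, ¬ s.inf Subtype.val ≤ M.1 := by
    intro s
    by_contra! h
    exact hcon s (le_antisymm (le_sInf fun M hM => h ⟨M, hM⟩)
      (Finset.le_inf fun M _ => sInf_le M.2))
  choose f hf using hex
  let s : ℕ → Finset {M : Ideal R // M.IsMaximal ∧ IsOpen (M : Set R)} :=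
    fun n => Nat.rec ∅ (fun _ t => insert (f t) t) n
  have hs : ∀ n, s (n + 1) = insert (f (s n)) (s n) := fun n => rfl
  let K : ℕ → Ideal R := fun n => (s n).inf Subtype.val
  let L : ℕ → Ideal R := fun n => (f (s n)).1
  have hKL : ∀ n, ¬ K n ≤ L n := fun n => hf (s n)
  have hK : ∀ n, K (n + 1) = L n ⊓ K n := fun n => by
    simp only [K, L, hs, Finset.inf_insert]
  have hKanti : Antitone K := antitone_nat_of_succ_le fun n => (hK n).trans_le inf_le_right
  have hKop : ∀ n, IsOpen (K n : Set R) := by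
    intro n
    induction n with
    | zero => exact isOpen_univ
    | succ n ih =>
      rw [hK]
      exact (f (s n)).2.2.inter ih
  let Z : ℕ →o Ideal R := ⟨fun n => ⨅ i, L (n + i), fun a b hab => le_iInf fun i => by
    obtain ⟨c, rfl⟩ := Nat.exists_eq_add_of_le hab
    rw [add_assoc]
    exact iInf_le (fun i => L (a + i)) (c + i)⟩
  obtain ⟨n, hn⟩ := (monotone_stabilizes_iff_noetherian (R := R) (M := R)).2 inferInstance Z
  have hstep : ∀ (k : ℕ) (x : R), ∃ x', x' - x ∈ K k ∧ x' ∈ L k := by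
    intro k x
    have htop : L k ⊔ K k = ⊤ := by
      refine (f (s k)).2.1.out.2 _ (lt_of_le_of_ne le_sup_left fun h => hKL k ?_)
      change L k = _ at h
      exact (le_sup_right (a := L k)).trans h.ge
    obtain ⟨l, hl, z, hz, rfl⟩ := Submodule.mem_sup.1 (htop ▸ Submodule.mem_top : x ∈ L k ⊔ K k)
    exact ⟨l, by simpa using hz, hl⟩
  choose g hg1 hg2 using hstep
  let x : ℕ → R := fun k => Nat.rec 1 (fun k y => g (n + 1 + k) y) k
  have hx : ∀ k, x (k + 1) = g (n + 1 + k) (x k) := fun k => rfl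
  -- Starting at `n + 1` matters: `K (n + 1) ≤ L n` keeps `y` congruent to `x 0 = 1` modulo `L n`.
  obtain ⟨y, hy⟩ := exists_forall_sub_mem (fun k => K (n + 1 + k))
    (fun a b hab => hKanti (by omega)) (fun k => hKop _) x (fun k => by rw [hx]; exact hg1 _ _)
  have hyn : y - 1 ∈ L n := by
    have := hy 0
    simp only [add_zero, hK] at this
    exact this.1
  have hyk : ∀ k, y ∈ L (n + 1 + k) := by
    intro k
    have h1 := hy (k + 1)
    have h2 : K (n + 1 + (k + 1)) ≤ L (n + 1 + k) := (hK (n + 1 + k)).trans_le inf_le_left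
    have := (L (n + 1 + k)).add_mem (h2 h1) (hg2 (n + 1 + k) (x k))
    rw [← hx] at this
    simpa using this
  have hyZ : y ∈ Z (n + 1) := (Submodule.mem_iInf _).2 hyk
  rw [← hn (n + 1) (by omega)] at hyZ
  have hyL : y ∈ L n := (Submodule.mem_iInf _).1 hyZ 0
  have h1 : (1 : R) ∈ L n := by
    have := (L n).sub_mem hyL hyn
    simpa using this
  exact (f (s n)).2.1.ne_top ((Ideal.eq_top_iff_one _).2 h1)

lemma isOpen_openJacobson [IsNoetherianRing R] : IsOpen (openJacobson R : Set R) := by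
  obtain ⟨s, hs⟩ := exists_finset_inf_eq_openJacobson (R := R)
  rw [← hs, Submodule.coe_finsetInf]
  exact isOpen_biInter_finset fun M _ => M.2.2

instance [IsNoetherianRing R] : IsArtinian R (R ⧸ openJacobson R) := by
  obtain ⟨s, hs⟩ := exists_finset_inf_eq_openJacobson (R := R)
  let φ : R →ₗ[R] ∀ M : s, R ⧸ M.1.1 := LinearMap.pi fun M => M.1.1.mkQ
  have hker : LinearMap.ker φ = openJacobson R := by
    rw [← hs]
    ext x
    simp only [LinearMap.mem_ker, φ, funext_iff, LinearMap.pi_apply, Pi.zero_apply,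
      Submodule.mem_finsetInf]
    constructor
    · intro h M hM
      exact (Submodule.Quotient.mk_eq_zero _).1 (h ⟨M, hM⟩)
    · intro h M
      exact (Submodule.Quotient.mk_eq_zero _).2 (h M.1 M.2)
  have hsimple : ∀ M : s, IsArtinian R (R ⧸ M.1.1) := fun M => by
    have : IsSimpleModule R (R ⧸ M.1.1) := isSimpleModule_iff_isCoatom.2 M.1.2.1.out
    infer_instance
  rw [← hker]
  exact isArtinian_of_injective (φ.quotKerEquivRange.toLinearMap) φ.quotKerEquivRange.injective

/-- Each layer of the filtration by powers of `openJacobson R` is a quotient of a finite power of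
the artinian module `R ⧸ openJacobson R`. -/
lemma isArtinian_of_openJacobson_pow_smul [IsNoetherianRing R] (k : ℕ) (X : Type u) [AddCommGroup X]
    [Module R X] [Module.Finite R X] (h : ∀ a ∈ openJacobson R ^ k, ∀ x : X, a • x = 0) :
    IsArtinian R X := by
  induction k generalizing X with
  | zero =>
    have : Subsingleton X := ⟨fun x y => by
      have h1 := h 1 (by rw [Submodule.pow_zero]; exact Submodule.one_le.1 le_rfl) x
      have h2 := h 1 (by rw [Submodule.pow_zero]; exact Submodule.one_le.1 le_rfl) y
      rw [one_smul] at h1 h2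
      rw [h1, h2]⟩
    infer_instance
  | succ k ih =>
    let Y : Submodule R X := openJacobson R • ⊤
    have h1 : IsArtinian R Y := by
      refine ih Y fun a ha y => Subtype.ext ?_
      obtain ⟨y, hy⟩ := y
      change a • y = 0
      induction hy using Submodule.smul_induction_on' with
      | smul b hb x _ =>
        rw [← mul_smul]
        exact h _ (Submodule.mul_mem_mul (M := openJacobson R ^ k) (N := openJacobson R) ha hb) x
      | add x _ y _ hx hy => rw [smul_add, hx, hy, add_zero]
    have h2 : IsArtinian R (X ⧸ Y) := by
      obtain ⟨n, g, hg⟩ := Module.Finite.exists_fin' R (X ⧸ Y)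
      let e : Fin n → (R ⧸ openJacobson R) →ₗ[R] X ⧸ Y := fun i =>
        Submodule.liftQ _ (LinearMap.toSpanSingleton R _ (g (Pi.single i 1))) fun a ha => by
          obtain ⟨x, hx⟩ := Submodule.Quotient.mk_surjective Y (g (Pi.single i 1))
          rw [LinearMap.mem_ker, LinearMap.toSpanSingleton_apply, ← hx,
            ← Submodule.Quotient.mk_smul, Submodule.Quotient.mk_eq_zero]
          exact Submodule.smul_mem_smul ha trivial
      let E : (Fin n → R ⧸ openJacobson R) →ₗ[R] X ⧸ Y :=
        ∑ i, (e i).comp (LinearMap.proj i)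
      refine isArtinian_of_surjective _ E fun z => ?_
      obtain ⟨w, rfl⟩ := hg z
      refine ⟨fun i => Submodule.Quotient.mk (w i), ?_⟩
      rw [LinearMap.sum_apply]
      have : w = ∑ i, w i • (Pi.single i 1 : Fin n → R) := by
        funext j
        simp [Finset.sum_apply, Pi.single_apply]
      conv_rhs => rw [this, map_sum]
      refine Finset.sum_congr rfl fun i _ => ?_
      rw [map_smul]
      rfl
    exact isArtinian_of_range_eq_ker Y.subtype Y.mkQ (by simp)

end IsPseudocompactRing

open IsPseudocompactRing

/-! ### Powers of two-sided ideals. -/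

namespace Ideal

variable {R : Type u} [Ring R]

lemma mem_pow_mul_of_isTwoSided (I : Ideal R) [I.IsTwoSided] (n : ℕ) {a : R} (ha : a ∈ I ^ n)
    (r : R) : a * r ∈ I ^ n := by
  cases n with
  | zero => exact (Submodule.one_le (P := (I ^ 0 : Ideal R))).1 le_rfl |>
      fun h => by simpa using (I ^ 0 : Ideal R).smul_mem (a * r) h
  | succ n =>
    replace ha : a ∈ (I ^ n : Submodule R R) * (I : Submodule R R) := ha
    induction ha using Submodule.mul_induction_on' with
    | mem_mul_mem b hb c hc =>
      rw [mul_assoc]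
      exact Submodule.mul_mem_mul (M := I ^ n) (N := I) hb (I.mul_mem_right r hc)
    | add a _ b _ h1 h2 =>
      rw [add_mul]
      exact Submodule.add_mem _ h1 h2

lemma pow_succ_le_of_isTwoSided (I : Ideal R) [I.IsTwoSided] (n : ℕ) : I ^ (n + 1) ≤ I ^ n := by
  intro a ha
  replace ha : a ∈ (I ^ n : Submodule R R) * (I : Submodule R R) := ha
  induction ha using Submodule.mul_induction_on' with
  | mem_mul_mem b hb c hc => exact I.mem_pow_mul_of_isTwoSided n hb c
  | add a _ b _ h1 h2 => exact Submodule.add_mem _ h1 h2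

lemma pow_le_pow_of_isTwoSided (I : Ideal R) [I.IsTwoSided] : Antitone fun n : ℕ => I ^ n :=
  antitone_nat_of_succ_le I.pow_succ_le_of_isTwoSided

lemma pow_mono_of_le {I J : Ideal R} (h : I ≤ J) (n : ℕ) : I ^ n ≤ J ^ n := by
  induction n with
  | zero => exact le_rfl
  | succ n ih => exact mul_le_mul' (a := (I ^ n : Submodule R R)) (b := J ^ n) ih h

end Ideal

/-! ### Stable ideals and nilpotence of monomials. -/

namespace SkewDerivation

variable {R : Type u} [Ring R] [UniformSpace R] (D : SkewDerivation R)

/-- The elements whose images under all monomials in `δ, σ, σ⁻¹` generate right ideals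
contained in `U`: the largest `(σ, δ)`-stable two-sided ideal contained in `U`. -/
def core (U : Ideal R) : Ideal R where
  carrier := {a | ∀ (k : ℕ) (F : R →+ R), IsSkewMonomial D.σ D.δ k F → ∀ r, F a * r ∈ U}
  add_mem' {a b} ha hb k F hF r := by
    rw [map_add, add_mul]
    exact U.add_mem (ha k F hF r) (hb k F hF r)
  zero_mem' k F _ r := by simp
  smul_mem' b a ha k F hF := by
    rw [smul_eq_mul]
    induction hF generalizing a b with
    | one =>
      intro r
      have := ha 0 _ .one r
      simp only [AddMonoidHom.id_apply] at this ⊢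
      rw [mul_assoc]
      exact U.mul_mem_left _ this
    | comp_delta hF ih =>
      intro r
      rw [AddMonoidHom.comp_apply, D.delta_mul, map_add, add_mul]
      exact U.add_mem (ih _ a ha r) (ih _ (D.δ a) (fun k F hF => ha (k + 1) _ hF.comp_delta) r)
    | comp_sigma hF ih =>
      intro r
      rw [AddMonoidHom.comp_apply, AddMonoidHom.coe_coe, map_mul]
      exact ih _ (D.σ a) (fun k F hF => ha k _ hF.comp_sigma) r
    | comp_sigma_symm hF ih =>
      intro r
      rw [AddMonoidHom.comp_apply, AddMonoidHom.coe_coe, map_mul]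
      exact ih _ (D.σ.symm a) (fun k F hF => ha k _ hF.comp_sigma_symm) r

variable {U : Ideal R} {D}

lemma mem_core {a : R} : a ∈ D.core U ↔
    ∀ (k : ℕ) (F : R →+ R), IsSkewMonomial D.σ D.δ k F → ∀ r, F a * r ∈ U := Iff.rfl

lemma core_le : D.core U ≤ U := fun a ha => by simpa using ha 0 _ .one 1

lemma delta_mem_core {a : R} (ha : a ∈ D.core U) : D.δ a ∈ D.core U :=
  fun _ _ hF => ha _ _ hF.comp_delta

lemma sigma_mem_core {a : R} (ha : a ∈ D.core U) : D.σ a ∈ D.core U :=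
  fun _ _ hF => ha _ _ hF.comp_sigma

lemma sigma_symm_mem_core {a : R} (ha : a ∈ D.core U) : D.σ.symm a ∈ D.core U :=
  fun _ _ hF => ha _ _ hF.comp_sigma_symm

instance : (D.core U).IsTwoSided where
  mul_mem_of_left {a} b ha := by
    intro k F hF
    induction hF generalizing a b with
    | one =>
      intro r
      have := ha 0 _ .one (b * r)
      simpa only [AddMonoidHom.id_apply, mul_assoc] using this
    | comp_delta hF ih =>
      intro r
      rw [AddMonoidHom.comp_apply, D.delta_mul, map_add, add_mul]
      exact U.add_mem (ih _ (delta_mem_core ha) r) (ih _ (sigma_mem_core ha) r)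
    | comp_sigma hF ih =>
      intro r
      rw [AddMonoidHom.comp_apply, AddMonoidHom.coe_coe, map_mul]
      exact ih _ (sigma_mem_core ha) r
    | comp_sigma_symm hF ih =>
      intro r
      rw [AddMonoidHom.comp_apply, AddMonoidHom.coe_coe, map_mul]
      exact ih _ (sigma_symm_mem_core ha) r

lemma words_mem_core_of_mem {a : R} (ha : a ∈ D.core U) : ∀ k l : ℕ, D.words k l a ∈ D.core U
  | 0, 0 => by rwa [words]
  | k + 1, 0 => by
    rw [words]
    exact delta_mem_core (words_mem_core_of_mem ha k 0)
  | 0, l + 1 => by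
    rw [words]
    exact sigma_mem_core (words_mem_core_of_mem ha 0 l)
  | k + 1, l + 1 => by
    rw [words]
    exact (D.core U).add_mem (delta_mem_core (words_mem_core_of_mem ha k (l + 1)))
      (sigma_mem_core (words_mem_core_of_mem ha (k + 1) l))

variable (D) in
lemma exists_monomial_mul_mem (hU : ∃ n : ℕ, 1 ≤ n ∧ ∀ x ∈ Ring.jacobson R ^ n, ∀ r, x * r ∈ U) :
    ∃ m : ℕ, ∀ k, m ≤ k → ∀ F : R →+ R, IsSkewMonomial D.σ D.δ k F → ∀ a r : R, F a * r ∈ U := by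
  obtain ⟨n, hn, h⟩ := hU
  obtain ⟨m, -, hm⟩ := D.nilpotent n hn
  exact ⟨m, fun k hk F hF a r => h _ (hm k hk F hF a) r⟩

variable (D) in
-- Composing a word with further monomials cannot lower its number of factors `δ`, so a bound that
-- brings monomials into `U` already brings words into the stable core.
lemma exists_words_mem_core
    (hU : ∃ n : ℕ, 1 ≤ n ∧ ∀ x ∈ Ring.jacobson R ^ n, ∀ r, x * r ∈ U) :
    ∃ m : ℕ, ∀ k l, m ≤ k → ∀ a : R, D.words k l a ∈ D.core U := by
  obtain ⟨m, hm⟩ := D.exists_monomial_mul_mem hU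
  refine ⟨m, fun k l hk a i F hF r => ?_⟩
  exact D.words_mem (U.toAddSubgroup.comap (AddMonoidHom.mulRight r)) m
    (fun k hk F hF a => hm k hk F hF a r) k l i F hF (by omega) a

lemma continuous_monomial {k : ℕ} {F : R →+ R} (hF : IsSkewMonomial D.σ D.δ k F) :
    Continuous F := by
  induction hF with
  | one => exact continuous_id
  | comp_delta hF ih => exact ih.comp D.continuous_delta
  | comp_sigma hF ih => exact ih.comp D.continuous_sigma
  | comp_sigma_symm hF ih => exact ih.comp D.continuous_sigma_symm

lemma isClosed_core [IsTopologicalRing R] (hU : IsClosed (U : Set R)) :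
    IsClosed (D.core U : Set R) := by
  have : (D.core U : Set R) = ⋂ (k : ℕ), ⋂ (F : R →+ R), ⋂ (_ : IsSkewMonomial D.σ D.δ k F),
      ⋂ (r : R), (fun a => F a * r) ⁻¹' U := by
    ext a
    simp [mem_core]
  rw [this]
  exact isClosed_iInter fun k => isClosed_iInter fun F => isClosed_iInter fun hF =>
    isClosed_iInter fun r => hU.preimage ((continuous_monomial hF).mul continuous_const)

omit [UniformSpace R] in
lemma exists_jacobson_pow_mul_mem (hfl : IsFiniteLength R (R ⧸ U)) :
    ∃ n : ℕ, 1 ≤ n ∧ ∀ x ∈ Ring.jacobson R ^ n, ∀ r, x * r ∈ U := by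
  obtain ⟨n, hn, h⟩ := hfl.exists_jacobson_pow_smul
  refine ⟨n, hn, fun x hx r => ?_⟩
  have := h x hx (Submodule.Quotient.mk r)
  rwa [← Submodule.Quotient.mk_smul, Submodule.Quotient.mk_eq_zero] at this

variable (D) in
/-- The largest `(σ, δ)`-stable two-sided ideal in the intersection of the open maximal left
ideals. -/
def radical : Ideal R := D.core (openJacobson R)

instance : D.radical.IsTwoSided := inferInstanceAs (D.core _).IsTwoSided

variable (D) in
-- Exponent `1` in the nilpotence condition suffices, since `Ring.jacobson R` lies in the two-sided
-- ideal `openJacobson R`.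
lemma exists_words_mem_radical [IsTopologicalRing R] :
    ∃ m : ℕ, ∀ k l, m ≤ k → ∀ a : R, D.words k l a ∈ D.radical := by
  refine D.exists_words_mem_core ⟨1, le_rfl, fun x hx r => ?_⟩
  rw [Submodule.pow_one] at hx
  exact Ideal.mul_mem_right _ _ (jacobson_le_openJacobson hx)

lemma delta_mem_radical_pow (n : ℕ) {a : R} (ha : a ∈ D.radical ^ (n + 1)) :
    D.δ a ∈ D.radical ^ (n + 1) ∧ D.σ a ∈ D.radical ^ (n + 1) ∧
      D.σ.symm a ∈ D.radical ^ (n + 1) := by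
  induction n generalizing a with
  | zero =>
    rw [zero_add, Submodule.pow_one] at ha ⊢
    exact ⟨delta_mem_core ha, sigma_mem_core ha, sigma_symm_mem_core ha⟩
  | succ n ih =>
    replace ha : a ∈ (D.radical ^ (n + 1) : Submodule R R) * (D.radical : Submodule R R) := ha
    induction ha using Submodule.mul_induction_on' with
    | mem_mul_mem b hb c hc =>
      have hmul : ∀ {x y : R}, x ∈ D.radical ^ (n + 1) → y ∈ D.radical →
          x * y ∈ D.radical ^ (n + 1 + 1) := fun hx hy =>
        Submodule.mul_mem_mul (M := D.radical ^ (n + 1)) (N := D.radical) hx hy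
      obtain ⟨h1, h2, h3⟩ := ih hb
      rw [D.delta_mul, map_mul, map_mul]
      exact ⟨Submodule.add_mem _ (hmul h1 hc) (hmul h2 (delta_mem_core hc)),
        hmul h2 (sigma_mem_core hc), hmul h3 (sigma_symm_mem_core hc)⟩
    | add a _ b _ h1 h2 =>
      simp only [map_add]
      exact ⟨Submodule.add_mem _ h1.1 h2.1, Submodule.add_mem _ h1.2.1 h2.2.1,
        Submodule.add_mem _ h1.2.2 h2.2.2⟩

lemma monomial_mem_radical_pow (n : ℕ) {a : R} (ha : a ∈ D.radical ^ (n + 1)) {k : ℕ} {F : R →+ R}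
    (hF : IsSkewMonomial D.σ D.δ k F) : F a ∈ D.radical ^ (n + 1) := by
  induction hF generalizing a with
  | one => exact ha
  | comp_delta hF ih => exact ih (delta_mem_radical_pow n ha).1
  | comp_sigma hF ih => exact ih (delta_mem_radical_pow n ha).2.1
  | comp_sigma_symm hF ih => exact ih (delta_mem_radical_pow n ha).2.2

variable (D) in
-- Monomials preserve positive powers of the radical, and a large power of `openJacobson R` kills `R
-- ⧸ U`.
lemma exists_radical_pow_le_core [IsTopologicalRing R] (hU : IsOpen (U : Set R))
    (hfl : IsFiniteLength R (R ⧸ U)) : ∃ n : ℕ, D.radical ^ (n + 1) ≤ D.core U := by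
  obtain ⟨n, hn, h⟩ := exists_openJacobson_pow_smul hfl (isOpen_smul_mk hU)
  obtain ⟨n, rfl⟩ := Nat.exists_eq_add_of_le' hn
  refine ⟨n, fun a ha k F hF r => ?_⟩
  have h1 : F a ∈ openJacobson R ^ (n + 1) :=
    Ideal.pow_mono_of_le (core_le (D := D)) _ (monomial_mem_radical_pow n ha hF)
  have := h _ h1 (Submodule.Quotient.mk r)
  rwa [← Submodule.Quotient.mk_smul, Submodule.Quotient.mk_eq_zero] at this

lemma sigma_mem_openJacobson_pow (n : ℕ) {a : R} (ha : a ∈ openJacobson R ^ (n + 1)) :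
    D.σ a ∈ openJacobson R ^ (n + 1) ∧ D.σ.symm a ∈ openJacobson R ^ (n + 1) := by
  induction n generalizing a with
  | zero =>
    rw [zero_add, Submodule.pow_one] at ha ⊢
    exact ⟨mem_openJacobson_of_ringEquiv _ D.continuous_sigma ha,
      mem_openJacobson_of_ringEquiv _ D.continuous_sigma_symm ha⟩
  | succ n ih =>
    replace ha : a ∈ (openJacobson R ^ (n + 1) : Submodule R R) * (openJacobson R : Submodule R R) :=
      ha
    induction ha using Submodule.mul_induction_on' with
    | mem_mul_mem b hb c hc =>
      rw [map_mul, map_mul]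
      exact ⟨Submodule.mul_mem_mul (M := openJacobson R ^ (n + 1)) (N := openJacobson R)
        (ih hb).1 (mem_openJacobson_of_ringEquiv _ D.continuous_sigma hc),
        Submodule.mul_mem_mul (M := openJacobson R ^ (n + 1)) (N := openJacobson R)
        (ih hb).2 (mem_openJacobson_of_ringEquiv _ D.continuous_sigma_symm hc)⟩
    | add a _ b _ h1 h2 =>
      simp only [map_add]
      exact ⟨Submodule.add_mem _ h1.1 h2.1, Submodule.add_mem _ h1.2 h2.2⟩

/-- `δ` need not preserve `openJacobson R`. The twisted Leibniz rule differentiates only one factor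
of a product at a time, so one exponent is lost, and no more. -/
lemma delta_mem_openJacobson_pow [IsTopologicalRing R] (n : ℕ) {a : R}
    (ha : a ∈ openJacobson R ^ (n + 1 + 1)) : D.δ a ∈ openJacobson R ^ (n + 1) := by
  induction n generalizing a with
  | zero =>
    replace ha : a ∈ (openJacobson R ^ 1 : Submodule R R) * (openJacobson R : Submodule R R) := ha
    rw [Submodule.pow_one] at ha
    rw [zero_add, Submodule.pow_one]
    induction ha using Submodule.mul_induction_on' with
    | mem_mul_mem b hb c hc =>
      rw [D.delta_mul]
      exact Submodule.add_mem _ (Ideal.mul_mem_left _ _ hc)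
        (Ideal.mul_mem_right _ _ (mem_openJacobson_of_ringEquiv _ D.continuous_sigma hb))
    | add a _ b _ h1 h2 =>
      rw [map_add]
      exact Submodule.add_mem _ h1 h2
  | succ n ih =>
    replace ha : a ∈ (openJacobson R ^ (n + 1 + 1) : Submodule R R) *
      (openJacobson R : Submodule R R) := ha
    induction ha using Submodule.mul_induction_on' with
    | mem_mul_mem b hb c hc =>
      rw [D.delta_mul]
      exact Submodule.add_mem _
        (Submodule.mul_mem_mul (M := openJacobson R ^ (n + 1)) (N := openJacobson R) (ih hb) hc)
        (Ideal.mem_pow_mul_of_isTwoSided _ _ (sigma_mem_openJacobson_pow _ hb).1 _)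
    | add a _ b _ h1 h2 =>
      rw [map_add]
      exact Submodule.add_mem _ h1 h2

lemma monomial_mem_openJacobson_pow [IsTopologicalRing R] {k : ℕ} {F : R →+ R}
    (hF : IsSkewMonomial D.σ D.δ k F) (n : ℕ) {a : R} (ha : a ∈ openJacobson R ^ (n + k + 1)) :
    F a ∈ openJacobson R ^ (n + 1) := by
  induction hF generalizing a with
  | one => exact ha
  | comp_delta hF ih => exact ih (delta_mem_openJacobson_pow _ ha)
  | comp_sigma hF ih => exact ih (sigma_mem_openJacobson_pow _ ha).1
  | comp_sigma_symm hF ih => exact ih (sigma_mem_openJacobson_pow _ ha).2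

variable (D) in
lemma exists_openJacobson_pow_le_radical [IsTopologicalRing R] :
    ∃ n : ℕ, openJacobson R ^ n ≤ D.radical := by
  obtain ⟨m, -, hm⟩ := D.nilpotent 1 le_rfl
  -- Monomials with at least `m` factors `δ` land in the Jacobson radical. The others have `k < m`
  -- factors, each costing one exponent, so exponent `m + 1` leaves at least one.
  refine ⟨m + 1, fun a ha k F hF r => Ideal.mul_mem_right _ _ ?_⟩
  by_cases hk : m ≤ k
  · have := hm k hk F hF a
    rw [Submodule.pow_one] at this
    exact jacobson_le_openJacobson this
  · have := monomial_mem_openJacobson_pow hF 0 (a := a)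
      (Ideal.pow_le_pow_of_isTwoSided _ (by omega) ha)
    rwa [zero_add, Submodule.pow_one] at this

variable [IsPseudocompactRing R]

lemma isClosed_radical [IsNoetherianRing R] : IsClosed (D.radical : Set R) :=
  isClosed_core (isClosed_of_isOpen isOpen_openJacobson)

variable (D) in
lemma isArtinian_of_radical_smul [IsNoetherianRing R] (X : Type u) [AddCommGroup X]
    [Module R X] [Module.Finite R X] (h : ∀ a ∈ D.radical, ∀ x : X, a • x = 0) :
    IsArtinian R X := by
  obtain ⟨n, hn⟩ := D.exists_openJacobson_pow_le_radical
  exact isArtinian_of_openJacobson_pow_smul n X fun a ha => h a (hn ha)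

end SkewDerivation

/-! ### Coefficients of skew power series and closed stable ideals. -/

namespace SkewPowerSeries

variable {R : Type u} [Ring R] [UniformSpace R] {D : SkewDerivation R}

@[ext] lemma ext {a b : SkewPowerSeries D} (h : ∀ m, coeff m a = coeff m b) : a = b := funext h

@[simp] lemma coeff_mk (m : ℕ) (a : ℕ → R) : coeff m (mk a : SkewPowerSeries D) = a m := rfl

@[simp] lemma coeff_add (m : ℕ) (a b : SkewPowerSeries D) :
    coeff m (a + b) = coeff m a + coeff m b := rfl

@[simp] lemma coeff_sub (m : ℕ) (a b : SkewPowerSeries D) :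
    coeff m (a - b) = coeff m a - coeff m b := rfl

@[simp] lemma coeff_zero (m : ℕ) : coeff m (0 : SkewPowerSeries D) = 0 := rfl

@[simp] lemma coeff_smul (m : ℕ) (r : R) (a : SkewPowerSeries D) :
    coeff m (r • a) = r * coeff m a := rfl

/-- The `m`-th coefficient, as a linear map. -/
def coeffₗ (m : ℕ) : SkewPowerSeries D →ₗ[R] R where
  toFun := coeff m
  map_add' _ _ := rfl
  map_smul' _ _ := rfl

lemma coeff_sum {ι : Type*} (m : ℕ) (s : Finset ι) (f : ι → SkewPowerSeries D) :
    coeff m (∑ i ∈ s, f i) = ∑ i ∈ s, coeff m (f i) :=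
  map_sum (coeffₗ (D := D) m) f s

variable [IsPseudocompactRing R]

instance : IsScalarTower R (SkewPowerSeries D) (SkewPowerSeries D) :=
  ⟨fun r a b => D.smul_mulCoeff r a b⟩

variable (D) in
/-- The embedding of `R` as the constant power series. -/
noncomputable def C : R →+* SkewPowerSeries D where
  toFun r := r • 1
  map_one' := one_smul _ _
  map_mul' r s := by rw [smul_mul_assoc, one_mul, mul_smul]
  map_zero' := zero_smul _ _
  map_add' r s := add_smul _ _ _

lemma C_mul (r : R) (a : SkewPowerSeries D) : C D r * a = r • a := by
  change (r • (1 : SkewPowerSeries D)) * a = _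
  rw [smul_mul_assoc, one_mul]

lemma C_smul {M : Type*} [AddCommGroup M] [Module R M] [Module (SkewPowerSeries D) M]
    [IsScalarTower R (SkewPowerSeries D) M] (r : R) (x : M) : C D r • x = r • x :=
  smul_one_smul _ _ _

lemma coeff_one (m : ℕ) : coeff m (1 : SkewPowerSeries D) = if m = 0 then 1 else 0 :=
  Pi.single_apply (M := R) 0 1 m

lemma coeff_C (m : ℕ) (r : R) : coeff m (C D r) = if m = 0 then r else 0 := by
  change r * coeff m (1 : SkewPowerSeries D) = _
  rw [coeff_one]
  split_ifs <;> simp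

lemma X_pow_eq (n : ℕ) : (X : SkewPowerSeries D) ^ n = mk (Pi.single n 1) := by
  induction n with
  | zero => rfl
  | succ n ih =>
    rw [pow_succ', ih]
    refine (D.single_mulCoeff 1 _).trans ?_
    have h1 : (Pi.single n 1 : ℕ → R) = D.tPow n (Pi.single 0 1) := (D.tPow_one n).symm
    have h2 : (Pi.single (n + 1) 1 : ℕ → R) = D.tPow (n + 1) (Pi.single 0 1) :=
      (D.tPow_one _).symm
    change D.tPow 1 (Pi.single n 1) = Pi.single (n + 1) 1
    rw [h1, h2, D.tPow_succ, D.tPow_succ, D.tPow_zero]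

lemma X_pow_mul (n : ℕ) (b : SkewPowerSeries D) : (X : SkewPowerSeries D) ^ n * b = D.tPow n b := by
  rw [X_pow_eq]
  exact D.single_mulCoeff n b

lemma hasSum_coeff_mul (m : ℕ) (a b : SkewPowerSeries D) :
    HasSum (fun j : ℕ => coeff j a * coeff m (X ^ j * b)) (coeff m (a * b)) := by
  simp only [X_pow_mul]
  have h := (D.summable_tPow (fun i => coeff i a) (fun i => coeff i b) m).hasSum
  rw [← D.mulCoeff_eq_tsum] at h
  exact h

lemma coeff_mul_eq_tsum (m : ℕ) (a b : SkewPowerSeries D) :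
    coeff m (a * b) = ∑' j : ℕ, coeff j a * coeff m (X ^ j * b) :=
  (hasSum_coeff_mul m a b).tsum_eq.symm

lemma coeff_X_pow_mul (n m : ℕ) (b : SkewPowerSeries D) :
    coeff m ((X : SkewPowerSeries D) ^ n * b) =
      ∑ i ∈ Finset.range (m + 1), D.wordsAt n i (coeff (m - i) b) := by
  rw [X_pow_mul]
  exact D.tPow_apply n b m

lemma coeff_X_mul_zero (b : SkewPowerSeries D) :
    coeff 0 ((X : SkewPowerSeries D) * b) = D.δ (coeff 0 b) := by
  rw [← pow_one X, X_pow_mul]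
  rfl

lemma coeff_X_mul_succ (m : ℕ) (b : SkewPowerSeries D) :
    coeff (m + 1) ((X : SkewPowerSeries D) * b) =
      D.σ (coeff m b) + D.δ (coeff (m + 1) b) := by
  rw [← pow_one X, X_pow_mul]
  rfl

lemma coeff_mul_X_pow (a : SkewPowerSeries D) (n m : ℕ) :
    coeff m (a * X ^ n) = if n ≤ m then coeff (m - n) a else 0 := by
  rw [coeff_mul_eq_tsum]
  simp only [← pow_add]
  simp only [X_pow_eq, coeff_mk]
  split_ifs with hn
  · rw [tsum_eq_single (m - n)]
    · rw [Nat.sub_add_cancel hn, Pi.single_eq_same, mul_one]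
    · intro j hj
      rw [Pi.single_eq_of_ne (by omega), mul_zero]
  · rw [tsum_congr (g := fun _ => (0 : R))]
    · exact tsum_zero
    · intro j
      rw [Pi.single_eq_of_ne (by omega), mul_zero]

lemma coeff_mul_X_zero (a : SkewPowerSeries D) : coeff 0 (a * X) = 0 := by
  rw [← pow_one X, coeff_mul_X_pow, if_neg (by omega)]

lemma coeff_mul_X_succ (a : SkewPowerSeries D) (m : ℕ) : coeff (m + 1) (a * X) = coeff m a := by
  rw [← pow_one X, coeff_mul_X_pow, if_pos (by omega), Nat.add_sub_cancel]

lemma X_mul_C (r : R) : (X : SkewPowerSeries D) * C D r = C D (D.σ r) * X + C D (D.δ r) := by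
  rw [C_mul]
  exact X_mul_smul_one r

/-- The power series `∑ a_{i+n} tⁱ`. -/
def shift (n : ℕ) (a : SkewPowerSeries D) : SkewPowerSeries D := mk fun i => coeff (n + i) a

omit [IsPseudocompactRing R] in
@[simp] lemma coeff_shift (n m : ℕ) (a : SkewPowerSeries D) :
    coeff m (shift n a) = coeff (n + m) a := rfl

lemma shift_succ_mul_X (n : ℕ) (a : SkewPowerSeries D) :
    shift (n + 1) a * X = shift n a - C D (coeff n a) := by
  ext m
  cases m with
  | zero => simp [coeff_mul_X_zero, coeff_C]
  | succ m =>
    rw [coeff_mul_X_succ, coeff_sub, coeff_C, if_neg (by omega), sub_zero, coeff_shift, coeff_shift]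
    congr 1
    omega

lemma exists_eq_sum_add_mul_X_pow (a : SkewPowerSeries D) (n : ℕ) :
    a = ∑ i ∈ Finset.range n, coeff i a • X ^ i + shift n a * X ^ n := by
  ext m
  rw [coeff_add, coeff_mul_X_pow, coeff_sum]
  simp only [coeff_smul, X_pow_eq, coeff_mk, coeff_shift]
  by_cases h : n ≤ m
  · rw [if_pos h, Finset.sum_eq_zero, zero_add, Nat.add_sub_cancel' h]
    intro i hi
    rw [Finset.mem_range] at hi
    rw [Pi.single_eq_of_ne (by omega), mul_zero]
  · rw [if_neg h, add_zero, Finset.sum_eq_single m]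
    · rw [Pi.single_eq_same, mul_one]
    · intro i _ hi
      rw [Pi.single_eq_of_ne hi.symm, mul_zero]
    · intro hm
      exact absurd (Finset.mem_range.2 (not_le.1 h)) hm

section Core

variable {U : Ideal R}

omit [IsPseudocompactRing R] in
lemma wordsAt_mem_core {a : R} (ha : a ∈ D.core U) (j n : ℕ) : D.wordsAt j n a ∈ D.core U := by
  unfold SkewDerivation.wordsAt
  split_ifs
  · exact SkewDerivation.words_mem_core_of_mem ha _ _
  · exact (D.core U).zero_mem

/-- The coefficient of `t ^ m` in `t ^ j * b` involves only words applied to the coefficients of `b`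
up to degree `m`. Stability handles the words and closedness the infinite sum over `j`. -/
lemma coeff_mul_mem_of_right (hc : IsClosed (D.core U : Set R)) {a b : SkewPowerSeries D} {m : ℕ}
    (hb : ∀ i ≤ m, coeff i b ∈ D.core U) : coeff m (a * b) ∈ D.core U := by
  refine hc.mem_of_tendsto (hasSum_coeff_mul m a b)
    (Filter.Eventually.of_forall fun s => (D.core U).sum_mem fun j _ =>
      Ideal.mul_mem_left _ _ ?_)
  rw [coeff_X_pow_mul]
  exact Submodule.sum_mem _ fun n _ => wordsAt_mem_core (hb _ (by omega)) _ _

lemma coeff_mul_mem_of_left {I : Ideal R} [I.IsTwoSided] (hc : IsClosed (I : Set R))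
    {a : SkewPowerSeries D} (b : SkewPowerSeries D) (ha : ∀ i, coeff i a ∈ I) (m : ℕ) :
    coeff m (a * b) ∈ I := by
  exact hc.mem_of_tendsto (hasSum_coeff_mul m a b)
    (Filter.Eventually.of_forall fun s => I.sum_mem fun j _ => Ideal.mul_mem_right _ _ (ha j))

/-- The coefficient of `t ^ m` in `t ^ k * b` is a sum of words with at least `k - m` factors `δ`.
-/
lemma coeff_X_pow_mul_mem {w : ℕ} (hw : ∀ k l, w ≤ k → ∀ a : R, D.words k l a ∈ D.core U)
    {k m : ℕ} (hk : m + w ≤ k) (b : SkewPowerSeries D) :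
    coeff m ((X : SkewPowerSeries D) ^ k * b) ∈ D.core U := by
  rw [coeff_X_pow_mul]
  refine Submodule.sum_mem _ fun i hi => ?_
  rw [Finset.mem_range] at hi
  unfold SkewDerivation.wordsAt
  rw [if_pos (by omega)]
  exact hw _ _ (by omega) _

end Core

/-- A power series whose coefficients lie in a two-sided ideal of a right noetherian ring is a
finite sum of multiples of elements of the ideal. -/
lemma exists_eq_sum_C_mul [IsNoetherianRing Rᵐᵒᵖ] {I : Ideal R} [I.IsTwoSided]
    {b : SkewPowerSeries D} (hb : ∀ i, coeff i b ∈ I) :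
    ∃ (s : Finset R) (c : R → SkewPowerSeries D), (s : Set R) ⊆ I ∧ b = ∑ a ∈ s, C D a * c a := by
  -- As a right ideal, `I` is finitely generated, so a single finite set of left factors serves all
  -- coefficients simultaneously.
  let J : Submodule Rᵐᵒᵖ R :=
    { carrier := I
      add_mem' := I.add_mem
      zero_mem' := I.zero_mem
      smul_mem' := fun r x hx => I.mul_mem_right r.unop hx }
  have : IsNoetherian Rᵐᵒᵖ R := by
    let e : Rᵐᵒᵖ ≃ₗ[Rᵐᵒᵖ] R :=
      { MulOpposite.opAddEquiv.symm with
        map_smul' := fun r x => rfl }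
    exact isNoetherian_of_linearEquiv e
  obtain ⟨s, hs⟩ := IsNoetherian.noetherian J
  have hb' : ∀ i, ∃ f : R → Rᵐᵒᵖ, ∑ a ∈ s, f a • a = coeff i b := by
    intro i
    have : coeff i b ∈ Submodule.span Rᵐᵒᵖ (s : Set R) := hs ▸ hb i
    obtain ⟨f, -, hf⟩ := Submodule.mem_span_finset.1 this
    exact ⟨f, hf⟩
  choose f hf using hb'
  refine ⟨s, fun a => mk fun i => (f i a).unop, fun a ha => ?_, ?_⟩
  · have : a ∈ J := hs ▸ Submodule.subset_span ha
    exact this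
  · ext m
    rw [coeff_sum, ← hf]
    refine Finset.sum_congr rfl fun a _ => ?_
    rw [C_mul]
    rfl

end SkewPowerSeries

/-! ### Topological nilpotence of the variable on modules. -/

namespace SkewPowerSeries

variable {R : Type u} [Ring R] [UniformSpace R] [IsPseudocompactRing R] {D : SkewDerivation R}

lemma smul_eq_zero_of_coeff_mem [IsNoetherianRing Rᵐᵒᵖ] {I : Ideal R} [I.IsTwoSided]
    {V : Type*} [AddCommGroup V] [Module (SkewPowerSeries D) V]
    (hV : ∀ a ∈ I, ∀ v : V, C D a • v = 0) {b : SkewPowerSeries D} (hb : ∀ i, coeff i b ∈ I)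
    (v : V) : b • v = 0 := by
  obtain ⟨s, c, hs, rfl⟩ := exists_eq_sum_C_mul hb
  rw [Finset.sum_smul]
  exact Finset.sum_eq_zero fun a ha => by rw [mul_smul, hV a (hs ha)]

lemma smul_mem_of_coeff_mem [IsNoetherianRing Rᵐᵒᵖ] {I : Ideal R} [I.IsTwoSided]
    {M : Type*} [AddCommGroup M] [Module R M] [Module (SkewPowerSeries D) M]
    [IsScalarTower R (SkewPowerSeries D) M] {b : SkewPowerSeries D} (hb : ∀ i, coeff i b ∈ I)
    (x : M) : b • x ∈ (I • ⊤ : Submodule R M) := by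
  obtain ⟨s, c, hs, rfl⟩ := exists_eq_sum_C_mul hb
  rw [Finset.sum_smul]
  refine Submodule.sum_mem _ fun a ha => ?_
  rw [mul_smul, C_smul]
  exact Submodule.smul_mem_smul (hs ha) trivial

variable (D) in
/-- `X ^ w` kills every simple module killed by the radical of `(σ, δ)`, if monomials with at least
`w` factors `δ` have values in the radical. -/
lemma X_pow_smul_eq_zero_of_isSimpleModule [IsNoetherianRing R] [IsNoetherianRing Rᵐᵒᵖ] {w : ℕ}
    (hw : ∀ k l, w ≤ k → ∀ a : R, D.words k l a ∈ D.radical)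
    {V : Type u} [AddCommGroup V] [Module (SkewPowerSeries D) V]
    [IsSimpleModule (SkewPowerSeries D) V] (hV : ∀ a ∈ D.radical, ∀ v : V, C D a • v = 0) (v : V) :
    (X : SkewPowerSeries D) ^ w • v = 0 := by
  by_contra hv
  obtain ⟨s, hs⟩ := IsSimpleModule.toSpanSingleton_surjective (SkewPowerSeries D) hv v
  rw [LinearMap.toSpanSingleton_apply, ← mul_smul] at hs
  have hcl : IsClosed (D.core (openJacobson R) : Set R) := SkewDerivation.isClosed_radical
  -- Here `x • v = v`. The contradiction comes from a left inverse of `1 - x` modulo series with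
  -- coefficients in the radical, which annihilate `v`.
  set x : SkewPowerSeries D := s * X ^ w with hx
  -- Modulo the radical, right multiplication by `x` raises the order in `t`: for `w ≤ j ≤ k` the
  -- coefficient of `t ^ j` in `t ^ k * s * t ^ w` is that of `t ^ (j - w)` in `t ^ k * s`, whose
  -- words have at least `w` factors `δ`.
  have hstep : ∀ (k : ℕ) (g : SkewPowerSeries D), (∀ i < k, coeff i g ∈ D.radical) →
      ∀ i < k + 1, coeff i (g * x) ∈ D.radical := by
    intro k g hg i hi
    rw [exists_eq_sum_add_mul_X_pow g k, add_mul, coeff_add]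
    refine Submodule.add_mem _ ?_ ?_
    · refine coeff_mul_mem_of_left hcl _ (fun j => ?_) i
      rw [coeff_sum]
      refine Submodule.sum_mem _ fun l hl => ?_
      rw [coeff_smul]
      exact Ideal.mul_mem_right _ _ (hg l (Finset.mem_range.1 hl))
    · rw [mul_assoc]
      refine coeff_mul_mem_of_right hcl fun j hj => ?_
      rw [hx, ← mul_assoc, coeff_mul_X_pow]
      split_ifs with hjw
      · exact coeff_X_pow_mul_mem hw (by omega) _
      · exact Submodule.zero_mem _
  have hpow : ∀ k, ∀ i < k, coeff i (x ^ k) ∈ D.radical := by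
    intro k
    induction k with
    | zero => intro i hi; omega
    | succ k ih =>
      rw [pow_succ]
      exact hstep k _ ih
  -- `y` is the geometric series in `x`. In degree `i` it stops at `x ^ i`, since higher powers
  -- contribute only elements of the radical.
  let y : SkewPowerSeries D := mk fun i => ∑ k ∈ Finset.range (i + 1), coeff i (x ^ k)
  have hy : ∀ K, ∀ i < K, coeff i (y - ∑ k ∈ Finset.range K, x ^ k) ∈ D.radical := by
    intro K i hi
    obtain ⟨l, rfl⟩ := Nat.exists_eq_add_of_le (Nat.succ_le_of_lt hi)
    rw [coeff_sub, coeff_sum, Finset.sum_range_add, ← sub_sub]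
    simp only [y, coeff_mk, Nat.succ_eq_add_one, sub_self, zero_sub]
    refine Submodule.neg_mem _ (Submodule.sum_mem _ fun j _ => hpow _ _ (by omega))
  have hinv : ∀ i, coeff i (y * (1 - x) - 1) ∈ D.radical := by
    intro i
    have h1 : y * (1 - x) - 1 = (y - ∑ k ∈ Finset.range (i + 1), x ^ k) -
        (y - ∑ k ∈ Finset.range (i + 1), x ^ k) * x - x ^ (i + 1) := by
      have h2 := geom_sum_mul_neg x (i + 1)
      have h3 : y * (1 - x) - 1 = (y - ∑ k ∈ Finset.range (i + 1), x ^ k) * (1 - x) +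
        ((∑ k ∈ Finset.range (i + 1), x ^ k) * (1 - x) - 1) := by noncomm_ring
      rw [h3, h2]
      noncomm_ring
    rw [h1, coeff_sub, coeff_sub]
    exact Submodule.sub_mem _ (Submodule.sub_mem _ (hy _ _ (by omega))
      (hstep (i + 1) _ (hy (i + 1)) i (by omega))) (hpow _ _ (by omega))
  have h1 : (y * (1 - x) - 1) • v = 0 := smul_eq_zero_of_coeff_mem hV hinv v
  rw [sub_smul, mul_smul, sub_smul, one_smul, hs, sub_self, smul_zero, zero_sub, neg_eq_zero] at h1
  exact hv (by rw [h1, smul_zero])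

variable (D) in
lemma exists_X_pow_smul_eq_zero [IsNoetherianRing R] [IsNoetherianRing Rᵐᵒᵖ]
    {V : Type u} [AddCommGroup V] [Module (SkewPowerSeries D) V]
    (h : IsFiniteLength (SkewPowerSeries D) V) (hV : ∀ a ∈ D.radical, ∀ v : V, C D a • v = 0) :
    ∃ N : ℕ, ∀ v : V, (X : SkewPowerSeries D) ^ N • v = 0 := by
  obtain ⟨w, hw⟩ := D.exists_words_mem_radical
  induction h with
  | of_subsingleton => exact ⟨0, fun v => Subsingleton.elim _ _⟩
  | @of_simple_quotient V _ _ N _ _ ih =>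
    obtain ⟨n, hn⟩ := ih fun a ha v => Subtype.ext (hV a ha v)
    refine ⟨n + w, fun v => ?_⟩
    have h1 := X_pow_smul_eq_zero_of_isSimpleModule D hw (V := V ⧸ N) (fun a ha v => by
      obtain ⟨v, rfl⟩ := Submodule.Quotient.mk_surjective N v
      rw [← Submodule.Quotient.mk_smul, hV a ha, Submodule.Quotient.mk_zero])
      (Submodule.Quotient.mk v)
    rw [← Submodule.Quotient.mk_smul, Submodule.Quotient.mk_eq_zero] at h1
    have h2 := hn ⟨_, h1⟩
    rw [pow_add, mul_smul]
    exact congrArg Subtype.val h2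

variable (D) in
/-- The variable acts topologically nilpotently on modules which are finitely generated
over the coefficient ring. -/
theorem exists_X_pow_smul_mem [IsNoetherianRing R] [IsNoetherianRing Rᵐᵒᵖ]
    (M : Type u) [AddCommGroup M] [Module R M] [Module (SkewPowerSeries D) M]
    [IsScalarTower R (SkewPowerSeries D) M] [Module.Finite R M] :
    ∃ N : ℕ, ∀ x : M, (X : SkewPowerSeries D) ^ N • x ∈ (D.radical • ⊤ : Submodule R M) := by
  have hcl : IsClosed (D.core (openJacobson R) : Set R) := SkewDerivation.isClosed_radical
  -- `D.radical • ⊤` is stable under power series: for `a` in the radical, all coefficients of `s *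
  -- C D a` are again in it, so finitely many elements of the radical can be pulled out on the left.
  let Y : Submodule (SkewPowerSeries D) M :=
    { (D.radical • ⊤ : Submodule R M) with
      smul_mem' := fun s x hx => by
        induction hx using Submodule.smul_induction_on' with
        | smul a ha x _ =>
          rw [← C_smul (D := D), ← mul_smul]
          refine smul_mem_of_coeff_mem (fun i => coeff_mul_mem_of_right hcl fun j _ => ?_) x
          rw [coeff_C]
          split_ifs
          · exact ha
          · exact Submodule.zero_mem _
        | add x _ y _ hx hy =>
          rw [smul_add]
          exact Submodule.add_mem _ hx hy }
  have hY : ∀ x, x ∈ Y ↔ x ∈ (D.radical • ⊤ : Submodule R M) := fun x => Iff.rfl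
  clear_value Y
  have hfin : Module.Finite R (M ⧸ Y) :=
    Module.Finite.of_surjective (Y.mkQ.restrictScalars R) (Submodule.mkQ_surjective Y)
  have hkill : ∀ a ∈ D.radical, ∀ x : M ⧸ Y, a • x = 0 := by
    intro a ha x
    obtain ⟨x, rfl⟩ := Submodule.Quotient.mk_surjective Y x
    rw [← Submodule.Quotient.mk_smul, Submodule.Quotient.mk_eq_zero, hY]
    exact Submodule.smul_mem_smul ha trivial
  have h1 : IsArtinian R (M ⧸ Y) := D.isArtinian_of_radical_smul _ hkill
  have h2 : IsArtinian (SkewPowerSeries D) (M ⧸ Y) := isArtinian_of_tower R h1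
  have h3 : IsNoetherian (SkewPowerSeries D) (M ⧸ Y) := isNoetherian_of_tower R inferInstance
  obtain ⟨N, hN⟩ := exists_X_pow_smul_eq_zero D
    (isFiniteLength_iff_isNoetherian_isArtinian.2 ⟨h3, h2⟩) fun a ha x => by
      rw [C_smul, hkill a ha]
  refine ⟨N, fun x => ?_⟩
  rw [← hY, ← Submodule.Quotient.mk_eq_zero, Submodule.Quotient.mk_smul]
  exact hN _

end SkewPowerSeries

/-! ### Dual operators on rows and columns, and their nilpotence. -/

namespace SkewDerivation

variable {R : Type u} [Ring R] [UniformSpace R] (D : SkewDerivation R)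
variable {ι : Type} [Fintype ι] [DecidableEq ι]

/-- The skew-linear operator on rows with `T(eᵢ) = ∑ⱼ Aᵢⱼ eⱼ`. -/
def rowOp (A : ι → ι → R) : (ι → R) →+ (ι → R) where
  toFun x j := ∑ i, D.σ (x i) * A i j + D.δ (x j)
  map_zero' := by
    funext j
    simp
  map_add' x y := by
    funext j
    simp only [Pi.add_apply, map_add, add_mul, Finset.sum_add_distrib]
    abel

/-- The operator on columns which is dual to `rowOp`. -/
def colOp (A : ι → ι → R) : (ι → R) →+ (ι → R) where
  toFun φ i := D.σ.symm (∑ j, A i j * φ j - D.δ (φ i))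
  map_zero' := by
    funext i
    simp
  map_add' x y := by
    funext i
    simp only [Pi.add_apply, map_add, map_sub, mul_add, Finset.sum_add_distrib]
    abel

variable {D} {A : ι → ι → R}

omit [DecidableEq ι] in
lemma rowOp_apply (x : ι → R) (j : ι) :
    D.rowOp A x j = ∑ i, D.σ (x i) * A i j + D.δ (x j) := rfl

omit [DecidableEq ι] in
lemma sigma_colOp_apply (φ : ι → R) (i : ι) :
    D.σ (D.colOp A φ i) = ∑ j, A i j * φ j - D.δ (φ i) :=
  D.σ.apply_symm_apply _

omit [DecidableEq ι] in
lemma rowOp_smul (r : R) (x : ι → R) :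
    D.rowOp A (r • x) = D.σ r • D.rowOp A x + D.δ r • x := by
  funext j
  simp only [rowOp_apply, Pi.smul_apply, Pi.add_apply, smul_eq_mul, map_mul, D.delta_mul,
    mul_add, Finset.mul_sum, mul_assoc]
  abel

omit [DecidableEq ι] in
-- `rowOp` plays the role of multiplication by `t`, so this mirrors the expansion of `t ^ n * r`.
lemma rowOp_iterate_smul (n : ℕ) (r : R) (x : ι → R) :
    (D.rowOp A)^[n] (r • x) =
      ∑ l ∈ Finset.range (n + 1), D.wordsAt n l r • (D.rowOp A)^[l] x := by
  induction n with
  | zero => simp [wordsAt, words]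
  | succ n ih =>
    have h0 : D.wordsAt n (n + 1) r = 0 := by simp [wordsAt]
    rw [Function.iterate_succ_apply', ih, map_sum, Finset.sum_range_succ' _ (n + 1)]
    simp only [rowOp_smul, ← Function.iterate_succ_apply' (D.rowOp A), Finset.sum_add_distrib,
      wordsAt_succ_succ, wordsAt_succ_zero, add_smul]
    rw [add_assoc]
    congr 1
    rw [Finset.sum_range_succ' _ n, Finset.sum_range_succ _ n, h0, map_zero, zero_smul, add_zero]

omit [DecidableEq ι] in
-- This is the adjunction between the two operators. It allows a factor `colOp` to be traded for a
-- factor `rowOp` or a factor `δ`.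
lemma sigma_sum_mul_colOp (x φ : ι → R) :
    D.σ (∑ i, x i * D.colOp A φ i) =
      ∑ i, D.rowOp A x i * φ i - D.δ (∑ i, x i * φ i) := by
  simp only [map_sum, map_mul, sigma_colOp_apply, rowOp_apply, D.delta_mul, add_mul, mul_sub,
    Finset.sum_add_distrib, Finset.sum_sub_distrib, Finset.mul_sum, Finset.sum_mul]
  rw [Finset.sum_comm]
  simp only [mul_assoc]
  abel

variable (D A) in
/-- Topological nilpotence of `rowOp`. -/
def RowNilpotent : Prop :=
  ∀ U : OpenIdeal R, ∃ N : ℕ, ∀ n, N ≤ n → ∀ x j, (D.rowOp A)^[n] x j ∈ D.core U.1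

/-- Repeated use of the adjunction turns each `colOp` into a `rowOp` or a `δ`, up to `σ⁻¹`, without
lowering the total count. Once no `colOp` is left, there are either at least `m` factors `δ` or at
least `N` factors `rowOp`. -/
lemma RowNilpotent.colOp_iterate_mem (h : RowNilpotent D A) (U : OpenIdeal R) :
    ∃ N : ℕ, ∀ n, N ≤ n → ∀ φ i, (D.colOp A)^[n] φ i ∈ D.core U.1 := by
  obtain ⟨N, hN⟩ := h U
  obtain ⟨m, hm⟩ := D.exists_monomial_mul_mem (exists_jacobson_pow_mul_mem U.2.2)
  have key : ∀ (k c j : ℕ) (F : R →+ R), IsSkewMonomial D.σ D.δ c F → m + N ≤ c + j + k →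
      ∀ (x φ : ι → R) (r : R),
        F (∑ i, (D.rowOp A)^[j] x i * (D.colOp A)^[k] φ i) * r ∈ U.1 := by
    intro k
    induction k with
    | zero =>
      intro c j F hF hc x φ r
      by_cases hcm : m ≤ c
      · exact hm c hcm F hF _ r
      · have h1 : ∑ i, (D.rowOp A)^[j] x i * φ i ∈ D.core U.1 :=
          Submodule.sum_mem _ fun i _ => Ideal.mul_mem_right _ _ (hN j (by omega) x i)
        exact h1 c F hF r
    | succ k ih =>
      intro c j F hF hc x φ r
      have h1 : ∑ i, (D.rowOp A)^[j] x i * (D.colOp A)^[k + 1] φ i =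
          D.σ.symm (∑ i, (D.rowOp A)^[j + 1] x i * (D.colOp A)^[k] φ i) -
          D.σ.symm (D.δ (∑ i, (D.rowOp A)^[j] x i * (D.colOp A)^[k] φ i)) := by
        rw [← map_sub, RingEquiv.eq_symm_apply, Function.iterate_succ_apply',
          Function.iterate_succ_apply', sigma_sum_mul_colOp]
      rw [h1, map_sub, sub_mul]
      exact Submodule.sub_mem _
        (ih c (j + 1) _ hF.comp_sigma_symm (by omega) x φ r)
        (ih (c + 1) j _ hF.comp_sigma_symm.comp_delta (by omega) x φ r)
  refine ⟨m + N, fun n hn φ i k F hF r => ?_⟩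
  -- Pairing with a standard row extracts a single entry of the column.
  have := key n k 0 F hF (by omega) (Pi.single i 1) φ r
  simpa [Pi.single_apply] using this

lemma exists_openIdeal_pow_le [IsTopologicalRing R] (U : OpenIdeal R) :
    ∃ n : ℕ, D.radical ^ (n + 1) ≤ D.core U.1 := D.exists_radical_pow_le_core U.2.1 U.2.2

lemma wordsAt_mem_sup (U : Ideal R) (n k l : ℕ) {a : R} (ha : a ∈ D.radical ^ (n + 1) ⊔ D.core U) :
    D.wordsAt k l a ∈ D.radical ^ (n + 1) ⊔ D.core U := by
  have hw : ∀ k l : ℕ, ∀ a ∈ D.radical ^ (n + 1) ⊔ D.core U,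
      D.words k l a ∈ D.radical ^ (n + 1) ⊔ D.core U := by
    intro k l a ha
    obtain ⟨b, hb, c, hc, rfl⟩ := Submodule.mem_sup.1 ha
    rw [map_add]
    refine Submodule.add_mem_sup ?_ (words_mem_core_of_mem hc k l)
    clear ha hc
    induction k generalizing l with
    | zero =>
      induction l with
      | zero => rwa [words]
      | succ l ih =>
        rw [words]
        exact (delta_mem_radical_pow n ih).2.1
    | succ k ih =>
      induction l with
      | zero =>
        rw [words]
        exact (delta_mem_radical_pow n (ih 0)).1
      | succ l ih' =>
        rw [words]
        exact Submodule.add_mem _ (delta_mem_radical_pow n (ih (l + 1))).1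
          (delta_mem_radical_pow n ih').2.1
  unfold wordsAt
  split_ifs
  · exact hw _ _ a ha
  · exact Submodule.zero_mem _

/-- In the expansion of `rowOp` iterates over the standard rows, the terms with `l ≥ N` acquire a
factor in the radical on the right, and those with `l < N` carry a word with many `δ` on the left.
Each further block of iterations thus gains one power of the radical modulo `D.core U`, until that
power lies in the core. -/
lemma rowNilpotent_of_single [IsTopologicalRing R] {N : ℕ}
    (h : ∀ n, N ≤ n → ∀ i j, (D.rowOp A)^[n] (Pi.single i 1) j ∈ D.radical) :
    RowNilpotent D A := by
  intro U
  obtain ⟨n, hn⟩ := exists_openIdeal_pow_le (D := D) U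
  obtain ⟨w, hw⟩ := D.exists_words_mem_radical
  obtain ⟨w', hw'⟩ := D.exists_words_mem_core (exists_jacobson_pow_mul_mem U.2.2)
  have hexp : ∀ (B : ℕ) (x : ι → R) (j : ι), (D.rowOp A)^[B] x j =
      ∑ i, ∑ l ∈ Finset.range (B + 1),
        D.wordsAt B l (x i) * (D.rowOp A)^[l] (Pi.single i 1) j := by
    intro B x j
    have hx : x = ∑ i, x i • (Pi.single i 1 : ι → R) := by
      funext j
      simp [Pi.single_apply]
    let E : AddMonoid.End (ι → R) := D.rowOp A
    have hB : ∀ x, (D.rowOp A)^[B] x = (E ^ B) x := fun x => by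
      rw [AddMonoid.End.coe_pow]
      rfl
    conv_lhs => rw [hx, hB, map_sum]
    simp only [← hB, Finset.sum_apply, rowOp_iterate_smul, Pi.smul_apply, smul_eq_mul]
  have key : ∀ k, ∃ B₀, ∀ B, B₀ ≤ B → ∀ x j,
      (D.rowOp A)^[B] x j ∈ D.radical ^ (k + 1) ⊔ D.core U.1 := by
    intro k
    induction k with
    | zero =>
      refine ⟨N + w, fun B hB x j => Submodule.mem_sup_left ?_⟩
      rw [zero_add, Submodule.pow_one, hexp]
      refine Submodule.sum_mem _ fun i _ => Submodule.sum_mem _ fun l hl => ?_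
      rw [Finset.mem_range] at hl
      by_cases hlN : N ≤ l
      · exact Ideal.mul_mem_left _ _ (h l hlN i j)
      · refine Ideal.mul_mem_right _ _ ?_
        rw [wordsAt, if_pos (by omega)]
        exact hw _ _ (by omega) _
    | succ k ih =>
      obtain ⟨B₀, hB₀⟩ := ih
      refine ⟨N + w' + B₀, fun B hB x j => ?_⟩
      obtain ⟨C, rfl⟩ := Nat.exists_eq_add_of_le hB
      rw [show N + w' + B₀ + C = (N + w') + (B₀ + C) by omega, Function.iterate_add_apply, hexp]
      refine Submodule.sum_mem _ fun i _ => Submodule.sum_mem _ fun l hl => ?_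
      rw [Finset.mem_range] at hl
      by_cases hlN : N ≤ l
      · have h1 := wordsAt_mem_sup U.1 k (N + w') l (hB₀ (B₀ + C) (by omega) x i)
        obtain ⟨b, hb, c, hc, hbc⟩ := Submodule.mem_sup.1 h1
        rw [← hbc, add_mul]
        exact Submodule.add_mem_sup
          (Submodule.mul_mem_mul (M := D.radical ^ (k + 1)) (N := D.radical) hb (h l hlN i j))
          (Ideal.mul_mem_right _ _ hc)
      · refine Submodule.mem_sup_right (Ideal.mul_mem_right _ _ ?_)
        rw [wordsAt, if_pos (by omega)]
        exact hw' _ _ (by omega) _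
  obtain ⟨B, hB⟩ := key n
  exact ⟨B, fun b hb x j => sup_le hn le_rfl (hB b hb x j)⟩

section Limit

variable [IsPseudocompactRing R]

lemma eq_zero_of_forall_mem_core {x : R} (h : ∀ U : OpenIdeal R, x ∈ D.core U.1) : x = 0 := by
  by_contra hx
  obtain ⟨L, hL, hLU, hfl⟩ := IsPseudocompactRing.exists_leftIdeal_subset ({x}ᶜ : Set R)
    (isOpen_compl_singleton.mem_nhds fun h => hx h.symm)
  exact hLU (core_le (D := D) (h ⟨L, hL, hfl⟩)) rfl

/-- One sum serves all `U`; its tails stay in the cores because these are closed. Later arguments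
use only such congruences. -/
lemma exists_limit (f : ℕ → R) (hf : ∀ U : OpenIdeal R, ∃ K, ∀ k, K ≤ k → f k ∈ D.core U.1) :
    ∃ z, ∀ (U : OpenIdeal R) (K : ℕ), (∀ k, K ≤ k → f k ∈ D.core U.1) →
      z - ∑ k ∈ Finset.range K, f k ∈ D.core U.1 := by
  have := nonarchimedeanAddGroup R
  have hs : Summable f := by
    apply NonarchimedeanAddGroup.summable_of_tendsto_cofinite_zero
    rw [Nat.cofinite_eq_atTop]
    intro V hV
    obtain ⟨L, hL, hLV, hfl⟩ := IsPseudocompactRing.exists_leftIdeal_subset V hV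
    obtain ⟨K, hK⟩ := hf ⟨L, hL, hfl⟩
    rw [Filter.mem_map, Filter.mem_atTop_sets]
    exact ⟨K, fun k hk => hLV (core_le (hK k hk))⟩
  refine ⟨∑' k, f k, fun U K hK => ?_⟩
  rw [← hs.sum_add_tsum_nat_add K, add_sub_cancel_left]
  refine (isClosed_core (D := D) (isClosed_of_isOpen U.2.1)).mem_of_tendsto
    ((summable_nat_add_iff K).2 hs).hasSum
    (Filter.Eventually.of_forall fun s => Submodule.sum_mem _ fun k _ => hK _ (by omega))

end Limit

end SkewDerivation

open SkewDerivation

/-! ### Division with remainder by `t - A`. -/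

namespace SkewPowerSeries

variable {R : Type u} [Ring R] [UniformSpace R] [IsPseudocompactRing R] {D : SkewDerivation R}
variable {ι : Type} [Fintype ι] [DecidableEq ι] {A : ι → ι → R}

lemma eq_zero_of_forall_coeff_mem {b : SkewPowerSeries D}
    (h : ∀ (U : OpenIdeal R) m, coeff m b ∈ D.core U.1) : b = 0 :=
  ext fun m => eq_zero_of_forall_mem_core fun U => h U m

lemma isClosed_core_openIdeal (U : OpenIdeal R) : IsClosed (D.core U.1 : Set R) :=
  isClosed_core (isClosed_of_isOpen U.2.1)

lemma coeff_mul_C_mem (U : OpenIdeal R) (a : SkewPowerSeries D) {r : R} (hr : r ∈ D.core U.1)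
    (m : ℕ) : coeff m (a * C D r) ∈ D.core U.1 :=
  coeff_mul_mem_of_right (isClosed_core_openIdeal U) fun i _ => by
    rw [coeff_C]
    split_ifs
    · exact hr
    · exact Submodule.zero_mem _

variable (D A) in
/-- The endomorphism `q ↦ q (t - A)` of the left module of rows. -/
noncomputable def rowMap : (ι → SkewPowerSeries D) →ₗ[SkewPowerSeries D] (ι → SkewPowerSeries D)
    where
  toFun q j := q j * X - ∑ i, q i * C D (A i j)
  map_add' p q := by
    funext j
    simp only [Pi.add_apply, add_mul, Finset.sum_add_distrib]
    abel
  map_smul' s q := by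
    funext j
    simp only [Pi.smul_apply, smul_eq_mul, mul_assoc, RingHom.id_apply, mul_sub, Finset.mul_sum]

omit [DecidableEq ι] in
lemma rowMap_apply (q : ι → SkewPowerSeries D) (j : ι) :
    rowMap D A q j = q j * X - ∑ i, q i * C D (A i j) := rfl

/-- Uniqueness of the remainder in the division by `t - A`, for rows. -/
theorem eq_zero_of_rowMap_eq (hA : RowNilpotent D A) {q : ι → SkewPowerSeries D} {r : ι → R}
    (h : ∀ j, rowMap D A q j = C D (r j)) : q = 0 := by
  -- Up to constants, `Q` turns `colOp` into right multiplication by `t`. Hence a coefficient of `Q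
  -- ψ` equals coefficients of arbitrarily high degree of `Q` at iterates of `colOp`, which tend to
  -- zero.
  let Q : (ι → R) → SkewPowerSeries D := fun ψ => ∑ j, q j * C D (D.σ (ψ j))
  have hQ : ∀ ψ, Q ψ * X = Q (D.colOp A ψ) + C D (∑ j, r j * ψ j) := by
    intro ψ
    have h1 : ∀ j, q j * C D (D.σ (ψ j)) * X =
        q j * X * C D (ψ j) - q j * C D (D.δ (ψ j)) := fun j => by
      rw [mul_assoc, mul_assoc, X_mul_C, mul_add, add_sub_cancel_right]
    have h2 : ∀ j, q j * X = C D (r j) + ∑ i, q i * C D (A i j) := fun j => by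
      rw [← h j, rowMap_apply, sub_add_cancel]
    simp only [Q, Finset.sum_mul, h1, h2, sigma_colOp_apply, map_sub, map_sum, map_mul, add_mul,
      mul_sub, Finset.sum_sub_distrib, Finset.sum_add_distrib, Finset.mul_sum]
    rw [Finset.sum_comm (f := fun j i => q i * C D (A i j) * C D (ψ j))]
    simp only [mul_assoc]
    abel
  have hcoeff : ∀ k m ψ, coeff m (Q ψ) = coeff (m + k) (Q ((D.colOp A)^[k] ψ)) := by
    intro k
    induction k with
    | zero => intro m ψ; rfl
    | succ k ih =>
      intro m ψ
      rw [ih, ← coeff_mul_X_succ, hQ, coeff_add, coeff_C, if_neg (by omega), add_zero,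
        Function.iterate_succ_apply', add_assoc]
  have hzero : ∀ ψ, Q ψ = 0 := by
    intro ψ
    refine eq_zero_of_forall_coeff_mem fun U m => ?_
    obtain ⟨N, hN⟩ := hA.colOp_iterate_mem U
    rw [hcoeff N, coeff_sum]
    exact Submodule.sum_mem _ fun j _ => coeff_mul_C_mem U _ (sigma_mem_core (hN N le_rfl ψ j)) _
  funext j
  have := hzero (Pi.single j 1)
  simp only [Q] at this
  rw [Finset.sum_eq_single j] at this
  · simpa using this
  · intro i _ hij
    simp [Pi.single_eq_of_ne hij]
  · simp

/-- Division by `t - A`, for rows. -/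
theorem exists_rowMap_eq (hA : RowNilpotent D A) (s : SkewPowerSeries D) (i : ι) :
    ∃ (q : ι → SkewPowerSeries D) (z : ι → R), ∀ j,
      rowMap D A q j = (Pi.single i s : ι → SkewPowerSeries D) j - C D (z j) := by
  let c : ℕ → ι → R := fun k => (D.rowOp A)^[k] (Pi.single i 1)
  have hc : ∀ U : OpenIdeal R, ∃ K, ∀ k, K ≤ k → ∀ j, c k j ∈ D.core U.1 := fun U =>
    (hA U).imp fun N hN k hk j => hN k hk _ j
  -- The quotient is the sum of the `f k`: by `shift_succ_mul_X`, their images under `rowMap`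
  -- telescope, leaving the remainder `∑ coeff k s * c k`.
  let f : ℕ → ι → SkewPowerSeries D := fun k l => shift (k + 1) s * C D (D.σ (c k l))
  have hz : ∀ j, ∃ z, ∀ (U : OpenIdeal R) (K : ℕ), (∀ k, K ≤ k → coeff k s * c k j ∈ D.core U.1) →
      z - ∑ k ∈ Finset.range K, coeff k s * c k j ∈ D.core U.1 := fun j =>
    exists_limit _ fun U => (hc U).imp fun K hK k hk => Ideal.mul_mem_left _ _ (hK k hk j)
  choose z hz using hz
  have hq : ∀ l m, ∃ x, ∀ (U : OpenIdeal R) (K : ℕ), (∀ k, K ≤ k → coeff m (f k l) ∈ D.core U.1) →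
      x - ∑ k ∈ Finset.range K, coeff m (f k l) ∈ D.core U.1 := fun l m =>
    exists_limit _ fun U => (hc U).imp fun K hK k hk =>
      coeff_mul_C_mem U _ (sigma_mem_core (hK k hk l)) m
  choose x hx using hq
  let q : ι → SkewPowerSeries D := fun l => mk fun m => x l m
  refine ⟨q, z, fun j => sub_eq_zero.1 (eq_zero_of_forall_coeff_mem (D := D) fun U m => ?_)⟩
  obtain ⟨K, hK⟩ := hc U
  have htel : ∀ K, rowMap D A (∑ k ∈ Finset.range K, f k) j =
      s * C D (c 0 j) - C D (∑ k ∈ Finset.range K, coeff k s * c k j) -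
        shift K s * C D (c K j) := by
    intro K
    induction K with
    | zero =>
      have : shift 0 s = s := ext fun m => by simp
      simp [this]
    | succ K ih =>
      have h1 : rowMap D A (f K) j = shift (K + 1) s * X * C D (c K j) -
          shift (K + 1) s * C D (c (K + 1) j) := by
        have h2 : c (K + 1) = D.rowOp A (c K) := Function.iterate_succ_apply' _ _ _
        rw [h2, rowOp_apply, rowMap_apply]
        simp only [f, mul_assoc, ← map_mul, ← Finset.mul_sum, ← map_sum]
        rw [← mul_sub, ← mul_sub, X_mul_C, map_add]
        congr 1
        abel
      rw [Finset.sum_range_succ, map_add, Pi.add_apply, ih, h1, shift_succ_mul_X,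
        Finset.sum_range_succ, map_add, map_mul, sub_mul]
      abel
  have hrem : ∀ l m, coeff m (q l - (∑ k ∈ Finset.range K, f k) l) ∈ D.core U.1 := by
    intro l m
    rw [coeff_sub, Finset.sum_apply, coeff_sum]
    exact hx l m U K fun k hk => coeff_mul_C_mem U _ (sigma_mem_core (hK k hk l)) m
  have hsingle : s * C D (c 0 j) = (Pi.single i s : ι → SkewPowerSeries D) j := by
    by_cases hij : j = i
    · subst hij
      simp [c]
    · simp [c, Pi.single_eq_of_ne hij]
  have hdecomp : rowMap D A q j - ((Pi.single i s : ι → SkewPowerSeries D) j - C D (z j)) =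
      rowMap D A (q - ∑ k ∈ Finset.range K, f k) j +
        C D (z j - ∑ k ∈ Finset.range K, coeff k s * c k j) - shift K s * C D (c K j) := by
    rw [map_sub, Pi.sub_apply, htel, hsingle, map_sub]
    abel
  rw [hdecomp, coeff_sub, coeff_add]
  refine Submodule.sub_mem _ (Submodule.add_mem _ ?_ ?_) (coeff_mul_C_mem U _ (hK K le_rfl j) m)
  · rw [rowMap_apply, coeff_sub, coeff_sum]
    exact Submodule.sub_mem _
      (coeff_mul_mem_of_left (isClosed_core_openIdeal U) _ (hrem j) m)
      (Submodule.sum_mem _ fun l _ =>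
        coeff_mul_mem_of_left (isClosed_core_openIdeal U) _ (hrem l) m)
  · rw [coeff_C]
    split_ifs
    · exact hz j U K fun k hk => Ideal.mul_mem_left _ _ (hK k hk j)
    · exact Submodule.zero_mem _

variable (D A) in
/-- The endomorphism `φ ↦ (t - A) φ` of the right module of columns. -/
noncomputable def colMap : (ι → SkewPowerSeries D) →+ (ι → SkewPowerSeries D) where
  toFun φ i := X * φ i - ∑ j, C D (A i j) * φ j
  map_zero' := by
    funext i
    simp
  map_add' p q := by
    funext j
    simp only [Pi.add_apply, mul_add, Finset.sum_add_distrib]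
    abel

omit [DecidableEq ι] in
lemma colMap_apply (φ : ι → SkewPowerSeries D) (i : ι) :
    colMap D A φ i = X * φ i - ∑ j, C D (A i j) * φ j := rfl

omit [DecidableEq ι] in
lemma coeff_colMap_zero (φ : ι → SkewPowerSeries D) (i : ι) :
    coeff 0 (colMap D A φ i) = -D.σ (D.colOp A (fun j => coeff 0 (φ j)) i) := by
  rw [colMap_apply, coeff_sub, coeff_X_mul_zero, coeff_sum, sigma_colOp_apply, neg_sub]
  simp only [C_mul, coeff_smul]

omit [DecidableEq ι] in
lemma coeff_colMap_succ (φ : ι → SkewPowerSeries D) (i : ι) (m : ℕ) :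
    coeff (m + 1) (colMap D A φ i) =
      D.σ (coeff m (φ i) - D.colOp A (fun j => coeff (m + 1) (φ j)) i) := by
  rw [colMap_apply, coeff_sub, coeff_X_mul_succ, coeff_sum, map_sub, sigma_colOp_apply]
  simp only [C_mul, coeff_smul]
  abel

/-- Uniqueness of the remainder in the division by `t - A`, for columns. -/
theorem eq_zero_of_colMap_eq (hA : RowNilpotent D A) {φ : ι → SkewPowerSeries D} {r : ι → R}
    (h : ∀ i, colMap D A φ i = C D (r i)) : φ = 0 := by
  have h1 : ∀ m, (fun j => coeff m (φ j)) = D.colOp A fun j => coeff (m + 1) (φ j) := by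
    intro m
    funext i
    have := coeff_colMap_succ (A := A) φ i m
    rw [h, coeff_C, if_neg (by omega)] at this
    exact sub_eq_zero.1 ((map_eq_zero_iff _ D.σ.injective).1 this.symm)
  have h2 : ∀ k m, (fun j => coeff m (φ j)) = (D.colOp A)^[k] fun j => coeff (m + k) (φ j) := by
    intro k
    induction k with
    | zero => intro m; rfl
    | succ k ih =>
      intro m
      rw [ih, h1, Function.iterate_succ_apply]
      rfl
  funext i
  refine eq_zero_of_forall_coeff_mem fun U m => ?_
  obtain ⟨N, hN⟩ := hA.colOp_iterate_mem U
  rw [show coeff m (φ i) = _ from congrFun (h2 N m) i]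
  exact hN N le_rfl _ i

/-- Division by `t - A`, for columns. -/
theorem exists_colMap_eq (hA : RowNilpotent D A) (g : ι → SkewPowerSeries D) :
    ∃ (φ : ι → SkewPowerSeries D) (r : ι → R), ∀ i, g i = colMap D A φ i + C D (D.σ (r i)) := by
  let h : ℕ → ι → R := fun m i => D.σ.symm (coeff (m + 1) (g i))
  -- The coefficients must satisfy `φ_m = h_m + colOp φ_{m+1}`. Unrolling this recursion gives the
  -- series `∑ colOp^k h_{m+k}`.
  let f : ℕ → ℕ → ι → R := fun m k => (D.colOp A)^[k] (h (m + k))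
  have hx : ∀ m i, ∃ x, ∀ (U : OpenIdeal R) (K : ℕ), (∀ k, K ≤ k → f m k i ∈ D.core U.1) →
      x - ∑ k ∈ Finset.range K, f m k i ∈ D.core U.1 := fun m i =>
    exists_limit _ fun U => (hA.colOp_iterate_mem U).imp fun N hN k hk => hN k hk _ i
  choose x hx using hx
  let φ : ι → SkewPowerSeries D := fun i => mk fun m => x m i
  have hcol : ∀ (U : OpenIdeal R) (y : ι → R), (∀ i, y i ∈ D.core U.1) →
      ∀ i, D.colOp A y i ∈ D.core U.1 := fun U y hy i =>
    sigma_symm_mem_core (Submodule.sub_mem _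
      (Submodule.sum_mem _ fun j _ => Ideal.mul_mem_left _ _ (hy j)) (delta_mem_core (hy i)))
  have hrec : ∀ m i, x m i - D.colOp A (x (m + 1)) i = h m i := by
    intro m i
    refine sub_eq_zero.1 (eq_zero_of_forall_mem_core (D := D) fun U => ?_)
    obtain ⟨N, hN⟩ := hA.colOp_iterate_mem U
    have h1 := hx m i U (N + 1) fun k hk => hN k (by omega) _ i
    have h2 := hcol U (x (m + 1) - ∑ k ∈ Finset.range N, f (m + 1) k) (fun j => by
      rw [Pi.sub_apply, Finset.sum_apply]
      exact hx (m + 1) j U N fun k hk => hN k hk _ j) i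
    have h3 : D.colOp A (∑ k ∈ Finset.range N, f (m + 1) k) =
        ∑ k ∈ Finset.range N, f m (k + 1) := by
      rw [map_sum]
      refine Finset.sum_congr rfl fun k _ => ?_
      simp only [f, Function.iterate_succ_apply']
      rw [show m + 1 + k = m + (k + 1) by omega]
    rw [map_sub, h3, Pi.sub_apply, Finset.sum_apply] at h2
    rw [Finset.sum_range_succ'] at h1
    have := Submodule.sub_mem _ h1 h2
    have h4 : f m 0 i = h m i := rfl
    rw [h4] at this
    convert this using 1
    abel
  -- The recursion settles positive degrees; the remainder is forced by degree zero, where `colMap`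
  -- contributes `-σ` of `colOp`.
  refine ⟨φ, fun i => D.σ.symm (coeff 0 (g i)) + D.colOp A (fun j => coeff 0 (φ j)) i,
    fun i => ext fun m => ?_⟩
  cases m with
  | zero =>
    rw [coeff_add, coeff_colMap_zero, coeff_C, if_pos rfl, map_add, RingEquiv.apply_symm_apply]
    abel
  | succ m =>
    rw [coeff_add, coeff_colMap_succ, coeff_C, if_neg (by omega), add_zero]
    have := congrArg D.σ (hrec m i)
    simp only [h, RingEquiv.apply_symm_apply] at this
    exact this.symm

end SkewPowerSeries

/-! ### The long exact sequence of the duals. -/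

namespace ExtDual

variable {A : Type u} [Ring A]
variable {N N' N'' : Type u} [AddCommGroup N] [Module A N] [AddCommGroup N'] [Module A N']
  [AddCommGroup N''] [Module A N'']

/-- The contravariant functoriality of `Ext^k_A(-, A)`. -/
noncomputable def map (f : N →ₗ[A] N') (k : ℕ) : ExtDual A N' k →+ ExtDual A N k :=
  (Ext.mk₀ (ModuleCat.ofHom f)).precomp _ (zero_add k)

lemma map_apply (f : N →ₗ[A] N') (k : ℕ) (x : ExtDual A N' k) :
    map f k x = (Ext.mk₀ (ModuleCat.ofHom f)).comp x (zero_add k) := rfl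

lemma map_map (f : N →ₗ[A] N') (g : N' →ₗ[A] N'') (k : ℕ) (x : ExtDual A N'' k) :
    map f k (map g k x) = map (g ∘ₗ f) k x := by
  simp only [map_apply, Ext.mk₀_comp_mk₀_assoc, ModuleCat.ofHom_comp]

@[simp] lemma map_id (k : ℕ) (x : ExtDual A N k) : map (LinearMap.id : N →ₗ[A] N) k x = x :=
  Ext.mk₀_id_comp x

@[simp] lemma map_zero_left (k : ℕ) (x : ExtDual A N' k) : map (0 : N →ₗ[A] N') k x = 0 := by
  rw [map_apply, ModuleCat.ofHom_zero, Ext.mk₀_zero, Ext.zero_comp]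

/-- The class of a linear form in `Ext⁰`. -/
noncomputable def ofLinear (φ : N →ₗ[A] A) : ExtDual A N 0 := Ext.mk₀ (ModuleCat.ofHom φ)

lemma ofLinear_surjective (x : ExtDual A N 0) : ∃ φ : N →ₗ[A] A, ofLinear φ = x := by
  obtain ⟨f, rfl⟩ := (Ext.mk₀_bijective _ _).2 x
  exact ⟨f.hom, rfl⟩

lemma ofLinear_eq_zero {φ : N →ₗ[A] A} : ofLinear φ = 0 ↔ φ = 0 := by
  rw [ofLinear, Ext.mk₀_eq_zero_iff]
  exact ⟨fun h => congrArg ModuleCat.Hom.hom h, fun h => by rw [h, ModuleCat.ofHom_zero]⟩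

lemma ofLinear_injective : Function.Injective (ofLinear : (N →ₗ[A] A) → ExtDual A N 0) := by
  intro φ ψ h
  exact congrArg ModuleCat.Hom.hom ((Ext.mk₀_bijective _ _).1 h)

lemma map_ofLinear (f : N →ₗ[A] N') (φ : N' →ₗ[A] A) :
    map f 0 (ofLinear φ) = ofLinear (φ ∘ₗ f) := by
  rw [map_apply, ofLinear, Ext.mk₀_comp_mk₀]
  rfl

lemma subsingleton_zero_iff : Subsingleton (ExtDual A N 0) ↔ ∀ φ : N →ₗ[A] A, φ = 0 := by
  constructor
  · intro h φ
    exact ofLinear_eq_zero.1 (Subsingleton.elim _ _)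
  · intro h
    refine subsingleton_of_forall_eq 0 fun x => ?_
    obtain ⟨φ, rfl⟩ := ofLinear_surjective x
    exact ofLinear_eq_zero.2 (h φ)

lemma subsingleton_of_linearEquiv (e : N ≃ₗ[A] N') {k : ℕ} (h : Subsingleton (ExtDual A N k)) :
    Subsingleton (ExtDual A N' k) := by
  refine subsingleton_of_forall_eq 0 fun x => ?_
  have h1 : map (e.symm : N' →ₗ[A] N) k (map (e : N →ₗ[A] N') k x) = x := by
    rw [map_map, LinearEquiv.comp_symm, map_id]
  rw [← h1, Subsingleton.elim (map (e : N →ₗ[A] N') k x) 0, AddMonoidHom.map_zero]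

lemma subsingleton_of_projective [Module.Projective A N] (k : ℕ) :
    Subsingleton (ExtDual A N (k + 1)) := by
  have : Projective (ModuleCat.of A N) := inferInstance
  exact subsingleton_of_forall_eq 0 Ext.eq_zero_of_projective

variable {f : N →ₗ[A] N'} {g : N' →ₗ[A] N''}

lemma shortExact (hf : Function.Injective f) (hg : Function.Surjective g)
    (hfg : Function.Exact f g) :
    (ShortComplex.mk (ModuleCat.ofHom f) (ModuleCat.ofHom g)
      (by ext x; exact hfg.apply_apply_eq_zero x)).ShortExact where
  exact := (ShortComplex.ShortExact.moduleCat_exact_iff_function_exact _).2 hfg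
  mono_f := (ModuleCat.mono_iff_injective _).2 hf
  epi_g := (ModuleCat.epi_iff_surjective _).2 hg

variable (hf : Function.Injective f) (hg : Function.Surjective g) (hfg : Function.Exact f g)

/-- The connecting homomorphisms of the long exact sequence of `Ext^*_A(-, A)`. -/
noncomputable def connecting (k : ℕ) : ExtDual A N k →+ ExtDual A N'' (k + 1) :=
  (shortExact hf hg hfg).extClass.precomp _ (add_comm 1 k)

lemma connecting_apply (k : ℕ) (x : ExtDual A N k) :
    connecting hf hg hfg k x = (shortExact hf hg hfg).extClass.comp x (add_comm 1 k) := rfl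

lemma connecting_map (k : ℕ) (x : ExtDual A N' k) : connecting hf hg hfg k (map f k x) = 0 :=
  (shortExact hf hg hfg).extClass_comp_assoc x (h := add_comm 1 k)

include hf hg hfg in
lemma exists_map_eq_of_map_eq_zero {k : ℕ} {x : ExtDual A N' k} (hx : map f k x = 0) :
    ∃ y, map g k y = x :=
  Ext.contravariant_sequence_exact₂ (shortExact hf hg hfg) _ x hx

lemma exists_map_eq_of_connecting_eq_zero {k : ℕ} {x : ExtDual A N k}
    (hx : connecting hf hg hfg k x = 0) : ∃ y, map f k y = x :=
  Ext.contravariant_sequence_exact₁ (shortExact hf hg hfg) _ x (add_comm 1 k) hx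

lemma exists_connecting_eq_of_map_eq_zero {k : ℕ} {x : ExtDual A N'' (k + 1)}
    (hx : map g (k + 1) x = 0) : ∃ y, connecting hf hg hfg k y = x :=
  Ext.contravariant_sequence_exact₃ (shortExact hf hg hfg) _ x hx (add_comm 1 k)

include hf hg hfg in
lemma map_injective_of_subsingleton {k : ℕ} (h : Subsingleton (ExtDual A N k)) :
    Function.Injective (map g (k + 1)) := by
  refine (injective_iff_map_eq_zero _).2 fun x hx => ?_
  obtain ⟨y, rfl⟩ := exists_connecting_eq_of_map_eq_zero hf hg hfg hx
  rw [Subsingleton.elim y 0, AddMonoidHom.map_zero]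

lemma map_injective_zero (hg : Function.Surjective g) : Function.Injective (map g 0) := by
  refine (injective_iff_map_eq_zero _).2 fun x hx => ?_
  obtain ⟨φ, rfl⟩ := ofLinear_surjective x
  rw [map_ofLinear, ofLinear_eq_zero] at hx
  rw [ofLinear_eq_zero]
  ext y
  obtain ⟨z, rfl⟩ := hg y
  exact LinearMap.congr_fun hx z

include hf hg hfg in
lemma subsingleton_left {k : ℕ} (h2 : Subsingleton (ExtDual A N' k))
    (h3 : Subsingleton (ExtDual A N'' (k + 1))) : Subsingleton (ExtDual A N k) := by
  refine subsingleton_of_forall_eq 0 fun x => ?_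
  obtain ⟨y, rfl⟩ := exists_map_eq_of_connecting_eq_zero hf hg hfg (x := x) (Subsingleton.elim _ _)
  rw [Subsingleton.elim y 0, AddMonoidHom.map_zero]

include hf hg hfg in
lemma subsingleton_right {k : ℕ} (h1 : Subsingleton (ExtDual A N k))
    (h2 : Subsingleton (ExtDual A N' (k + 1))) : Subsingleton (ExtDual A N'' (k + 1)) :=
  (map_injective_of_subsingleton hf hg hfg h1).subsingleton

include hf hg hfg in
/-- Dimension shifting. -/
lemma subsingleton_succ_iff {k : ℕ} (h2 : Subsingleton (ExtDual A N' k))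
    (h2' : Subsingleton (ExtDual A N' (k + 1))) :
    Subsingleton (ExtDual A N'' (k + 1)) ↔ Subsingleton (ExtDual A N k) :=
  ⟨fun h => subsingleton_left hf hg hfg h2 h, fun h => subsingleton_right hf hg hfg h h2'⟩

end ExtDual

/-! ### The Ext groups of the modules `S^ι / S^ι (t - A)`. -/

namespace SkewPowerSeries

variable {R : Type u} [Ring R] [UniformSpace R] [IsPseudocompactRing R] {D : SkewDerivation R}
variable {ι κ : Type} [Fintype ι] [DecidableEq ι] [Fintype κ] [DecidableEq κ]
variable {A : ι → ι → R} {B : κ → κ → R}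

variable (D A) in
/-- The module with generators `eᵢ` and relations `t eᵢ = ∑ⱼ Aᵢⱼ eⱼ`. -/
abbrev RowModule : Type u := (ι → SkewPowerSeries D) ⧸ LinearMap.range (rowMap D A)

variable (D ι) in
/-- The inclusion of the rows of constants. -/
noncomputable def constRow : (ι → R) →ₗ[R] (ι → SkewPowerSeries D) where
  toFun r j := C D (r j)
  map_add' r s := by
    funext j
    simp
  map_smul' r s := by
    funext j
    simp [C_mul]

omit [Fintype ι] [DecidableEq ι] in
lemma constRow_apply (r : ι → R) (j : ι) : constRow D ι r j = C D (r j) := rfl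

omit [Fintype ι] [DecidableEq ι] in
lemma C_injective : Function.Injective (C D) := fun r s h => by
  have := congrArg (coeff 0) h
  simpa [coeff_C] using this

/-- Uniqueness of division: zero is the only constant row divisible by `t - A`. -/
lemma constRow_mem_range_iff (hA : RowNilpotent D A) {r : ι → R} :
    constRow D ι r ∈ LinearMap.range (rowMap D A) ↔ r = 0 := by
  constructor
  · rintro ⟨q, hq⟩
    have hq0 := eq_zero_of_rowMap_eq hA (fun j => congrFun hq j)
    subst hq0
    rw [map_zero] at hq
    funext j
    have := congrFun hq.symm j
    exact C_injective (by simpa [constRow_apply] using this)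
  · rintro rfl
    rw [map_zero]
    exact Submodule.zero_mem _

lemma rowMap_injective (hA : RowNilpotent D A) : Function.Injective (rowMap D A) :=
  (injective_iff_map_eq_zero _).2 fun q hq =>
    eq_zero_of_rowMap_eq hA (r := 0) fun j => by rw [hq]; simp

/-- `RowModule` is free over the coefficient ring. -/
noncomputable def rowModuleEquiv (hA : RowNilpotent D A) : (ι → R) ≃ₗ[R] RowModule D A :=
  LinearEquiv.ofBijective
    (((LinearMap.range (rowMap D A)).mkQ.restrictScalars R).comp (constRow D ι)) (by
      constructor
      · refine (injective_iff_map_eq_zero _).2 fun r hr => ?_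
        exact (constRow_mem_range_iff hA).1 ((Submodule.Quotient.mk_eq_zero _).1 hr)
      · intro y
        obtain ⟨v, rfl⟩ := Submodule.Quotient.mk_surjective _ y
        choose q z hqz using fun i => exists_rowMap_eq hA (v i) i
        refine ⟨∑ i, z i, ?_⟩
        refine (Submodule.Quotient.eq _).2 ⟨-∑ i, q i, ?_⟩
        rw [map_neg, map_sum, map_sum]
        funext j
        simp only [Pi.neg_apply, Pi.sub_apply, Finset.sum_apply, hqz, Finset.sum_sub_distrib,
          constRow_apply]
        rw [Finset.sum_eq_single j (fun i _ hij => Pi.single_eq_of_ne hij.symm _) (by simp),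
          Pi.single_eq_same]
        abel)

lemma rowModuleEquiv_apply (hA : RowNilpotent D A) (r : ι → R) :
    rowModuleEquiv hA r = Submodule.Quotient.mk (constRow D ι r) := rfl

omit [Fintype ι] in
lemma constRow_single (i : ι) (r : R) : constRow D ι (Pi.single i r) = Pi.single i (C D r) := by
  funext j
  rw [constRow_apply]
  by_cases h : j = i
  · subst h; simp
  · simp [Pi.single_eq_of_ne h]

variable (D A) in
/-- The generators of `RowModule`. -/
noncomputable def rowGen (i : ι) : RowModule D A := Submodule.Quotient.mk (Pi.single i 1)

lemma rowModuleEquiv_single (hA : RowNilpotent D A) (i : ι) :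
    rowModuleEquiv hA (Pi.single i 1) = rowGen D A i := by
  rw [rowModuleEquiv_apply, constRow_single, map_one]
  rfl

/-- The linear map of rows with constant matrix `F`. -/
noncomputable def matMap (F : ι → κ → R) :
    (ι → SkewPowerSeries D) →ₗ[SkewPowerSeries D] (κ → SkewPowerSeries D) where
  toFun q k := ∑ i, q i * C D (F i k)
  map_add' p q := by
    funext k
    simp only [Pi.add_apply, add_mul, Finset.sum_add_distrib]
  map_smul' s q := by
    funext k
    simp only [Pi.smul_apply, smul_eq_mul, mul_assoc, RingHom.id_apply, Finset.mul_sum]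

omit [Fintype κ] [DecidableEq κ] [DecidableEq ι] in
lemma matMap_apply (F : ι → κ → R) (q : ι → SkewPowerSeries D) (k : κ) :
    matMap F q k = ∑ i, q i * C D (F i k) := rfl

omit [Fintype κ] [DecidableEq κ] in
lemma matMap_single (F : ι → κ → R) (i : ι) :
    matMap F (Pi.single i 1) = constRow D κ (F i) := by
  funext k
  rw [matMap_apply, Finset.sum_eq_single i]
  · simp [constRow_apply]
  · intro j _ hj
    simp [Pi.single_eq_of_ne hj]
  · simp

lemma linearMap_ext_single {N : Type*} [AddCommGroup N] [Module (SkewPowerSeries D) N]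
    {f g : (ι → SkewPowerSeries D) →ₗ[SkewPowerSeries D] N}
    (h : ∀ i, f (Pi.single i 1) = g (Pi.single i 1)) : f = g := by
  refine LinearMap.pi_ext fun i s => ?_
  have : (Pi.single i s : ι → SkewPowerSeries D) = s • Pi.single i 1 := by
    rw [← Pi.single_smul, smul_eq_mul, mul_one]
  rw [this, map_smul, map_smul, h]

/-- The row of coefficients of the image of a generator. -/
noncomputable def rowMatrix (hB : RowNilpotent D B)
    (f : RowModule D A →ₗ[SkewPowerSeries D] RowModule D B) (i : ι) : κ → R :=
  (rowModuleEquiv hB).symm (f (rowGen D A i))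

lemma mkQ_comp_matMap (hB : RowNilpotent D B)
    (f : RowModule D A →ₗ[SkewPowerSeries D] RowModule D B) :
    (LinearMap.range (rowMap D B)).mkQ ∘ₗ matMap (rowMatrix hB f) =
      f ∘ₗ (LinearMap.range (rowMap D A)).mkQ := by
  refine linearMap_ext_single fun i => ?_
  rw [LinearMap.comp_apply, LinearMap.comp_apply, matMap_single]
  exact (rowModuleEquiv hB).apply_symm_apply _

lemma rowMap_single (i : ι) :
    rowMap D A (Pi.single i 1) = Pi.single i X - constRow D ι (A i) := by
  funext j
  rw [rowMap_apply, Pi.sub_apply, Finset.sum_eq_single i]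
  · by_cases h : j = i
    · subst h; simp [constRow_apply]
    · simp [Pi.single_eq_of_ne h, constRow_apply]
  · intro k _ hk
    simp [Pi.single_eq_of_ne hk]
  · simp

/-- The twist by `σ` comes from `t F = σ(F) t + δ(F)`. On a generator the two sides differ by a
constant row, and both lie in the range of `rowMap D B` because the matrix lifts `f`. Such a
constant row is zero. -/
lemma rowMap_comp_matMap (hB : RowNilpotent D B)
    (f : RowModule D A →ₗ[SkewPowerSeries D] RowModule D B) :
    rowMap D B ∘ₗ matMap (fun i k => D.σ (rowMatrix hB f i k)) =
      matMap (rowMatrix hB f) ∘ₗ rowMap D A := by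
  set F := rowMatrix hB f with hF
  refine linearMap_ext_single fun i => ?_
  rw [LinearMap.comp_apply, LinearMap.comp_apply]
  have hmem : matMap F (rowMap D A (Pi.single i 1)) ∈ LinearMap.range (rowMap D B) := by
    have h := LinearMap.congr_fun (mkQ_comp_matMap hB f) (rowMap D A (Pi.single i 1))
    have h0 : (LinearMap.range (rowMap D A)).mkQ (rowMap D A (Pi.single i 1)) = 0 :=
      (Submodule.Quotient.mk_eq_zero _).2 ⟨_, rfl⟩
    rw [LinearMap.comp_apply, LinearMap.comp_apply, h0, map_zero] at h
    exact (Submodule.Quotient.mk_eq_zero _).1 h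
  let c : κ → R := fun k =>
    -(∑ l, D.σ (F i l) * B l k) - D.δ (F i k) + ∑ j, A i j * F j k
  have hc : rowMap D B (matMap (fun i k => D.σ (F i k)) (Pi.single i 1)) -
      matMap F (rowMap D A (Pi.single i 1)) = constRow D κ c := by
    rw [matMap_single, rowMap_single, map_sub]
    have h1 : matMap F (Pi.single i X : ι → SkewPowerSeries D) =
        (X : SkewPowerSeries D) • constRow D κ (F i) := by
      rw [← matMap_single, ← map_smul, ← Pi.single_smul, smul_eq_mul, mul_one]
    rw [h1]
    funext k
    simp only [Pi.sub_apply, rowMap_apply, constRow_apply, matMap_apply, Pi.smul_apply,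
      smul_eq_mul, X_mul_C, c, map_add, map_sub, map_neg, map_sum, map_mul]
    abel
  have h0 : c = 0 := by
    refine (constRow_mem_range_iff hB).1 ?_
    rw [← hc]
    exact Submodule.sub_mem _ ⟨_, rfl⟩ hmem
  rw [h0, map_zero] at hc
  exact sub_eq_zero.1 hc

omit [DecidableEq ι] in
lemma exact_rowMap_mkQ :
    Function.Exact (rowMap D A) (LinearMap.range (rowMap D A)).mkQ := fun x => by
  rw [Submodule.mkQ_apply, Submodule.Quotient.mk_eq_zero]
  rfl

/-- The linear form on rows defined by a column. -/
noncomputable def colForm (φ : ι → SkewPowerSeries D) :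
    (ι → SkewPowerSeries D) →ₗ[SkewPowerSeries D] SkewPowerSeries D where
  toFun q := ∑ i, q i * φ i
  map_add' p q := by simp only [Pi.add_apply, add_mul, Finset.sum_add_distrib]
  map_smul' s q := by
    simp only [Pi.smul_apply, smul_eq_mul, mul_assoc, RingHom.id_apply, Finset.mul_sum]

lemma colForm_single (φ : ι → SkewPowerSeries D) (i : ι) :
    colForm φ (Pi.single i 1) = φ i := by
  change ∑ j, (Pi.single i 1 : ι → SkewPowerSeries D) j * φ j = φ i
  rw [Finset.sum_eq_single i]
  · simp
  · intro j _ hj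
    simp [Pi.single_eq_of_ne hj]
  · simp

lemma eq_colForm (f : (ι → SkewPowerSeries D) →ₗ[SkewPowerSeries D] SkewPowerSeries D) :
    f = colForm fun i => f (Pi.single i 1) :=
  linearMap_ext_single fun i => (colForm_single (fun i => f (Pi.single i 1)) i).symm

/-- Associativity of row, matrix and column: the dual of `rowMap` is `colMap`. -/
lemma colForm_comp_rowMap (φ : ι → SkewPowerSeries D) :
    colForm φ ∘ₗ rowMap D A = colForm (colMap D A φ) := by
  refine linearMap_ext_single fun i => ?_
  rw [LinearMap.comp_apply, rowMap_single, map_sub, colForm_single, colMap_apply]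
  have h1 : colForm φ (Pi.single i X) = X * φ i := by
    rw [← colForm_single φ i, ← smul_eq_mul, ← map_smul, ← Pi.single_smul, smul_eq_mul, mul_one]
  rw [h1]
  rfl

lemma colForm_injective :
    Function.Injective (colForm : (ι → SkewPowerSeries D) → _) := fun φ ψ h => by
  funext i
  rw [← colForm_single φ, h, colForm_single]

/-- The natural map `Hom_R(P, R) → Ext¹_S(P, S)`, for `P = RowModule D A`. -/
noncomputable def residueClass (hA : RowNilpotent D A) (ψ : RowModule D A →ₗ[R] R) :
    ExtDual (SkewPowerSeries D) (RowModule D A) 1 :=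
  ExtDual.connecting (rowMap_injective hA) (Submodule.mkQ_surjective _) exact_rowMap_mkQ 0
    (ExtDual.ofLinear (colForm fun i => C D (D.σ (ψ (rowGen D A i)))))

/-- As `Ext^1` of the free module vanishes, each class comes from a column. Division by `t - A`
replaces it, modulo coboundaries, by a constant column. -/
lemma residueClass_surjective (hA : RowNilpotent D A)
    (x : ExtDual (SkewPowerSeries D) (RowModule D A) 1) : ∃ ψ, residueClass hA ψ = x := by
  obtain ⟨y, rfl⟩ := ExtDual.exists_connecting_eq_of_map_eq_zero (rowMap_injective hA)
    (Submodule.mkQ_surjective _) exact_rowMap_mkQ (x := x)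
    (@Subsingleton.elim _ (ExtDual.subsingleton_of_projective 0) _ _)
  obtain ⟨f, rfl⟩ := ExtDual.ofLinear_surjective y
  obtain ⟨φ, r, hφ⟩ := exists_colMap_eq hA fun i => f (Pi.single i 1)
  let ψ : RowModule D A →ₗ[R] R :=
    ((LinearMap.lsum R (fun _ : ι => R) ℕ) fun i => LinearMap.toSpanSingleton R R (r i)).comp
      (rowModuleEquiv hA).symm.toLinearMap
  have hψ : ∀ i, ψ (rowGen D A i) = r i := fun i => by
    simp only [ψ, LinearMap.comp_apply, LinearEquiv.coe_coe]
    rw [← rowModuleEquiv_single hA, LinearEquiv.symm_apply_apply]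
    simp [Pi.single_apply]
  refine ⟨ψ, ?_⟩
  have hf : f = colForm φ ∘ₗ rowMap D A + colForm fun i => C D (D.σ (ψ (rowGen D A i))) := by
    rw [colForm_comp_rowMap]
    refine linearMap_ext_single fun i => ?_
    rw [hφ, LinearMap.add_apply, colForm_single, colForm_single, hψ]
  have hadd : ∀ f g : (ι → SkewPowerSeries D) →ₗ[SkewPowerSeries D] SkewPowerSeries D,
      ExtDual.ofLinear (f + g) = ExtDual.ofLinear f + ExtDual.ofLinear g := fun f g => by
    rw [ExtDual.ofLinear, ModuleCat.ofHom_add, Ext.mk₀_add]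
    rfl
  rw [hf, hadd, AddMonoidHom.map_add, ← ExtDual.map_ofLinear, ExtDual.connecting_map, zero_add]
  rfl

lemma linearMap_ext_rowGen (hA : RowNilpotent D A) {N : Type*} [AddCommGroup N] [Module R N]
    {f g : RowModule D A →ₗ[R] N} (h : ∀ i, f (rowGen D A i) = g (rowGen D A i)) : f = g := by
  have : f.comp (rowModuleEquiv hA).toLinearMap = g.comp (rowModuleEquiv hA).toLinearMap := by
    refine LinearMap.pi_ext fun i s => ?_
    have hs : (Pi.single i s : ι → R) = s • Pi.single i 1 := by
      rw [← Pi.single_smul, smul_eq_mul, mul_one]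
    rw [hs, map_smul, map_smul, LinearMap.comp_apply, LinearMap.comp_apply,
      LinearEquiv.coe_coe, rowModuleEquiv_single, h]
  refine LinearMap.ext fun y => ?_
  obtain ⟨r, rfl⟩ := (rowModuleEquiv hA).surjective y
  exact LinearMap.congr_fun this r

lemma residueClass_zero (hA : RowNilpotent D A) : residueClass hA 0 = 0 := by
  have : (colForm fun i => C D (D.σ ((0 : RowModule D A →ₗ[R] R) (rowGen D A i)))) = 0 := by
    refine linearMap_ext_single fun i => ?_
    rw [colForm_single]
    simp
  rw [residueClass, this, ExtDual.ofLinear_eq_zero.2 rfl, AddMonoidHom.map_zero]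

lemma residueClass_add (hA : RowNilpotent D A) (ψ θ : RowModule D A →ₗ[R] R) :
    residueClass hA (ψ + θ) = residueClass hA ψ + residueClass hA θ := by
  have : (colForm fun i => C D (D.σ ((ψ + θ) (rowGen D A i)))) =
      (colForm fun i => C D (D.σ (ψ (rowGen D A i)))) +
      colForm fun i => C D (D.σ (θ (rowGen D A i))) := by
    refine linearMap_ext_single fun i => ?_
    rw [LinearMap.add_apply, colForm_single, colForm_single, colForm_single, LinearMap.add_apply,
      map_add, map_add]
  rw [residueClass, this, ExtDual.ofLinear, ModuleCat.ofHom_add, Ext.mk₀_add]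
  exact AddMonoidHom.map_add _ _ _

/-- By uniqueness of column division, a constant column that is a coboundary is zero. -/
lemma residueClass_eq_zero (hA : RowNilpotent D A) {ψ : RowModule D A →ₗ[R] R}
    (h : residueClass hA ψ = 0) : ψ = 0 := by
  obtain ⟨y, hy⟩ := ExtDual.exists_map_eq_of_connecting_eq_zero _ _ _ h
  obtain ⟨f, rfl⟩ := ExtDual.ofLinear_surjective y
  rw [ExtDual.map_ofLinear] at hy
  have h1 := ExtDual.ofLinear_injective hy
  rw [eq_colForm f, colForm_comp_rowMap] at h1
  have h2 := colForm_injective h1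
  have h3 := eq_zero_of_colMap_eq hA fun i => congrFun h2 i
  refine linearMap_ext_rowGen hA fun i => ?_
  have h4 := congrFun h2 i
  rw [h3, map_zero, Pi.zero_apply] at h4
  have h5 : D.σ (ψ (rowGen D A i)) = 0 := C_injective (by rw [← h4, map_zero])
  exact (map_eq_zero_iff _ D.σ.injective).1 h5

/-- A homomorphism lifts to a morphism of the length-one resolutions, with matrix `σ(F)` on the
relations. The `σ` built into `residueClass` matches this twist, so naturality of the extension
class gives the claim. -/
lemma map_residueClass (hA : RowNilpotent D A) (hB : RowNilpotent D B)
    (f : RowModule D A →ₗ[SkewPowerSeries D] RowModule D B) (ψ : RowModule D B →ₗ[R] R) :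
    ExtDual.map f 1 (residueClass hB ψ) = residueClass hA (ψ ∘ₗ f.restrictScalars R) := by
  let F := rowMatrix hB f
  have hform : (colForm fun i => C D (D.σ ((ψ ∘ₗ f.restrictScalars R) (rowGen D A i)))) =
      (colForm fun k => C D (D.σ (ψ (rowGen D B k)))) ∘ₗ matMap (fun i k => D.σ (F i k)) := by
    refine linearMap_ext_single fun i => ?_
    rw [colForm_single]
    change _ = colForm _ (matMap _ (Pi.single i 1))
    rw [matMap_single]
    have h1 : f (rowGen D A i) = ∑ k, F i k • rowGen D B k := by
      have h2 : f (rowGen D A i) = rowModuleEquiv hB (F i) :=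
        ((rowModuleEquiv hB).apply_symm_apply _).symm
      have h3 : F i = ∑ k, F i k • (Pi.single k 1 : κ → R) := by
        funext j
        simp [Pi.single_apply]
      rw [h2]
      conv_lhs => rw [h3, map_sum]
      refine Finset.sum_congr rfl fun k _ => ?_
      rw [map_smul, rowModuleEquiv_single]
    rw [LinearMap.comp_apply, LinearMap.restrictScalars_apply, h1]
    simp only [map_sum, map_smul, smul_eq_mul, map_mul]
    rfl
  let φ : ShortComplex.mk (ModuleCat.ofHom (rowMap D A))
      (ModuleCat.ofHom (LinearMap.range (rowMap D A)).mkQ) 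
        (ModuleCat.hom_ext (LinearMap.ext fun x => exact_rowMap_mkQ.apply_apply_eq_zero x)) ⟶
      ShortComplex.mk (ModuleCat.ofHom (rowMap D B))
      (ModuleCat.ofHom (LinearMap.range (rowMap D B)).mkQ) 
        (ModuleCat.hom_ext (LinearMap.ext fun x => exact_rowMap_mkQ.apply_apply_eq_zero x)) :=
    { τ₁ := ModuleCat.ofHom (matMap fun i k => D.σ (F i k))
      τ₂ := ModuleCat.ofHom (matMap F)
      τ₃ := ModuleCat.ofHom f
      comm₁₂ := congrArg ModuleCat.ofHom (rowMap_comp_matMap hB f)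
      comm₂₃ := congrArg ModuleCat.ofHom (mkQ_comp_matMap hB f) }
  have hnat := ShortComplex.ShortExact.extClass_naturality
    (ExtDual.shortExact (rowMap_injective hA) (Submodule.mkQ_surjective _) exact_rowMap_mkQ)
    (ExtDual.shortExact (rowMap_injective hB) (Submodule.mkQ_surjective _) exact_rowMap_mkQ) φ
  rw [residueClass, residueClass, hform, ← ExtDual.map_ofLinear, ExtDual.connecting_apply,
    ExtDual.connecting_apply, ExtDual.map_apply, ExtDual.map_apply]
  have h1 := congrArg (fun z => z.comp
    (ExtDual.ofLinear (colForm fun k => C D (D.σ (ψ (rowGen D B k))))) (add_zero 1)) hnat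
  simp only [Ext.comp_assoc_of_second_deg_zero, Ext.comp_assoc_of_third_deg_zero] at h1
  exact h1.symm

lemma subsingleton_extDual_zero_rowModule (hA : RowNilpotent D A) :
    Subsingleton (ExtDual (SkewPowerSeries D) (RowModule D A) 0) := by
  refine ExtDual.subsingleton_zero_iff.2 fun φ => ?_
  have h1 : colForm (fun i => φ (rowGen D A i)) = φ ∘ₗ (LinearMap.range (rowMap D A)).mkQ :=
    linearMap_ext_single fun i => colForm_single _ i
  have h2 : colForm (colMap D A fun i => φ (rowGen D A i)) = 0 := by
    rw [← colForm_comp_rowMap, h1, LinearMap.comp_assoc,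
      LinearMap.range_mkQ_comp, LinearMap.comp_zero]
  have h3 : colForm (0 : ι → SkewPowerSeries D) = 0 :=
    linearMap_ext_single fun i => colForm_single _ i
  have h4 := colForm_injective (h2.trans h3.symm)
  have h5 := eq_zero_of_colMap_eq hA (r := 0) fun i => by rw [h4]; simp
  rw [h5, h3] at h1
  refine LinearMap.ext fun y => ?_
  obtain ⟨v, rfl⟩ := Submodule.Quotient.mk_surjective _ y
  exact (LinearMap.congr_fun h1 v).symm

lemma subsingleton_extDual_rowModule (hA : RowNilpotent D A) (k : ℕ) :
    Subsingleton (ExtDual (SkewPowerSeries D) (RowModule D A) (k + 2)) :=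
  ExtDual.subsingleton_right (rowMap_injective hA) (Submodule.mkQ_surjective _) exact_rowMap_mkQ
    (ExtDual.subsingleton_of_projective k) (ExtDual.subsingleton_of_projective (k + 1))

lemma subsingleton_extDual_coeff_rowModule (hA : RowNilpotent D A) (k : ℕ) :
    Subsingleton (ExtDual R (RowModule D A) (k + 1)) :=
  ExtDual.subsingleton_of_linearEquiv (rowModuleEquiv hA)
    (ExtDual.subsingleton_of_projective k)

end SkewPowerSeries

/-! ### Companion matrices and presentations of modules. -/

namespace SkewDerivation

variable {R : Type u} [Ring R] [UniformSpace R] {D : SkewDerivation R}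
variable {ι : Type} [Fintype ι] [DecidableEq ι] {A : ι → ι → R}

lemma rowOp_single (i : ι) : D.rowOp A (Pi.single i 1) = A i := by
  funext j
  rw [rowOp_apply, Finset.sum_eq_single i]
  · by_cases h : j = i
    · subst h; simp [delta_one]
    · simp [Pi.single_eq_of_ne h]
  · intro k _ hk
    simp [Pi.single_eq_of_ne hk]
  · simp

omit [DecidableEq ι] in
lemma rowOp_iterate_mem_core {U : Ideal R} (n : ℕ) {x : ι → R} (hx : ∀ j, x j ∈ D.core U) (j : ι) :
    (D.rowOp A)^[n] x j ∈ D.core U := by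
  induction n generalizing j with
  | zero => exact hx j
  | succ n ih =>
    rw [Function.iterate_succ_apply', rowOp_apply]
    exact Submodule.add_mem _
      (Submodule.sum_mem _ fun i _ => Ideal.mul_mem_right _ _ (sigma_mem_core (ih i)))
      (delta_mem_core (ih j))

/-- The companion matrix of the relations `t ^ (N + 1) xᵢ = ∑ⱼ aᵢⱼ xⱼ`. -/
def companion {r : ℕ} (N : ℕ) (a : Fin r → Fin r → R) (p q : Fin r × Fin (N + 1)) : R :=
  if p.2.val = N then if q.2 = 0 then a p.1 q.1 else 0
  else if q.1 = p.1 ∧ q.2.val = p.2.val + 1 then 1 else 0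

/-- The operator moves the standard row `(i, l)` to `(i, l + 1)` until `l = N`. The next step lands
in rows with entries in the radical, and these are preserved from then on. -/
lemma rowNilpotent_companion [IsTopologicalRing R] {r : ℕ} (N : ℕ) {a : Fin r → Fin r → R}
    (ha : ∀ i j, a i j ∈ D.radical) : RowNilpotent D (companion N a) := by
  refine rowNilpotent_of_single (N := N + 1) fun n hn ⟨i, l⟩ j => ?_
  have key : ∀ (n : ℕ) (l : Fin (N + 1)), N + 1 ≤ l.val + n →
      ∀ j, (D.rowOp (companion N a))^[n] (Pi.single (i, l) 1) j ∈ D.radical := by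
    intro n
    induction n with
    | zero =>
      intro l hl
      have := l.isLt
      omega
    | succ n ih =>
      intro l hl
      rw [Function.iterate_succ_apply, rowOp_single]
      by_cases h : l.val = N
      · refine rowOp_iterate_mem_core n fun q => ?_
        rw [companion, if_pos h]
        split_ifs
        · exact ha _ _
        · exact Submodule.zero_mem _
      · have hlt := l.isLt
        have h1 : companion N a (i, l) =
            (Pi.single (i, ⟨l.val + 1, by omega⟩) 1 : Fin r × Fin (N + 1) → R) := by
          funext q
          rw [companion, if_neg h, Pi.single_apply]
          refine if_congr ?_ rfl rfl
          rw [Prod.ext_iff, Fin.ext_iff (a := q.2)]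
        rw [h1]
        exact ih _ (by simp only; omega)
  exact key n l (by omega) j

end SkewDerivation

namespace SkewPowerSeries

variable {R : Type u} [Ring R] [UniformSpace R] [IsPseudocompactRing R] {D : SkewDerivation R}

section Lift

variable {ι : Type} [Fintype ι] [DecidableEq ι] {A : ι → ι → R}
variable {M : Type u} [AddCommGroup M] [Module R M] [Module (SkewPowerSeries D) M]
  [IsScalarTower R (SkewPowerSeries D) M]

lemma exists_rowModule_lift {v : ι → M}
    (hv : ∀ i, (X : SkewPowerSeries D) • v i = ∑ j, A i j • v j) :
    ∃ π : RowModule D A →ₗ[SkewPowerSeries D] M, ∀ i, π (rowGen D A i) = v i := by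
  let f : (ι → SkewPowerSeries D) →ₗ[SkewPowerSeries D] M :=
    Fintype.linearCombination (SkewPowerSeries D) v
  have hf : ∀ q, f q = ∑ i, q i • v i := fun q => Fintype.linearCombination_apply _ _ _
  have h0 : f ∘ₗ rowMap D A = 0 := by
    refine linearMap_ext_single fun i => ?_
    rw [LinearMap.comp_apply, rowMap_single, map_sub, hf, hf, LinearMap.zero_apply, sub_eq_zero,
      Finset.sum_eq_single i]
    · simp only [Pi.single_eq_same, constRow_apply, C_smul, hv]
    · intro j _ hj
      rw [Pi.single_eq_of_ne hj, zero_smul]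
    · simp
  refine ⟨(LinearMap.range (rowMap D A)).liftQ f (LinearMap.range_le_ker_iff.2 h0), fun i => ?_⟩
  rw [rowGen, Submodule.liftQ_apply, hf, Finset.sum_eq_single i]
  · simp
  · intro j _ hj
    rw [Pi.single_eq_of_ne hj, zero_smul]
  · simp

end Lift

lemma exists_eq_sum_smul_of_mem_smul_top {R M : Type*} [Ring R] [AddCommGroup M] [Module R M]
    {I : Ideal R} [I.IsTwoSided] {ι : Type*} [Fintype ι] {x : ι → M}
    (hx : Submodule.span R (Set.range x) = ⊤) {y : M} (hy : y ∈ (I • ⊤ : Submodule R M)) :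
    ∃ a : ι → R, (∀ j, a j ∈ I) ∧ y = ∑ j, a j • x j := by
  induction hy using Submodule.smul_induction_on' with
  | smul a ha y _ =>
    have hy : y ∈ Submodule.span R (Set.range x) := hx ▸ Submodule.mem_top
    obtain ⟨b, rfl⟩ := (Submodule.mem_span_range_iff_exists_fun R).1 hy
    refine ⟨fun j => a * b j, fun j => Ideal.mul_mem_right _ _ ha, ?_⟩
    simp only [Finset.smul_sum, mul_smul]
  | add y _ z _ hy hz =>
    obtain ⟨a, ha, rfl⟩ := hy
    obtain ⟨b, hb, rfl⟩ := hz
    refine ⟨fun j => a j + b j, fun j => Submodule.add_mem _ (ha j) (hb j), ?_⟩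
    simp only [add_smul, Finset.sum_add_distrib]

variable (D) in
/-- Every module which is finitely generated over the coefficient ring is a quotient of some
`RowModule`. -/
theorem exists_rowModule_surjective [IsNoetherianRing R] [IsNoetherianRing Rᵐᵒᵖ]
    (M : Type u) [AddCommGroup M] [Module R M] [Module (SkewPowerSeries D) M]
    [IsScalarTower R (SkewPowerSeries D) M] [Module.Finite R M] :
    ∃ (ι : Type) (_ : Fintype ι) (_ : DecidableEq ι) (A : ι → ι → R) (_ : RowNilpotent D A)
      (π : RowModule D A →ₗ[SkewPowerSeries D] M), Function.Surjective π := by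
  obtain ⟨N, hN⟩ := exists_X_pow_smul_mem D M
  obtain ⟨r, x, hx⟩ := Module.Finite.exists_fin (R := R) (M := M)
  have : D.radical.IsTwoSided := inferInstance
  -- Applying the bound to `t • x i` gives relations for `t ^ (N + 1) • x i`, so the blocks of the
  -- companion matrix are nonempty even for `N = 0`.
  choose a ha hax using fun i => exists_eq_sum_smul_of_mem_smul_top hx
    (hN ((X : SkewPowerSeries D) • x i))
  let v : Fin r × Fin (N + 1) → M := fun p => (X : SkewPowerSeries D) ^ p.2.val • x p.1
  have hv : ∀ p, (X : SkewPowerSeries D) • v p = ∑ q, companion N a p q • v q := by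
    rintro ⟨i, l⟩
    have hlt := l.isLt
    simp only [v, companion, ← mul_smul, ← pow_succ']
    by_cases h : l.val = N
    · simp only [h, if_true]
      rw [pow_succ, mul_smul, hax, Fintype.sum_prod_type]
      refine Finset.sum_congr rfl fun j _ => ?_
      rw [Finset.sum_eq_single 0]
      · simp
      · intro k _ hk
        rw [if_neg hk, zero_smul]
      · simp
    · simp only [if_neg h]
      rw [Finset.sum_eq_single (i, ⟨l.val + 1, by omega⟩)]
      · simp
      · rintro ⟨j, k⟩ _ hjk
        rw [if_neg, zero_smul]
        rintro ⟨h1, h2⟩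
        exact hjk (Prod.ext h1 (Fin.ext h2))
      · simp
  obtain ⟨π, hπ⟩ := exists_rowModule_lift hv
  refine ⟨_, inferInstance, inferInstance, companion N a, rowNilpotent_companion N ha, π, ?_⟩
  have hle : (⊤ : Submodule R M) ≤ LinearMap.range (π.restrictScalars R) := by
    rw [← hx, Submodule.span_le]
    rintro _ ⟨i, rfl⟩
    refine ⟨rowGen D _ (i, 0), ?_⟩
    rw [LinearMap.restrictScalars_apply, hπ]
    simp [v]
  intro y
  exact hle (Submodule.mem_top (x := y))

end SkewPowerSeries

/-! ### Comparison of the duals over the two rings. -/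

namespace ExtDual

variable {A : Type u} [Ring A]
variable {N N' N'' : Type u} [AddCommGroup N] [Module A N] [AddCommGroup N'] [Module A N']
  [AddCommGroup N''] [Module A N''] {f : N →ₗ[A] N'} {g : N' →ₗ[A] N''}

lemma subsingleton_succ_iff_surjective (hf : Function.Injective f) (hg : Function.Surjective g)
    (hfg : Function.Exact f g) {k : ℕ} (h : Subsingleton (ExtDual A N' (k + 1))) :
    Subsingleton (ExtDual A N'' (k + 1)) ↔ Function.Surjective (map f k) := by
  constructor
  · intro h' x
    exact exists_map_eq_of_connecting_eq_zero hf hg hfg (Subsingleton.elim _ _)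
  · intro h'
    refine subsingleton_of_forall_eq 0 fun x => ?_
    obtain ⟨y, rfl⟩ := exists_connecting_eq_of_map_eq_zero hf hg hfg (x := x)
      (Subsingleton.elim _ _)
    obtain ⟨z, rfl⟩ := h' y
    exact connecting_map hf hg hfg k z

end ExtDual

namespace SkewPowerSeries

variable {R : Type u} [Ring R] [UniformSpace R] [IsPseudocompactRing R] {D : SkewDerivation R}

section RowModule

variable {ι : Type} [Fintype ι] [DecidableEq ι] {A : ι → ι → R}

lemma residueClass_injective (hA : RowNilpotent D A) : Function.Injective (residueClass hA) := by
  intro ψ θ h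
  have h1 := residueClass_add hA (ψ - θ) θ
  rw [sub_add_cancel, h, right_eq_add] at h1
  exact sub_eq_zero.1 (residueClass_eq_zero hA h1)

lemma finite_rowModule (hA : RowNilpotent D A) : Module.Finite R (RowModule D A) :=
  Module.Finite.equiv (rowModuleEquiv hA)

end RowModule

section Comparison

variable [IsNoetherianRing R] [IsNoetherianRing Rᵐᵒᵖ]
variable (M : Type u) [AddCommGroup M] [Module R M] [Module (SkewPowerSeries D) M]
  [IsScalarTower R (SkewPowerSeries D) M] [Module.Finite R M]

omit [IsNoetherianRing Rᵐᵒᵖ] in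
lemma finite_submodule (N : Submodule (SkewPowerSeries D) M) : Module.Finite R N :=
  inferInstanceAs (Module.Finite R (N.restrictScalars R))

omit [IsNoetherianRing Rᵐᵒᵖ] in
lemma finite_submodule_rowModule {ι : Type} [Fintype ι] [DecidableEq ι] {A : ι → ι → R}
    (hA : RowNilpotent D A) (N : Submodule (SkewPowerSeries D) (RowModule D A)) :
    Module.Finite R N :=
  have := finite_rowModule hA
  finite_submodule _ N

lemma subsingleton_extDual_zero : Subsingleton (ExtDual (SkewPowerSeries D) M 0) := by
  obtain ⟨ι, _, _, A, hA, π, hπ⟩ := exists_rowModule_surjective D M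
  have := subsingleton_extDual_zero_rowModule hA
  exact (ExtDual.map_injective_zero hπ).subsingleton

variable {M}
variable {ι : Type} [Fintype ι] [DecidableEq ι] {A : ι → ι → R}

omit [Module R M] [IsScalarTower R (SkewPowerSeries D) M] [Module.Finite R M] in
lemma map_one_injective (hA : RowNilpotent D A) {π : RowModule D A →ₗ[SkewPowerSeries D] M}
    (hπ : Function.Surjective π) : Function.Injective (ExtDual.map π 1) := by
  have := finite_submodule_rowModule hA (LinearMap.ker π)
  exact ExtDual.map_injective_of_subsingleton (LinearMap.ker π).subtype_injective hπ
    (LinearMap.exact_subtype_ker_map π) (subsingleton_extDual_zero _)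

omit [Module.Finite R M] in
-- Pulled back to the cover, the class is the residue class of some `ψ`. It restricts to zero on a
-- cover of `ker π`, so by naturality `ψ` vanishes on `ker π` and descends to `M`.
lemma exists_map_one_eq_residueClass (hA : RowNilpotent D A)
    {π : RowModule D A →ₗ[SkewPowerSeries D] M} (hπ : Function.Surjective π)
    (e : ExtDual (SkewPowerSeries D) M 1) :
    ∃ χ : M →ₗ[R] R, ExtDual.map π 1 e = residueClass hA (χ ∘ₗ π.restrictScalars R) := by
  have := finite_submodule_rowModule hA (LinearMap.ker π)
  obtain ⟨κ, _, _, B, hB, ρ, hρ⟩ := exists_rowModule_surjective D (LinearMap.ker π)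
  obtain ⟨ψ, hψ⟩ := residueClass_surjective hA (ExtDual.map π 1 e)
  have h1 : π ∘ₗ ((LinearMap.ker π).subtype ∘ₗ ρ) = 0 := LinearMap.ext fun x => (ρ x).2
  have h2 := map_residueClass hB hA ((LinearMap.ker π).subtype ∘ₗ ρ) ψ
  rw [hψ, ExtDual.map_map, h1, ExtDual.map_zero_left] at h2
  have h3 := residueClass_eq_zero hB h2.symm
  have h4 : LinearMap.ker (π.restrictScalars R) ≤ LinearMap.ker ψ := by
    intro x hx
    obtain ⟨y, hy⟩ := hρ ⟨x, hx⟩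
    have h5 := LinearMap.congr_fun h3 y
    have h6 : ψ ((ρ y : RowModule D A)) = 0 := h5
    rw [hy] at h6
    exact h6
  let e' := (π.restrictScalars R).quotKerEquivOfSurjective hπ
  refine ⟨(LinearMap.ker (π.restrictScalars R)).liftQ ψ h4 ∘ₗ e'.symm.toLinearMap, ?_⟩
  rw [← hψ]
  congr 1
  refine LinearMap.ext fun x => ?_
  have h7 : e'.symm (π x) = Submodule.Quotient.mk x := by
    rw [LinearEquiv.symm_apply_eq]
    rfl
  simp only [LinearMap.comp_apply, LinearMap.restrictScalars_apply, LinearEquiv.coe_coe, h7]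
  rfl

omit [Module.Finite R M] in
-- The form `χ ∘ π` vanishes on `ker π`, so its residue class restricts to zero there and comes from
-- `M`. With `exists_map_one_eq_residueClass` this matches `Ext^1_S(M, S)` with `Hom_R(M, R)`.
lemma exists_residueClass_eq_map_one (hA : RowNilpotent D A)
    {π : RowModule D A →ₗ[SkewPowerSeries D] M} (hπ : Function.Surjective π) (χ : M →ₗ[R] R) :
    ∃ e : ExtDual (SkewPowerSeries D) M 1,
      ExtDual.map π 1 e = residueClass hA (χ ∘ₗ π.restrictScalars R) := by
  have := finite_submodule_rowModule hA (LinearMap.ker π)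
  obtain ⟨κ, _, _, B, hB, ρ, hρ⟩ := exists_rowModule_surjective D (LinearMap.ker π)
  refine ExtDual.exists_map_eq_of_map_eq_zero (LinearMap.ker π).subtype_injective hπ
    (LinearMap.exact_subtype_ker_map π) (map_one_injective hB hρ ?_)
  have h1 : (χ ∘ₗ π.restrictScalars R) ∘ₗ
      ((LinearMap.ker π).subtype ∘ₗ ρ).restrictScalars R = 0 := LinearMap.ext fun x => by
    change χ (π (ρ x)) = 0
    rw [(ρ x).2, map_zero]
  rw [ExtDual.map_map, map_residueClass hB hA, h1, residueClass_zero, AddMonoidHom.map_zero]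

variable (M)

lemma subsingleton_extDual_one_iff :
    Subsingleton (ExtDual (SkewPowerSeries D) M 1) ↔ Subsingleton (ExtDual R M 0) := by
  obtain ⟨ι, _, _, A, hA, π, hπ⟩ := exists_rowModule_surjective D M
  rw [ExtDual.subsingleton_zero_iff]
  constructor
  · intro h χ
    obtain ⟨e, he⟩ := exists_residueClass_eq_map_one hA hπ χ
    rw [Subsingleton.elim e 0, AddMonoidHom.map_zero] at he
    have h1 := residueClass_eq_zero hA he.symm
    refine LinearMap.ext fun y => ?_
    obtain ⟨x, rfl⟩ := hπ y
    exact LinearMap.congr_fun h1 x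
  · intro h
    refine subsingleton_of_forall_eq 0 fun e => map_one_injective hA hπ ?_
    obtain ⟨χ, hχ⟩ := exists_map_one_eq_residueClass hA hπ e
    rw [hχ, h χ, LinearMap.zero_comp, residueClass_zero, AddMonoidHom.map_zero]

/-- Both groups are cokernels of restriction from the cover to `ker π`: on `Ext^1_S` for the power
series ring, on `Hom_R` for `R`. Residue classes identify the two restriction maps. -/
lemma subsingleton_extDual_two_iff :
    Subsingleton (ExtDual (SkewPowerSeries D) M 2) ↔ Subsingleton (ExtDual R M 1) := by
  obtain ⟨ι, _, _, A, hA, π, hπ⟩ := exists_rowModule_surjective D M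
  have := finite_submodule_rowModule hA (LinearMap.ker π)
  obtain ⟨κ, _, _, B, hB, ρ, hρ⟩ := exists_rowModule_surjective D (LinearMap.ker π)
  rw [ExtDual.subsingleton_succ_iff_surjective (LinearMap.ker π).subtype_injective hπ
      (LinearMap.exact_subtype_ker_map π) (subsingleton_extDual_rowModule hA 0),
    ExtDual.subsingleton_succ_iff_surjective
      (f := (LinearMap.ker π).subtype.restrictScalars R) (g := π.restrictScalars R)
      (LinearMap.ker π).subtype_injective hπ
      (LinearMap.exact_subtype_ker_map π) (subsingleton_extDual_coeff_rowModule hA 0)]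
  constructor
  · intro h y
    obtain ⟨χ, rfl⟩ := ExtDual.ofLinear_surjective y
    obtain ⟨e, he⟩ := exists_residueClass_eq_map_one hB hρ χ
    obtain ⟨e', rfl⟩ := h e
    obtain ⟨ψ, rfl⟩ := residueClass_surjective hA e'
    rw [ExtDual.map_map, map_residueClass hB hA] at he
    have h1 := residueClass_injective hB he
    refine ⟨ExtDual.ofLinear ψ, ?_⟩
    rw [ExtDual.map_ofLinear]
    congr 1
    refine LinearMap.ext fun x => ?_
    obtain ⟨z, rfl⟩ := hρ x
    exact LinearMap.congr_fun h1 z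
  · intro h e
    obtain ⟨χ, hχ⟩ := exists_map_one_eq_residueClass hB hρ e
    obtain ⟨y, hy⟩ := h (ExtDual.ofLinear χ)
    obtain ⟨ψ, rfl⟩ := ExtDual.ofLinear_surjective y
    rw [ExtDual.map_ofLinear] at hy
    have h1 := ExtDual.ofLinear_injective hy
    refine ⟨residueClass hA ψ, map_one_injective hB hρ ?_⟩
    rw [ExtDual.map_map, map_residueClass hB hA, hχ, ← h1]
    rfl

/-- The comparison of the vanishing of the duals over the power series ring and over the
coefficient ring. -/
theorem subsingleton_extDual_succ_iff (l : ℕ) :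
    Subsingleton (ExtDual (SkewPowerSeries D) M (l + 1)) ↔ Subsingleton (ExtDual R M l) := by
  induction l using Nat.strongRecOn generalizing M with
  | ind l ih =>
    match l with
    | 0 => exact subsingleton_extDual_one_iff M
    | 1 => exact subsingleton_extDual_two_iff M
    | k + 2 =>
      -- In the degrees involved the cover has no Ext over either ring, so both sides shift to the
      -- kernel.
      obtain ⟨ι, _, _, A, hA, π, hπ⟩ := exists_rowModule_surjective D M
      have := finite_submodule_rowModule hA (LinearMap.ker π)
      rw [ExtDual.subsingleton_succ_iff (LinearMap.ker π).subtype_injective hπ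
          (LinearMap.exact_subtype_ker_map π) (subsingleton_extDual_rowModule hA k)
          (subsingleton_extDual_rowModule hA (k + 1)),
        ExtDual.subsingleton_succ_iff
          (f := (LinearMap.ker π).subtype.restrictScalars R) (g := π.restrictScalars R)
          (LinearMap.ker π).subtype_injective hπ
          (LinearMap.exact_subtype_ker_map π) (subsingleton_extDual_coeff_rowModule hA k)
          (subsingleton_extDual_coeff_rowModule hA (k + 1))]
      exact ih (k + 1) (by omega) (LinearMap.ker π)

end Comparison

end SkewPowerSeries

/-! ### The Auslander condition and the grade of submodules. -/

namespace ExtDual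

section Covariant

variable {B : Type u} [Ring B]
variable {E X Y Z : Type u} [AddCommGroup E] [Module B E] [AddCommGroup X] [Module B X]
  [AddCommGroup Y] [Module B Y] [AddCommGroup Z] [Module B Z]

lemma subsingleton_ext_of_shortExact {f : X →ₗ[B] Y} {g : Y →ₗ[B] Z}
    (hf : Function.Injective f) (hg : Function.Surjective g) (hfg : Function.Exact f g) {i : ℕ}
    (hY : Subsingleton (Ext (ModuleCat.of B E) (ModuleCat.of B Y) i))
    (hX : Subsingleton (Ext (ModuleCat.of B E) (ModuleCat.of B X) (i + 1))) :
    Subsingleton (Ext (ModuleCat.of B E) (ModuleCat.of B Z) i) := by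
  refine subsingleton_of_forall_eq 0 fun x => ?_
  obtain ⟨y, rfl⟩ := Ext.covariant_sequence_exact₃ _ (shortExact hf hg hfg) x rfl
    (Subsingleton.elim _ _)
  rw [Subsingleton.elim y 0, Ext.zero_comp]

lemma subsingleton_ext_zero_iff :
    Subsingleton (Ext (ModuleCat.of B E) (ModuleCat.of B Y) 0) ↔ ∀ φ : E →ₗ[B] Y, φ = 0 := by
  rw [← (Equiv.ofBijective _ (Ext.mk₀_bijective (ModuleCat.of B E) (ModuleCat.of B Y))).subsingleton_congr]
  exact ⟨fun h φ => congrArg ModuleCat.Hom.hom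
    (Subsingleton.elim (ModuleCat.ofHom φ) (ModuleCat.ofHom 0)),
    fun h => ⟨fun f g => ModuleCat.hom_ext ((h f.hom).trans (h g.hom).symm)⟩⟩

lemma subsingleton_ext_of_subsingleton (h : Subsingleton Y) {k : ℕ} :
    Subsingleton (Ext (ModuleCat.of B E) (ModuleCat.of B Y) k) := by
  refine subsingleton_of_forall_eq 0 fun e => ?_
  have h1 : 𝟙 (ModuleCat.of B Y) = 0 := ModuleCat.hom_ext (LinearMap.ext fun y => h.elim _ _)
  rw [← Ext.comp_mk₀_id e, h1, Ext.mk₀_zero, Ext.comp_zero]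

/-- The identity of `Y` is a sum of maps through `X`, each of which acts as zero on Ext. It is
applied to the dual of `A^n`, with `X` the ring itself. -/
lemma subsingleton_ext_of_retract {ι : Type*} [Fintype ι] (p : ι → Y →ₗ[B] X) (q : ι → X →ₗ[B] Y)
    (h : ∑ i, q i ∘ₗ p i = LinearMap.id) {k : ℕ}
    (hX : Subsingleton (Ext (ModuleCat.of B E) (ModuleCat.of B X) k)) :
    Subsingleton (Ext (ModuleCat.of B E) (ModuleCat.of B Y) k) := by
  refine subsingleton_of_forall_eq 0 fun e => ?_
  let F : (Y →ₗ[B] Y) →+ Ext (ModuleCat.of B E) (ModuleCat.of B Y) k :=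
    { toFun := fun h => e.comp (Ext.mk₀ (ModuleCat.ofHom h)) (add_zero k)
      map_zero' := by rw [ModuleCat.ofHom_zero, Ext.mk₀_zero, Ext.comp_zero]
      map_add' := fun g h => by rw [ModuleCat.ofHom_add, Ext.mk₀_add, Ext.comp_add] }
  have h1 : F LinearMap.id = e := Ext.comp_mk₀_id e
  rw [← h1, ← h, map_sum]
  refine Finset.sum_eq_zero fun i _ => ?_
  change e.comp (Ext.mk₀ (ModuleCat.ofHom (q i ∘ₗ p i))) (add_zero k) = 0
  rw [ModuleCat.ofHom_comp, ← Ext.mk₀_comp_mk₀, ← Ext.comp_assoc_of_third_deg_zero,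
    Subsingleton.elim (e.comp (Ext.mk₀ (ModuleCat.ofHom (p i))) (add_zero k)) 0, Ext.zero_comp]

end Covariant

section Dual

variable {A : Type u} [Ring A]
variable {N N' N'' : Type u} [AddCommGroup N] [Module A N] [AddCommGroup N'] [Module A N']
  [AddCommGroup N''] [Module A N'']

/-- The transpose of a linear map. -/
def transpose (f : N →ₗ[A] N') : (N' →ₗ[A] A) →ₗ[Aᵐᵒᵖ] (N →ₗ[A] A) where
  toFun φ := φ ∘ₗ f
  map_add' _ _ := rfl
  map_smul' _ _ := rfl

/-- The identification of `Ext⁰_A(N, A)` with the dual of `N`. -/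
noncomputable def zeroEquiv : (N →ₗ[A] A) ≃ₗ[Aᵐᵒᵖ] ExtDual A N 0 :=
  LinearEquiv.ofBijective
    { toFun := ofLinear
      map_add' := fun φ ψ => by rw [ofLinear, ModuleCat.ofHom_add, Ext.mk₀_add]; rfl
      map_smul' := fun a φ => by
        change _ = (ofLinear φ).comp (Ext.mk₀ (mulRightEnd A a.unop)) (add_zero 0)
        rw [ofLinear, ofLinear, Ext.mk₀_comp_mk₀]
        rfl }
    ⟨ofLinear_injective, ofLinear_surjective⟩

variable {f : N →ₗ[A] N'} {g : N' →ₗ[A] N''}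
variable (hf : Function.Injective f) (hg : Function.Surjective g) (hfg : Function.Exact f g)

/-- `connecting` as a linear map. -/
noncomputable def connectingₗ (k : ℕ) : ExtDual A N k →ₗ[Aᵐᵒᵖ] ExtDual A N'' (k + 1) where
  __ := connecting hf hg hfg k
  map_smul' a x := by
    change (shortExact hf hg hfg).extClass.comp
      (x.comp (Ext.mk₀ (mulRightEnd A a.unop)) (add_zero k)) (add_comm 1 k) =
      ((shortExact hf hg hfg).extClass.comp x (add_comm 1 k)).comp
        (Ext.mk₀ (mulRightEnd A a.unop)) (add_zero (k + 1))
    rw [Ext.comp_assoc_of_third_deg_zero]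

lemma connectingₗ_injective {k : ℕ} (h : Subsingleton (ExtDual A N' k)) :
    Function.Injective (connectingₗ hf hg hfg k) := by
  refine (injective_iff_map_eq_zero _).2 fun x hx => ?_
  obtain ⟨y, rfl⟩ := exists_map_eq_of_connecting_eq_zero hf hg hfg hx
  rw [Subsingleton.elim y 0, AddMonoidHom.map_zero]

lemma connectingₗ_surjective {k : ℕ} (h : Subsingleton (ExtDual A N' (k + 1))) :
    Function.Surjective (connectingₗ hf hg hfg k) := fun _ =>
  exists_connecting_eq_of_map_eq_zero hf hg hfg (Subsingleton.elim _ _)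

include hg in
lemma transpose_injective : Function.Injective (transpose g) := fun φ ψ h =>
  LinearMap.ext fun y => by
    obtain ⟨x, rfl⟩ := hg y
    exact LinearMap.congr_fun h x

include hg hfg in
lemma exact_transpose : Function.Exact (transpose g) (transpose f) := fun φ => by
  constructor
  · intro h
    have h1 : LinearMap.ker g ≤ LinearMap.ker φ := by
      intro x hx
      obtain ⟨y, rfl⟩ := (hfg x).1 hx
      exact LinearMap.congr_fun h y
    refine ⟨(LinearMap.ker g).liftQ φ h1 ∘ₗ (g.quotKerEquivOfSurjective hg).symm.toLinearMap, ?_⟩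
    refine LinearMap.ext fun x => ?_
    have h2 : (g.quotKerEquivOfSurjective hg).symm (g x) = Submodule.Quotient.mk x := by
      rw [LinearEquiv.symm_apply_eq]
      rfl
    change (LinearMap.ker g).liftQ φ h1 ((g.quotKerEquivOfSurjective hg).symm (g x)) = φ x
    rw [h2]
    rfl
  · rintro ⟨ψ, rfl⟩
    refine LinearMap.ext fun x => ?_
    change ψ (g (f x)) = 0
    rw [hfg.apply_apply_eq_zero, map_zero]

lemma exact_transpose_connectingₗ :
    Function.Exact (transpose f) (connectingₗ hf hg hfg 0 ∘ₗ zeroEquiv.toLinearMap) := fun φ => by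
  constructor
  · intro h
    obtain ⟨y, hy⟩ := exists_map_eq_of_connecting_eq_zero hf hg hfg (x := ofLinear φ) h
    obtain ⟨ψ, rfl⟩ := ofLinear_surjective y
    rw [map_ofLinear] at hy
    exact ⟨ψ, ofLinear_injective hy⟩
  · rintro ⟨ψ, rfl⟩
    change connecting hf hg hfg 0 (ofLinear (ψ ∘ₗ f)) = 0
    rw [← map_ofLinear, connecting_map]

variable {E : Type u} [AddCommGroup E] [Module Aᵐᵒᵖ E]

lemma subsingleton_ext_dual_pi {n k : ℕ}
    (h : Subsingleton (Ext (ModuleCat.of Aᵐᵒᵖ E) (ModuleCat.of Aᵐᵒᵖ Aᵐᵒᵖ) k)) :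
    Subsingleton (Ext (ModuleCat.of Aᵐᵒᵖ E) (ModuleCat.of Aᵐᵒᵖ ((Fin n → A) →ₗ[A] A)) k) := by
  let p : Fin n → ((Fin n → A) →ₗ[A] A) →ₗ[Aᵐᵒᵖ] Aᵐᵒᵖ := fun i =>
    { toFun := fun φ => MulOpposite.op (φ (Pi.single i 1))
      map_add' := fun _ _ => rfl
      map_smul' := fun _ _ => rfl }
  let q : Fin n → Aᵐᵒᵖ →ₗ[Aᵐᵒᵖ] ((Fin n → A) →ₗ[A] A) := fun i =>
    { toFun := fun b =>
        { toFun := fun x => x i * b.unop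
          map_add' := fun x y => add_mul _ _ _
          map_smul' := fun a x => mul_assoc _ _ _ }
      map_add' := fun b c => LinearMap.ext fun x => mul_add _ _ _
      map_smul' := fun b c => LinearMap.ext fun x => (mul_assoc _ _ _).symm }
  refine subsingleton_ext_of_retract p q (LinearMap.ext fun φ => LinearMap.ext fun x => ?_) h
  have hx : x = ∑ i, x i • (Pi.single i 1 : Fin n → A) := by
    funext j
    simp [Pi.single_apply]
  conv_rhs => rw [LinearMap.id_apply, hx, map_sum]
  rw [LinearMap.sum_apply, LinearMap.sum_apply]
  refine Finset.sum_congr rfl fun i _ => ?_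
  rw [map_smul]
  rfl

/-- A module whose dual vanishes has no nonzero maps to the dual of a finite module. -/
lemma subsingleton_ext_zero_dual [Module.Finite A N]
    (h : Subsingleton (Ext (ModuleCat.of Aᵐᵒᵖ E) (ModuleCat.of Aᵐᵒᵖ Aᵐᵒᵖ) 0)) :
    Subsingleton (Ext (ModuleCat.of Aᵐᵒᵖ E) (ModuleCat.of Aᵐᵒᵖ (N →ₗ[A] A)) 0) := by
  obtain ⟨n, π, hπ⟩ := Module.Finite.exists_fin' A N
  have h1 := subsingleton_ext_zero_iff.1 (subsingleton_ext_dual_pi (n := n) h)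
  refine subsingleton_ext_zero_iff.2 fun φ => LinearMap.ext fun x => transpose_injective hπ ?_
  exact LinearMap.congr_fun (h1 (transpose π ∘ₗ φ)) x

/-- Form of `linearMap_extDual_eq_zero` suited to induction. Vanishing of the dual `N*` is not
inherited by the kernel `K` of a free cover `F → N`. Vanishing of `Ext^i(E, N*)` passes to `K`, in
one degree fewer, along `0 → N* → F* → K* → 0`, while the group `Ext^{k+2}(N, A)` becomes
`Ext^{k+1}(K, A)`. -/
lemma linearMap_extDual_succ_eq_zero [IsNoetherianRing A] (k : ℕ)
    (hE : ∀ i ≤ k + 1, Subsingleton (Ext (ModuleCat.of Aᵐᵒᵖ E) (ModuleCat.of Aᵐᵒᵖ Aᵐᵒᵖ) i))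
    (N : Type u) [AddCommGroup N] [Module A N] [Module.Finite A N]
    (hN : ∀ i < k, Subsingleton (ExtDual A N (i + 1)))
    (hEN : ∀ i ≤ k + 2,
      Subsingleton (Ext (ModuleCat.of Aᵐᵒᵖ E) (ModuleCat.of Aᵐᵒᵖ (N →ₗ[A] A)) i))
    (φ : E →ₗ[Aᵐᵒᵖ] ExtDual A N (k + 1)) : φ = 0 := by
  induction k generalizing N with
  | zero =>
    obtain ⟨n, π, hπ⟩ := Module.Finite.exists_fin' A N
    have hi := (LinearMap.ker π).subtype_injective
    have hex := LinearMap.exact_subtype_ker_map π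
    let t := transpose (LinearMap.ker π).subtype
    -- The range of `t` is `F* / N*`, and `Ext^1(N, A)` is the quotient of `K*` by this range.
    have h1 : Subsingleton (Ext (ModuleCat.of Aᵐᵒᵖ E) (ModuleCat.of Aᵐᵒᵖ (LinearMap.range t)) 1) :=
      subsingleton_ext_of_shortExact (f := transpose π) (g := t.rangeRestrict)
        (transpose_injective hπ) t.surjective_rangeRestrict
        (fun ψ => by
          rw [← exact_transpose hπ hex ψ, ← Subtype.val_inj]
          rfl)
        (subsingleton_ext_dual_pi (hE 1 le_rfl)) (hEN 2 le_rfl)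
    have h2 := subsingleton_ext_of_shortExact (f := (LinearMap.range t).subtype)
        (g := connectingₗ hi hπ hex 0 ∘ₗ zeroEquiv.toLinearMap)
        (LinearMap.range t).subtype_injective
        ((connectingₗ_surjective hi hπ hex (subsingleton_of_projective 0)).comp
          zeroEquiv.surjective)
        (fun ψ => by
          rw [exact_transpose_connectingₗ hi hπ hex ψ, Submodule.coe_subtype,
            Subtype.range_coe]
          rfl)
        (subsingleton_ext_zero_dual (hE 0 (by omega))) h1
    exact subsingleton_ext_zero_iff.1 h2 φ
  | succ k ih =>
    obtain ⟨n, π, hπ⟩ := Module.Finite.exists_fin' A N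
    have hi := (LinearMap.ker π).subtype_injective
    have hex := LinearMap.exact_subtype_ker_map π
    have hinj := connectingₗ_injective hi hπ hex (k := k + 1) (subsingleton_of_projective k)
    have hsurj := connectingₗ_surjective hi hπ hex (k := k + 1) (subsingleton_of_projective _)
    let e := LinearEquiv.ofBijective _ ⟨hinj, hsurj⟩
    -- `Ext^1(N, A) = 0`, so every form on the kernel extends to the free module.
    have h1 : Function.Surjective (transpose (LinearMap.ker π).subtype) := by
      intro χ
      refine (exact_transpose_connectingₗ hi hπ hex χ).1 ?_
      have := hN 0 (by omega)
      exact Subsingleton.elim _ _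
    have h2 := ih (fun i hi => hE i (by omega)) (LinearMap.ker π)
      (fun i hik => subsingleton_left hi hπ hex (subsingleton_of_projective i)
        (hN (i + 1) (by omega)))
      (fun i hik => subsingleton_ext_of_shortExact (transpose_injective hπ) h1
        (exact_transpose hπ hex) (subsingleton_ext_dual_pi (hE i (by omega)))
        (hEN (i + 1) (by omega)))
      (e.symm.toLinearMap ∘ₗ φ)
    refine LinearMap.ext fun x => e.symm.injective ?_
    rw [LinearMap.zero_apply, map_zero]
    exact LinearMap.congr_fun h2 x

/-- If `Ext^i_A(N, A) = 0` for `i < k` and `Ext^i(E, A) = 0` for `i ≤ k`, then every map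
`E → Ext^k_A(N, A)` vanishes. -/
lemma linearMap_extDual_eq_zero [IsNoetherianRing A] {k : ℕ}
    (hE : ∀ i ≤ k, Subsingleton (Ext (ModuleCat.of Aᵐᵒᵖ E) (ModuleCat.of Aᵐᵒᵖ Aᵐᵒᵖ) i))
    [Module.Finite A N] (hN : ∀ i < k, Subsingleton (ExtDual A N i))
    (φ : E →ₗ[Aᵐᵒᵖ] ExtDual A N k) : φ = 0 := by
  cases k with
  | zero =>
    have h1 := subsingleton_ext_zero_iff.1 (subsingleton_ext_zero_dual (N := N) (hE 0 le_rfl))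
      (zeroEquiv.symm.toLinearMap ∘ₗ φ)
    refine LinearMap.ext fun x => zeroEquiv.symm.injective ?_
    rw [LinearMap.zero_apply, map_zero]
    exact LinearMap.congr_fun h1 x
  | succ k =>
    have h0 : Subsingleton (N →ₗ[A] A) :=
      subsingleton_of_forall_eq 0 (subsingleton_zero_iff.1 (hN 0 (by omega)))
    exact linearMap_extDual_succ_eq_zero k hE N (fun i hi => hN (i + 1) (by omega))
      (fun i _ => subsingleton_ext_of_subsingleton h0) φ

end Dual

section Grade

variable {A : Type u} [Ring A]

lemma le_moduleGrade_iff {N : Type u} [AddCommGroup N] [Module A N] {k : ℕ} :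
    (k : ℕ∞) ≤ moduleGrade A N ↔ ∀ i < k, Subsingleton (ExtDual A N i) := by
  rw [moduleGrade, le_sInf_iff]
  constructor
  · intro h i hi
    by_contra h1
    have := h i ⟨i, not_subsingleton_iff_nontrivial.1 h1, rfl⟩
    exact absurd (Nat.cast_le.1 this) (not_le.2 hi)
  · rintro h _ ⟨i, hi, rfl⟩
    refine Nat.cast_le.2 (not_lt.1 fun hik => ?_)
    exact not_subsingleton_iff_nontrivial.2 hi (h i hik)

/-- Over a noetherian ring with the Auslander condition, the grade of a submodule is at least the
grade of the module. -/
theorem subsingleton_submodule [IsNoetherianRing A]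
    (hA : AuslanderCondition A Aᵐᵒᵖ (RingEquiv.refl Aᵐᵒᵖ))
    {M : Type u} [AddCommGroup M] [Module A M] [Module.Finite A M] {j : ℕ}
    (hM : ∀ i < j, Subsingleton (ExtDual A M i)) (N : Submodule A M) :
    ∀ i < j, Subsingleton (ExtDual A N i) := by
  intro i
  induction i using Nat.strongRecOn with
  | ind i ih =>
    intro hij
    have hi := N.subtype_injective
    have hπ := N.mkQ_surjective
    have hex := LinearMap.exact_subtype_mkQ N
    let δ := connectingₗ hi hπ hex i
    have hinj : Function.Injective δ := connectingₗ_injective hi hπ hex (hM i hij)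
    -- `Ext^i(N, A)` embeds into `Ext^{i+1}(M ⧸ N, A)`, so its image has grade at least `i + 1`. By
    -- induction the lower Ext groups of `N` vanish, so the inverse map from this image to `Ext^i(N,
    -- A)` is zero although it is bijective.
    have h1 : ((i + 1 : ℕ) : ℕ∞) ≤ moduleGrade Aᵐᵒᵖ (LinearMap.range δ) :=
      hA (M ⧸ N) inferInstance (i + 1) (LinearMap.range δ)
    have h2 := le_moduleGrade_iff.1 h1
    let e := LinearEquiv.ofInjective δ hinj
    have h3 := linearMap_extDual_eq_zero (fun l hl => h2 l (by omega))
      (fun l hl => ih l hl (by omega)) e.symm.toLinearMap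
    refine subsingleton_of_forall_eq 0 fun x => ?_
    rw [← e.symm_apply_apply x]
    exact LinearMap.congr_fun h3 (e x)

end Grade

end ExtDual

/-! ### Codimension classes and grades. -/

theorem proposition3p2 {R : Type u} [Ring R] [UniformSpace R] [IsPseudocompactRing R]
    [IsNoetherianRing R] [IsNoetherianRing Rᵐᵒᵖ] (D : SkewDerivation R)
    [IsNoetherianRing (SkewPowerSeries D)] [IsNoetherianRing (SkewPowerSeries D)ᵐᵒᵖ]
    (hR : IsAuslanderRegular R) (hS : IsAuslanderRegular (SkewPowerSeries D))
    (M : Type u) [AddCommGroup M] [Module R M] [Module (SkewPowerSeries D) M]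
    [IsScalarTower R (SkewPowerSeries D) M] [Module.Finite R M] :
    (∀ j : ℕ, MemCodim R j M ↔ MemCodim (SkewPowerSeries D) (j + 1) M) ∧
      moduleGrade (SkewPowerSeries D) M = moduleGrade R M + 1 := by
  -- The extra degree over the power series ring is degree zero, where Ext always vanishes.
  have hgrade : ∀ (N : Type u) [AddCommGroup N] [Module R N] [Module (SkewPowerSeries D) N]
      [IsScalarTower R (SkewPowerSeries D) N] [Module.Finite R N] (j : ℕ),
      (∀ i < j + 1, Subsingleton (ExtDual (SkewPowerSeries D) N i)) ↔
        ∀ i < j, Subsingleton (ExtDual R N i) := by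
    intro N _ _ _ _ _ j
    constructor
    · intro h i hi
      exact (SkewPowerSeries.subsingleton_extDual_succ_iff N i).1 (h (i + 1) (by omega))
    · intro h i hi
      cases i with
      | zero => exact SkewPowerSeries.subsingleton_extDual_zero N
      | succ i => exact (SkewPowerSeries.subsingleton_extDual_succ_iff N i).2 (h i (by omega))
  refine ⟨fun j => ⟨fun h => ⟨Module.Finite.of_restrictScalars_finite R _ _, fun N => ?_⟩,
    fun h => ⟨inferInstance, ?_⟩⟩, ?_⟩
  · have := SkewPowerSeries.finite_submodule M N
    exact (hgrade N j).2 (h.2 (N.restrictScalars R))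
  -- An `R`-submodule need not be stable under `t`, so only the vanishing for `M` itself is
  -- transferred. The Auslander condition extends it to all `R`-submodules.
  · refine ExtDual.subsingleton_submodule hR.left_auslander ?_
    rw [← hgrade M j]
    intro i hi
    exact ExtDual.subsingleton_of_linearEquiv Submodule.topEquiv (h.2 ⊤ i hi)
  -- Comparing natural lower bounds treats finite and infinite grades together.
  · refine ENat.eq_of_forall_natCast_le_iff fun k => ?_
    cases k with
    | zero => simp
    | succ j =>
      rw [ExtDual.le_moduleGrade_iff, hgrade M j, ← ExtDual.le_moduleGrade_iff, Nat.cast_succ,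
        ENat.add_le_add_iff_right ENat.one_ne_top]
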